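/- **Setting.** An operational probabilistic theory (OPT) consists of systems, transformations between systems, sequential composition $\circ$, a symmetric parallel composition $\otimes$ with trivial system $\mathrm I$, and tests, i.e. certain finite families of transformations $\{\mathcal C_i\}_{i\in\mathsf X}$ from $\mathrm A$ to $\mathrm B$. States of $\mathrm A$ are transformations $\mathrm I\to\mathrm A$, effects are transformations $\mathrm A\to\mathrm I$; scalars are numbers in $[0,1]$, tests of $\mathrm I$ are the finite probability distributions, and $(a|\rho)$ is the scalar $a\circ\rho$. Tests are closed under sequential and parallel composition and under coarse-graining (adding up the members in each block of a partition of the outcomes). A member of a one-outcome test is a channel; identities and the structural identifications (associativity, unit, swap) are channels. A channel $\mathcal U:\mathrm A\to\mathrm B$ is reversible if it has a two-sided inverse channel $\mathcal U^{-1}$. Sets of transformations span real vector spaces $\mathsf{Transf}_{\mathbb R}(\mathrm A,\mathrm B)$, on which both compositions are (bi)linear, and whose elements are determined by the probabilities they give on states and effects of $\mathrm A\otimes\mathrm S$ and $\mathrm B\otimes\mathrm S$ for all systems $\mathrm S$. Write $\mathsf{St}_{\mathbb R}(\mathrm A)$, $\mathsf{Eff}_{\mathbb R}(\mathrm A)$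 for the spans of states and effects; each $\mathsf{St}_{\mathbb R}(\mathrm A)$ is finite-dimensional, and the set of states is closed in it. The norms are $\|\rho\|=\sup_a(a|\rho)$ and $\|a\|=\sup_\rho(a|\rho)$, over all effects, respectively states; norm $1$ means normalised. A transformation $\mathcal C$ is pure if, whenever $\mathcal C=\sum_{j\in\mathsf S}\mathcal D_j$ for a non-empty set $\mathsf S$ of outcomes of a test $\{\mathcal D_j\}$, one has $\mathcal D_j=p_j\mathcal C$ for all $j\in\mathsf S$ with some probability distribution $\{p_j\}_{j\in\mathsf S}$. A sharp theory with purification is an OPT that satisfies: * *Causality*: every system $\mathrm A$ has a unique deterministic effect $u_{\mathrm A}$ (and, as usual in causal theories, the choice of a later test may depend on the outcome of an earlier one); * *Purity Preservation*: sequential and parallel compositions of pure transformations are pure; * *Pure Sharpness*: every system has a pure effect $a$ and a state $\rho$ with $(a|\rho)=1$; * *Purification*: every normalised state $\rho$ of $\mathrm A$ has a purification, i.e. a normalised pure state $\Psi$ of some $\mathrm A\otimes\mathrm B$ with $(\mathcal I_{\mathrm A}\otimes u_{\mathrm B})\Psi=\rho$; and if $\Psi,\Psi'$ are purifications of $\rho$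 with the same purifying system $\mathrm B$, then $\Psi'=(\mathcal I_{\mathrm A}\otimes\mathcal U)\Psi$ for a reversible channel $\mathcal U$ on $\mathrm B$. **Proposition.** In a sharp theory with purification, every system $\mathrm A$ has a unique dagger, i.e. there is exactly one linear map $\dagger:\mathsf{St}_{\mathbb R}(\mathrm A)\to\mathsf{Eff}_{\mathbb R}(\mathrm A)$ such that, for every normalised pure state $\alpha$, $\alpha^\dagger$ is the unique normalised pure effect with $(\alpha^\dagger|\alpha)=1$. The bilinear form $\langle\xi,\eta\rangle:=(\xi^\dagger|\eta)$ defined by it (called the self-dualising inner product of $\mathrm A$) is invariant under reversible channels: for every reversible channel $\mathcal U:\mathrm A\to\mathrm B$ and all $\xi,\eta\in\mathsf{St}_{\mathbb R}(\mathrm A)$, $$\langle\mathcal U\xi,\mathcal U\eta\rangle=\langle\xi,\eta\rangle .$$ -/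

import Mathlib

open CategoryTheory MonoidalCategory Filter Topology

universe v u

/-- The raw data of an operational probabilistic theory.  The ambient category `C` is the symmetric
monoidal, `ℝ`-linear category whose objects are the systems and whose hom-spaces are the real vector
spaces `Transf_ℝ(A, B)` spanned by the physical transformations; `𝟙_ C` is the trivial system, so
`𝟙_ C ⟶ A` is `St_ℝ(A)` and `A ⟶ 𝟙_ C` is `Eff_ℝ(A)`.  `IsTest D` says that the finite family `D`
is a test, and `prob` reads off the real number that a scalar stands for. -/
structure ProbTheory (C : Type u) [Category.{v} C] [MonoidalCategory C] [Preadditive C]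
    [Linear ℝ C] where
  prob : (𝟙_ C ⟶ 𝟙_ C) →ₗ[ℝ] ℝ
  IsTest : ∀ {A B : C} {X : Type} [Fintype X], (X → (A ⟶ B)) → Prop

namespace ProbTheory

section Basic

variable {C : Type u} [Category.{v} C] [MonoidalCategory C] [Preadditive C] [Linear ℝ C]

/-- The pairing `(a|ξ)`. -/
def pair (T : ProbTheory C) {A : C} (a : A ⟶ 𝟙_ C) (ξ : 𝟙_ C ⟶ A) : ℝ := T.prob (ξ ≫ a)

/-- `f ∈ Transf(A, B)`: `f` is one of the members of some test. -/
def IsTransf (T : ProbTheory C) {A B : C} (f : A ⟶ B) : Prop :=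
  ∃ (X : Type) (_ : Fintype X) (D : X → (A ⟶ B)) (i : X), T.IsTest D ∧ D i = f

/-- `ρ ∈ St(A)`. -/
def IsState (T : ProbTheory C) {A : C} (ρ : 𝟙_ C ⟶ A) : Prop := T.IsTransf ρ

/-- `a ∈ Eff(A)`. -/
def IsEffect (T : ProbTheory C) {A : C} (a : A ⟶ 𝟙_ C) : Prop := T.IsTransf a

/-- A channel is a deterministic transformation: the only member of a one-outcome test. -/
def IsChannel (T : ProbTheory C) {A B : C} (f : A ⟶ B) : Prop := T.IsTest (fun _ : Unit => f)

/-- Reversible channels. -/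
def IsReversible (T : ProbTheory C) {A B : C} (U : A ⟶ B) : Prop :=
  T.IsChannel U ∧ ∃ V : B ⟶ A, T.IsChannel V ∧ U ≫ V = 𝟙 A ∧ V ≫ U = 𝟙 B

/-- Pure transformations: every refinement `(D j)_{j ∈ S}` of `f` (a block of a test that is
coarse-grained to `f`) is trivial, `D j = p j • f` with `p` a probability distribution on `S`. -/
def IsPure (T : ProbTheory C) {A B : C} (f : A ⟶ B) : Prop :=
  T.IsTransf f ∧
    ∀ (Y : Type) [Fintype Y] (D : Y → (A ⟶ B)) (S : Finset Y),
      T.IsTest D → S.Nonempty → ∑ j ∈ S, D j = f →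
        ∃ p : Y → ℝ, (∀ j ∈ S, 0 ≤ p j) ∧ ∑ j ∈ S, p j = 1 ∧ ∀ j ∈ S, D j = p j • f

/-- The operational norm of a state, `‖ρ‖ = sup {(a|ρ) : a ∈ Eff(A)}`. -/
noncomputable def stateNorm (T : ProbTheory C) {A : C} (ρ : 𝟙_ C ⟶ A) : ℝ :=
  sSup {x : ℝ | ∃ a : A ⟶ 𝟙_ C, T.IsEffect a ∧ x = T.pair a ρ}

/-- The operational norm of an effect, `‖a‖ = sup {(a|ρ) : ρ ∈ St(A)}`. -/
noncomputable def effectNorm (T : ProbTheory C) {A : C} (a : A ⟶ 𝟙_ C) : ℝ :=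
  sSup {x : ℝ | ∃ ρ : 𝟙_ C ⟶ A, T.IsState ρ ∧ x = T.pair a ρ}

/-- `ρ ∈ St₁(A)`. -/
def IsNormState (T : ProbTheory C) {A : C} (ρ : 𝟙_ C ⟶ A) : Prop :=
  T.IsState ρ ∧ T.stateNorm ρ = 1

/-- `α ∈ PurSt₁(A)`. -/
def IsPureNormState (T : ProbTheory C) {A : C} (α : 𝟙_ C ⟶ A) : Prop :=
  T.IsPure α ∧ T.stateNorm α = 1

/-- `a ∈ PurEff₁(A)`. -/
def IsPureNormEffect (T : ProbTheory C) {A : C} (a : A ⟶ 𝟙_ C) : Prop :=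
  T.IsPure a ∧ T.effectNorm a = 1

/-- `Ψ ∈ PurSt₁(A ⊗ B)` is a purification of `ρ`: discarding the purifying system `B` with the
deterministic effect of `B` gives `ρ`. -/
def IsPurification (T : ProbTheory C) {A B : C} (Ψ : 𝟙_ C ⟶ A ⊗ B) (ρ : 𝟙_ C ⟶ A) : Prop :=
  T.IsPureNormState Ψ ∧
    ∃ e : B ⟶ 𝟙_ C, T.IsChannel e ∧ Ψ ≫ (A ◁ e) ≫ (ρ_ A).hom = ρ

/-- `D` is the dagger of the system `A`: the linear map `St_ℝ(A) → Eff_ℝ(A)` that sends each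
normalised pure state `α` to the unique normalised pure effect `α†` with `(α†|α) = 1`. -/
def IsDagger (T : ProbTheory C) (A : C) (D : (𝟙_ C ⟶ A) →ₗ[ℝ] (A ⟶ 𝟙_ C)) : Prop :=
  ∀ α : 𝟙_ C ⟶ A, T.IsPureNormState α →
    T.IsPureNormEffect (D α) ∧ T.pair (D α) α = 1 ∧
      ∀ b : A ⟶ 𝟙_ C, T.IsPureNormEffect b → T.pair b α = 1 → b = D α

/-- The dagger `ξ ↦ ξ†` of the system `A`.  (That a map with the property `IsDagger` exists and is
unique is to be proved; otherwise the value is arbitrary.) -/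
noncomputable def dagger (T : ProbTheory C) (A : C) : (𝟙_ C ⟶ A) →ₗ[ℝ] (A ⟶ 𝟙_ C) :=
  Classical.epsilon (T.IsDagger A)

/-- `⟨ξ, η⟩ = (ξ†|η)` on `St_ℝ(A)`. -/
noncomputable def daggerInner (T : ProbTheory C) {A : C} (ξ η : 𝟙_ C ⟶ A) : ℝ :=
  T.pair (T.dagger A ξ) η

end Basic

section Axioms

variable {C : Type u} [Category.{v} C] [MonoidalCategory C] [SymmetricCategory C]
  [Preadditive C] [Linear ℝ C] [MonoidalPreadditive C] [MonoidalLinear ℝ C]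

/-- The laws of an operational probabilistic theory with finite systems and closed state sets. -/
structure IsOPT (T : ProbTheory C) : Prop where
  /-- Scalars are real numbers, the identity of the trivial system being the number `1`. -/
  prob_id : T.prob (𝟙 (𝟙_ C)) = 1
  prob_injective : Function.Injective T.prob
  /-- The tests of the trivial system are the finite probability distributions. -/
  scalar_test : ∀ (X : Type) [Fintype X] (s : X → (𝟙_ C ⟶ 𝟙_ C)),
    T.IsTest s ↔ (∀ i, 0 ≤ T.prob (s i)) ∧ ∑ i, T.prob (s i) = 1
  /-- Doing nothing, rebracketing, adding or removing the trivial system, and swapping two systems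
  are deterministic. -/
  id_channel : ∀ A : C, T.IsChannel (𝟙 A)
  assoc_hom_channel : ∀ A B D : C, T.IsChannel (α_ A B D).hom
  assoc_inv_channel : ∀ A B D : C, T.IsChannel (α_ A B D).inv
  left_hom_channel : ∀ A : C, T.IsChannel (λ_ A).hom
  left_inv_channel : ∀ A : C, T.IsChannel (λ_ A).inv
  right_hom_channel : ∀ A : C, T.IsChannel (ρ_ A).hom
  right_inv_channel : ∀ A : C, T.IsChannel (ρ_ A).inv
  braiding_channel : ∀ A B : C, T.IsChannel (β_ A B).hom
  /-- Sequential composition of tests. -/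
  seq_test : ∀ (A B D : C) (X Y : Type) [Fintype X] [Fintype Y]
    (f : X → (A ⟶ B)) (g : Y → (B ⟶ D)),
    T.IsTest f → T.IsTest g → T.IsTest (fun z : X × Y => f z.1 ≫ g z.2)
  /-- Parallel composition of tests. -/
  par_test : ∀ (A B A' B' : C) (X Y : Type) [Fintype X] [Fintype Y]
    (f : X → (A ⟶ B)) (g : Y → (A' ⟶ B')),
    T.IsTest f → T.IsTest g → T.IsTest (fun z : X × Y => f z.1 ⊗ₘ g z.2)
  /-- Coarse-graining: outcomes of a test may be joined along a map of outcome sets. -/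
  coarse_test : ∀ (A B : C) (X Y : Type) [Fintype X] [Fintype Y] [DecidableEq X]
    (D : Y → (A ⟶ B)) (f : Y → X), Function.Surjective f →
    T.IsTest D → T.IsTest (fun i : X => ∑ j with f j = i, D j)
  /-- The transformations span the vector space `Transf_ℝ(A, B)`. -/
  span_transf : ∀ A B : C, Submodule.span ℝ {f : A ⟶ B | T.IsTransf f} = ⊤
  /-- Elements of `Transf_ℝ(A, B)` are characterised by the probabilities they give when applied to
  one part of a composite system. -/
  separated : ∀ (A B : C) (f : A ⟶ B),
    (∀ (S : C) (ρ : 𝟙_ C ⟶ A ⊗ S) (E : B ⊗ S ⟶ 𝟙_ C),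
      T.IsState ρ → T.IsEffect E → T.prob (ρ ≫ (f ▷ S) ≫ E) = 0) → f = 0
  /-- Systems are finite. -/
  finite_system : ∀ A : C, FiniteDimensional ℝ (𝟙_ C ⟶ A)
  /-- The set of states is closed.  As `St_ℝ(A)` is finite-dimensional and separated by effects, its
  topology is the one of convergence of the probabilities of all effects. -/
  closed_states : ∀ (A : C) (ρ : ℕ → (𝟙_ C ⟶ A)) (ξ : 𝟙_ C ⟶ A),
    (∀ n, T.IsState (ρ n)) →
    (∀ a : A ⟶ 𝟙_ C, T.IsEffect a →
      Tendsto (fun n => T.pair a (ρ n)) atTop (𝓝 (T.pair a ξ))) →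
    T.IsState ξ

/-- Causal theories: every system has a unique deterministic effect, and, as usual in a causal
theory, the choice of a later test may depend on the outcome of an earlier one. -/
structure IsCausal (T : ProbTheory C) : Prop where
  unique_deterministic_effect : ∀ A : C, ∃! e : A ⟶ 𝟙_ C, T.IsChannel e
  conditioned_test : ∀ (A B D : C) (X : Type) [Fintype X] (Y : X → Type) [∀ i, Fintype (Y i)]
    (f : X → (A ⟶ B)) (g : (i : X) → Y i → (B ⟶ D)),
    T.IsTest f → (∀ i, T.IsTest (g i)) →
    T.IsTest (fun z : (i : X) × Y i => f z.1 ≫ g z.1 z.2)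

/-- Sharp theories with purification: causal operational probabilistic theories that satisfy Purity
Preservation, Pure Sharpness and Purification. -/
structure IsSharpWithPurification (T : ProbTheory C) : Prop where
  isOPT : T.IsOPT
  causality : T.IsCausal
  purity_preservation_seq : ∀ (A B D : C) (f : A ⟶ B) (g : B ⟶ D),
    T.IsPure f → T.IsPure g → T.IsPure (f ≫ g)
  purity_preservation_par : ∀ (A B A' B' : C) (f : A ⟶ B) (g : A' ⟶ B'),
    T.IsPure f → T.IsPure g → T.IsPure (f ⊗ₘ g)
  pure_sharpness : ∀ A : C, ∃ a : A ⟶ 𝟙_ C, T.IsPure a ∧ ∃ ρ : 𝟙_ C ⟶ A, T.IsState ρ ∧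
    T.pair a ρ = 1
  purification_exists : ∀ (A : C) (ρ : 𝟙_ C ⟶ A), T.IsNormState ρ →
    ∃ (B : C) (Ψ : 𝟙_ C ⟶ A ⊗ B), T.IsPurification Ψ ρ
  purification_unique : ∀ (A B : C) (ρ : 𝟙_ C ⟶ A) (Ψ Ψ' : 𝟙_ C ⟶ A ⊗ B),
    T.IsPurification Ψ ρ → T.IsPurification Ψ' ρ →
    ∃ U : B ⟶ B, T.IsReversible U ∧ Ψ' = Ψ ≫ (A ◁ U)

end Axioms

end ProbTheory

/-!
States of a sharp theory with purification form a closed cone, generated by the pure states, on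
which reversible channels act transitively: pure states of `A` purify the trivial system
(`exists_reversible_pure`).

*The effect `α†`.* A purification `Φ` turns effects of `A` into vectors `lmap Φ e` of the purifying
system and effects of that system into vectors `rmap Φ b` of `A`. By Purity Preservation these
assignments send pure effects to multiples of pure states. For a purification of a state that is
invariant under reversible channels, following a pure effect `a` with `(a|α) = 1` to the other
system and back shows that `a` is determined by `α` (`sharp_unique`); this gives `dag α`. The same
argument shows that a state `ρ` minus `p • α` is still positive when `α†` has the largest
probability `p` among all `ψ†` on `ρ` (`inCone_sub_of_max`). Applied to the maximally mixed state,
it yields frames of orthogonal pure states (`exists_frame`), whose effects add up to the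
deterministic one (`sum_dag_frame`), and it shows that all pure effects are multiples of some `ψ†`
(`exists_dag_smul`).

*Symmetry.* The map `α ↦ α†` extends linearly because `(α†|α') = (α'†|α)` for pure `α`, `α'`
(`pair_dag_comm`): a linear map that agrees with it on a basis of pure states then agrees with it on
all pure states (`exists_linear_dag`). To prove the symmetry, one completes `α` and `α'` by
orthogonal pure states `ψ` and `κ` with `α + ψ = α' + κ` (`exists_common_sum`); this uses a pure
filter that occurs with the probability of `u - α†`. Integrating over the polar of the set of states
gives an inner product `Q` that is invariant under reversible channels (`exists_invariant_inner`),
so that all pure states have the same length `N`. The functional `Q α` is maximal at `α`, and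
therefore on the face spanned by `α` and `ψ` it is a combination of `α†` and `ψ†`
(`pair_eq_of_max`): `Q α α' = N (α†|α') + Q α ψ (1 - (α†|α'))`. The corresponding formula for `α'`
has the same constants, which are different from each other, and the symmetry of `Q` gives the
symmetry of the pairing.

Invariance of the inner product follows from the uniqueness of `(α ≫ U)†`.
-/

set_option linter.unusedSectionVars false

namespace ProbTheory

/-! ### Operational theories: closure properties of tests -/

section OPT

variable {C : Type u} [Category.{v} C] [MonoidalCategory C] [SymmetricCategory C]
  [Preadditive C] [Linear ℝ C] [MonoidalPreadditive C] [MonoidalLinear ℝ C] {T : ProbTheory C}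

theorem IsOPT.scalar_eq (h : T.IsOPT) (s : 𝟙_ C ⟶ 𝟙_ C) : s = T.prob s • 𝟙 (𝟙_ C) :=
  h.prob_injective (by simp [h.prob_id])

theorem IsOPT.test_reindex (h : T.IsOPT) {A B : C} {X Y : Type} [Fintype X] [Fintype Y]
    {D : Y → (A ⟶ B)} (hD : T.IsTest D) (e : X ≃ Y) : T.IsTest (fun x => D (e x)) := by
  classical
  have := h.coarse_test A B X Y D e.symm e.symm.surjective hD
  convert this using 2 with x
  rw [Finset.sum_eq_single (e x)]
  · intro b hb hne
    simp only [Finset.mem_filter, Finset.mem_univ, true_and] at hb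
    exact absurd (by rw [← hb]; simp) hne
  · intro hx
    simp at hx

theorem IsOPT.test_comp_channel (h : T.IsOPT) {A B D : C} {X : Type} [Fintype X]
    {f : X → (A ⟶ B)} {g : B ⟶ D} (hf : T.IsTest f) (hg : T.IsChannel g) :
    T.IsTest (fun x => f x ≫ g) :=
  h.test_reindex (h.seq_test A B D X Unit f (fun _ => g) hf hg) (Equiv.prodPUnit X).symm

theorem IsOPT.channel_comp_test (h : T.IsOPT) {A B D : C} {X : Type} [Fintype X]
    {f : A ⟶ B} {g : X → (B ⟶ D)} (hf : T.IsChannel f) (hg : T.IsTest g) :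
    T.IsTest (fun x => f ≫ g x) :=
  h.test_reindex (h.seq_test A B D Unit X (fun _ => f) g hf hg) (Equiv.punitProd X).symm

theorem IsOPT.test_whiskerRight (h : T.IsOPT) {A B : C} {X : Type} [Fintype X]
    {f : X → (A ⟶ B)} (hf : T.IsTest f) (S : C) : T.IsTest (fun x => f x ▷ S) := by
  have := h.test_reindex (h.par_test A B S S X Unit f (fun _ => 𝟙 S) hf (h.id_channel S))
    (Equiv.prodPUnit X).symm
  simpa using this

theorem IsOPT.test_whiskerLeft (h : T.IsOPT) {A B : C} {X : Type} [Fintype X]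
    {f : X → (A ⟶ B)} (hf : T.IsTest f) (S : C) : T.IsTest (fun x => S ◁ f x) := by
  have := h.test_reindex (h.par_test S S A B Unit X (fun _ => 𝟙 S) f (h.id_channel S) hf)
    (Equiv.punitProd X).symm
  simpa using this

theorem IsOPT.channel_comp (h : T.IsOPT) {A B D : C} {f : A ⟶ B} {g : B ⟶ D}
    (hf : T.IsChannel f) (hg : T.IsChannel g) : T.IsChannel (f ≫ g) :=
  h.test_comp_channel hf hg

theorem IsOPT.channel_whiskerRight (h : T.IsOPT) {A B : C} {f : A ⟶ B}
    (hf : T.IsChannel f) (S : C) : T.IsChannel (f ▷ S) := h.test_whiskerRight hf S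

theorem IsOPT.channel_whiskerLeft (h : T.IsOPT) {A B : C} {f : A ⟶ B}
    (hf : T.IsChannel f) (S : C) : T.IsChannel (S ◁ f) := h.test_whiskerLeft hf S

theorem IsChannel.isTransf {A B : C} {f : A ⟶ B} (hf : T.IsChannel f) : T.IsTransf f :=
  ⟨Unit, inferInstance, fun _ => f, (), hf, rfl⟩

theorem IsOPT.transf_comp (h : T.IsOPT) {A B D : C} {f : A ⟶ B} {g : B ⟶ D}
    (hf : T.IsTransf f) (hg : T.IsTransf g) : T.IsTransf (f ≫ g) := by
  obtain ⟨X, _, F, i, hF, rfl⟩ := hf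
  obtain ⟨Y, _, G, j, hG, rfl⟩ := hg
  exact ⟨X × Y, inferInstance, _, (i, j), h.seq_test A B D X Y F G hF hG, rfl⟩

theorem IsOPT.transf_whiskerRight (h : T.IsOPT) {A B : C} {f : A ⟶ B}
    (hf : T.IsTransf f) (S : C) : T.IsTransf (f ▷ S) := by
  obtain ⟨X, _, F, i, hF, rfl⟩ := hf
  exact ⟨X, inferInstance, _, i, h.test_whiskerRight hF S, rfl⟩

theorem IsOPT.transf_whiskerLeft (h : T.IsOPT) {A B : C} {f : A ⟶ B}
    (hf : T.IsTransf f) (S : C) : T.IsTransf (S ◁ f) := by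
  obtain ⟨X, _, F, i, hF, rfl⟩ := hf
  exact ⟨X, inferInstance, _, i, h.test_whiskerLeft hF S, rfl⟩

/-- A test may be randomised: it is preceded by a random choice that is part of the outcome. -/
theorem IsOPT.test_smul (h : T.IsOPT) {A B : C} {X Y : Type} [Fintype X] [Fintype Y]
    {D : X → (A ⟶ B)} (hD : T.IsTest D) {p : Y → ℝ} (hp : ∀ y, 0 ≤ p y) (hp1 : ∑ y, p y = 1) :
    T.IsTest (fun z : Y × X => p z.1 • D z.2) := by
  have hs : T.IsTest (fun y => p y • 𝟙 (𝟙_ C)) := by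
    rw [h.scalar_test]
    simpa [h.prob_id] using ⟨hp, hp1⟩
  have := h.test_comp_channel (h.channel_comp_test (h.left_inv_channel A)
    (h.par_test _ _ _ _ Y X _ D hs hD)) (h.left_hom_channel B)
  convert this using 2 with z
  simp [MonoidalCategory.tensorHom_def]

theorem IsOPT.prob_nonneg (h : T.IsOPT) {s : 𝟙_ C ⟶ 𝟙_ C} (hs : T.IsTransf s) :
    0 ≤ T.prob s := by
  obtain ⟨X, _, D, i, hD, rfl⟩ := hs
  exact ((h.scalar_test X D).1 hD).1 i

theorem IsOPT.sum_channel (h : T.IsOPT) {A B : C} {X : Type} [Fintype X] [Nonempty X]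
    {D : X → (A ⟶ B)} (hD : T.IsTest D) : T.IsChannel (∑ x, D x) := by
  have := h.coarse_test A B Unit X D (fun _ => ()) (fun _ => ⟨Classical.arbitrary X, rfl⟩) hD
  simpa [IsChannel] using this

/-- A block of outcomes of a test and its complement form a two-outcome test. -/
theorem IsOPT.test_block (h : T.IsOPT) {A B : C} {X : Type} [Fintype X]
    {D : X → (A ⟶ B)} (hD : T.IsTest D) {S : Finset X} (hS : S.Nonempty) :
    ∃ g : A ⟶ B, T.IsTest (fun b : Bool => bif b then ∑ j ∈ S, D j else g) := by
  classical
  -- The test is first followed by a dummy outcome of probability zero, so that both blocks are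
  -- inhabited.
  have h2 := h.test_smul hD (p := fun b : Bool => bif b then (1 : ℝ) else 0)
    (by rintro (_ | _) <;> simp) (by simp)
  obtain ⟨i, hi⟩ := hS
  have := h.coarse_test A B Bool (Bool × X) _ (fun z => z.1 && decide (z.2 ∈ S)) (by
    rintro (_ | _)
    · exact ⟨(false, i), by simp⟩
    · exact ⟨(true, i), by simp [hi]⟩) h2
  refine ⟨∑ z : Bool × X with (z.1 && decide (z.2 ∈ S)) = false,
    (bif z.1 then (1 : ℝ) else 0) • D z.2, ?_⟩
  convert this using 2 with b
  cases b
  · rfl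
  · simp only [cond_true]
    rw [Finset.sum_filter, Fintype.sum_prod_type]
    simp [← Finset.sum_filter]

theorem IsOPT.transf_compl (h : T.IsOPT) {A B : C} {f : A ⟶ B} (hf : T.IsTransf f) :
    ∃ g : A ⟶ B, T.IsTest (fun b : Bool => bif b then f else g) := by
  obtain ⟨X, _, D, i, hD, rfl⟩ := hf
  simpa using h.test_block hD (Finset.singleton_nonempty i)

theorem IsOPT.transf_smul (h : T.IsOPT) {A B : C} {f : A ⟶ B} (hf : T.IsTransf f) {p : ℝ}
    (h0 : 0 ≤ p) (h1 : p ≤ 1) : T.IsTransf (p • f) := by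
  obtain ⟨X, _, D, i, hD, rfl⟩ := hf
  have := h.test_smul hD (p := fun b : Bool => bif b then p else 1 - p)
    (by rintro (_ | _) <;> simp [h0, h1]) (by simp)
  exact ⟨_, inferInstance, _, (true, i), this, rfl⟩

theorem IsOPT.pair_nonneg (h : T.IsOPT) {A : C} {a : A ⟶ 𝟙_ C} {ρ : 𝟙_ C ⟶ A}
    (ha : T.IsEffect a) (hρ : T.IsState ρ) : 0 ≤ T.pair a ρ :=
  h.prob_nonneg (h.transf_comp hρ ha)

@[simp] theorem pair_add_left {A : C} (a b : A ⟶ 𝟙_ C) (ξ : 𝟙_ C ⟶ A) :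
    T.pair (a + b) ξ = T.pair a ξ + T.pair b ξ := by simp [pair]

@[simp] theorem pair_sub_left {A : C} (a b : A ⟶ 𝟙_ C) (ξ : 𝟙_ C ⟶ A) :
    T.pair (a - b) ξ = T.pair a ξ - T.pair b ξ := by simp [pair]

@[simp] theorem pair_smul_left {A : C} (r : ℝ) (a : A ⟶ 𝟙_ C) (ξ : 𝟙_ C ⟶ A) :
    T.pair (r • a) ξ = r * T.pair a ξ := by simp [pair]

@[simp] theorem pair_add_right {A : C} (a : A ⟶ 𝟙_ C) (ξ η : 𝟙_ C ⟶ A) :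
    T.pair a (ξ + η) = T.pair a ξ + T.pair a η := by simp [pair]

@[simp] theorem pair_sub_right {A : C} (a : A ⟶ 𝟙_ C) (ξ η : 𝟙_ C ⟶ A) :
    T.pair a (ξ - η) = T.pair a ξ - T.pair a η := by simp [pair]

@[simp] theorem pair_smul_right {A : C} (r : ℝ) (a : A ⟶ 𝟙_ C) (ξ : 𝟙_ C ⟶ A) :
    T.pair a (r • ξ) = r * T.pair a ξ := by simp [pair]

@[simp] theorem pair_zero_right {A : C} (a : A ⟶ 𝟙_ C) : T.pair a 0 = 0 := by simp [pair]

@[simp] theorem pair_zero_left {A : C} (ξ : 𝟙_ C ⟶ A) : T.pair 0 ξ = 0 := by simp [pair]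

theorem pair_sum_right {A : C} {ι : Type*} (s : Finset ι) (a : A ⟶ 𝟙_ C) (ξ : ι → (𝟙_ C ⟶ A)) :
    T.pair a (∑ i ∈ s, ξ i) = ∑ i ∈ s, T.pair a (ξ i) := by simp [pair, Preadditive.sum_comp]

theorem pair_sum_left {A : C} {ι : Type*} (s : Finset ι) (a : ι → (A ⟶ 𝟙_ C)) (ξ : 𝟙_ C ⟶ A) :
    T.pair (∑ i ∈ s, a i) ξ = ∑ i ∈ s, T.pair (a i) ξ := by simp [pair, Preadditive.comp_sum]

theorem pair_comp {A B : C} (f : A ⟶ B) (a : B ⟶ 𝟙_ C) (ξ : 𝟙_ C ⟶ A) :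
    T.pair (f ≫ a) ξ = T.pair a (ξ ≫ f) := by simp [pair]

/-- The pairing `(a|·)` as a linear functional. -/
noncomputable def pairR (T : ProbTheory C) {A : C} (a : A ⟶ 𝟙_ C) : (𝟙_ C ⟶ A) →ₗ[ℝ] ℝ where
  toFun := T.pair a
  map_add' := pair_add_right a
  map_smul' r := pair_smul_right r a

@[simp] theorem pairR_apply {A : C} (a : A ⟶ 𝟙_ C) (ξ : 𝟙_ C ⟶ A) :
    T.pairR a ξ = T.pair a ξ := rfl

theorem IsOPT.comp_eq_smul (h : T.IsOPT) {A : C} (ξ : 𝟙_ C ⟶ A) (a : A ⟶ 𝟙_ C) :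
    ξ ≫ a = T.pair a ξ • 𝟙 (𝟙_ C) := h.scalar_eq _

/-! ### Bipartite vectors as linear maps -/

/-- The vector of `B` that is left when the effect `e` is applied to the first factor. -/
def lmap {A B : C} (Φ : 𝟙_ C ⟶ A ⊗ B) (e : A ⟶ 𝟙_ C) : 𝟙_ C ⟶ B := Φ ≫ e ▷ B ≫ (λ_ B).hom

/-- The vector of `A` that is left when the effect `b` is applied to the second factor. -/
def rmap {A B : C} (Φ : 𝟙_ C ⟶ A ⊗ B) (b : B ⟶ 𝟙_ C) : 𝟙_ C ⟶ A := Φ ≫ A ◁ b ≫ (ρ_ A).hom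

theorem pair_lmap {A B : C} (Φ : 𝟙_ C ⟶ A ⊗ B) (e : A ⟶ 𝟙_ C) (b : B ⟶ 𝟙_ C) :
    T.pair b (lmap Φ e) = T.pair e (rmap Φ b) := by
  have h1 : (λ_ B).hom ≫ b = (𝟙_ C) ◁ b ≫ (λ_ _).hom := (leftUnitor_naturality b).symm
  have h2 : (ρ_ A).hom ≫ e = e ▷ (𝟙_ C) ≫ (ρ_ _).hom := (rightUnitor_naturality e).symm
  simp only [pair, lmap, rmap, Category.assoc, h1, h2, unitors_equal]
  rw [← whisker_exchange_assoc]

section linear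

variable {A B : C} (Φ Ψ : 𝟙_ C ⟶ A ⊗ B) (e e' : A ⟶ 𝟙_ C) (b b' : B ⟶ 𝟙_ C) (r : ℝ)

@[simp] theorem lmap_add : lmap Φ (e + e') = lmap Φ e + lmap Φ e' := by simp [lmap]
@[simp] theorem lmap_sub : lmap Φ (e - e') = lmap Φ e - lmap Φ e' := by
  rw [eq_sub_iff_add_eq, ← lmap_add, sub_add_cancel]
@[simp] theorem lmap_smul : lmap Φ (r • e) = r • lmap Φ e := by simp [lmap]
@[simp] theorem rmap_add : rmap Φ (b + b') = rmap Φ b + rmap Φ b' := by simp [rmap]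
@[simp] theorem rmap_sub : rmap Φ (b - b') = rmap Φ b - rmap Φ b' := by
  rw [eq_sub_iff_add_eq, ← rmap_add, sub_add_cancel]
@[simp] theorem lmap_add_state : lmap (Φ + Ψ) e = lmap Φ e + lmap Ψ e := by simp [lmap]
@[simp] theorem rmap_add_state : rmap (Φ + Ψ) b = rmap Φ b + rmap Ψ b := by simp [rmap]

end linear

theorem lmap_whiskerLeft {A B D : C} (Φ : 𝟙_ C ⟶ A ⊗ B) (g : B ⟶ D) (e : A ⟶ 𝟙_ C) :
    lmap (Φ ≫ A ◁ g) e = lmap Φ e ≫ g := by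
  simp only [lmap, Category.assoc]
  rw [whisker_exchange_assoc, leftUnitor_naturality]

theorem rmap_whiskerLeft {A B D : C} (Φ : 𝟙_ C ⟶ A ⊗ B) (g : B ⟶ D) (b : D ⟶ 𝟙_ C) :
    rmap (Φ ≫ A ◁ g) b = rmap Φ (g ≫ b) := by
  simp [rmap]

theorem lmap_braiding {A B : C} (Φ : 𝟙_ C ⟶ A ⊗ B) (b : B ⟶ 𝟙_ C) :
    lmap (Φ ≫ (β_ A B).hom) b = rmap Φ b := by
  simp only [lmap, rmap, Category.assoc]
  rw [← BraidedCategory.braiding_naturality_right_assoc, braiding_leftUnitor]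

theorem rmap_braiding {A B : C} (Φ : 𝟙_ C ⟶ A ⊗ B) (e : A ⟶ 𝟙_ C) :
    rmap (Φ ≫ (β_ A B).hom) e = lmap Φ e := by
  simp only [lmap, rmap, Category.assoc]
  rw [← BraidedCategory.braiding_naturality_left_assoc, braiding_rightUnitor]

/-- Adjoining a system in the state `ψ` on the left. -/
def insL {B : C} (ψ : 𝟙_ C ⟶ B) (X : C) : X ⟶ B ⊗ X := (λ_ X).inv ≫ ψ ▷ X

/-- Adjoining a system in the state `ψ` on the right. -/
def insR {B : C} (ψ : 𝟙_ C ⟶ B) (X : C) : X ⟶ X ⊗ B := (ρ_ X).inv ≫ X ◁ ψ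

theorem IsOPT.lmap_insL (h : T.IsOPT) {B X : C} (ψ : 𝟙_ C ⟶ B) (ξ : 𝟙_ C ⟶ X) (b : B ⟶ 𝟙_ C) :
    lmap (ξ ≫ insL ψ X) b = T.pair b ψ • ξ := by
  have : ψ ▷ X ≫ b ▷ X = T.pair b ψ • 𝟙 _ := by
    rw [← comp_whiskerRight, h.comp_eq_smul]; simp
  simp only [lmap, insL, Category.assoc]
  rw [reassoc_of% this]
  simp

theorem IsOPT.rmap_insR (h : T.IsOPT) {B X : C} (ψ : 𝟙_ C ⟶ B) (ξ : 𝟙_ C ⟶ X) (b : B ⟶ 𝟙_ C) :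
    rmap (ξ ≫ insR ψ X) b = T.pair b ψ • ξ := by
  have : X ◁ ψ ≫ X ◁ b = T.pair b ψ • 𝟙 _ := by
    rw [← whiskerLeft_comp, h.comp_eq_smul]; simp
  simp only [rmap, insR, Category.assoc]
  rw [reassoc_of% this]
  simp

theorem IsOPT.lmap_insR (h : T.IsOPT) {B X : C} (ψ : 𝟙_ C ⟶ B) (ξ : 𝟙_ C ⟶ X) (e : X ⟶ 𝟙_ C) :
    lmap (ξ ≫ insR ψ X) e = T.pair e ξ • ψ := by
  have h1 : ξ ≫ (ρ_ X).inv ≫ X ◁ ψ ≫ e ▷ B ≫ (λ_ B).hom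
      = (ξ ≫ e) ≫ (ρ_ (𝟙_ C)).inv ≫ (𝟙_ C) ◁ ψ ≫ (λ_ B).hom := by
    rw [whisker_exchange_assoc]
    simp
  simp only [lmap, insR, Category.assoc]
  rw [h1, h.comp_eq_smul]
  simp [← unitors_inv_equal]

theorem rmap_lmap_assoc {A B D : C} (Ω : 𝟙_ C ⟶ (A ⊗ B) ⊗ D) (e : A ⟶ 𝟙_ C) (d : D ⟶ 𝟙_ C) :
    rmap (lmap (Ω ≫ (α_ A B D).hom) e) d = lmap (rmap Ω d) e := by
  simp only [rmap, lmap, Category.assoc]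
  congr 1
  have h1 : (ρ_ (A ⊗ B)).hom ≫ e ▷ B ≫ (λ_ B).hom
      = (e ▷ B) ▷ 𝟙_ C ≫ (λ_ B).hom ▷ (𝟙_ C) ≫ (ρ_ B).hom := by simp
  rw [h1, whisker_exchange_assoc, whisker_exchange_assoc]
  simp

end OPT

section Sharp

variable {C : Type u} [Category.{v} C] [MonoidalCategory C] [SymmetricCategory C]
  [Preadditive C] [Linear ℝ C] [MonoidalPreadditive C] [MonoidalLinear ℝ C] {T : ProbTheory C}

/-! ### Normalised states and the cone of states -/

/-- `ξ` lies in the cone generated by the states, i.e. it is an unnormalised state. -/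
def InCone (T : ProbTheory C) {A : C} (ξ : 𝟙_ C ⟶ A) : Prop :=
  ∃ r : ℝ, 0 ≤ r ∧ ∃ ρ : 𝟙_ C ⟶ A, T.IsState ρ ∧ ξ = r • ρ

theorem IsTransf.inCone {A : C} {ρ : 𝟙_ C ⟶ A} (hρ : T.IsTransf ρ) :
    T.InCone ρ := ⟨1, zero_le_one, ρ, hρ, (one_smul _ _).symm⟩

theorem InCone.smul {A : C} {ξ : 𝟙_ C ⟶ A} (hξ : T.InCone ξ) {r : ℝ}
    (hr : 0 ≤ r) : T.InCone (r • ξ) := by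
  obtain ⟨s, hs, ρ, hρ, rfl⟩ := hξ
  exact ⟨r * s, mul_nonneg hr hs, ρ, hρ, smul_smul _ _ _⟩

namespace IsSharpWithPurification

/-- The deterministic effect of `A`. -/
noncomputable def disc (hT : T.IsSharpWithPurification) (A : C) : A ⟶ 𝟙_ C :=
  (hT.causality.unique_deterministic_effect A).choose

theorem disc_channel (hT : T.IsSharpWithPurification) (A : C) : T.IsChannel (hT.disc A) :=
  (hT.causality.unique_deterministic_effect A).choose_spec.1

theorem eq_disc (hT : T.IsSharpWithPurification) {A : C} {e : A ⟶ 𝟙_ C} (he : T.IsChannel e) :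
    e = hT.disc A :=
  (hT.causality.unique_deterministic_effect A).choose_spec.2 e he

theorem comp_disc (hT : T.IsSharpWithPurification) {A B : C} {f : A ⟶ B} (hf : T.IsChannel f) :
    f ≫ hT.disc B = hT.disc A :=
  hT.eq_disc (hT.isOPT.channel_comp hf (hT.disc_channel B))

theorem disc_tensorUnit (hT : T.IsSharpWithPurification) : hT.disc (𝟙_ C) = 𝟙 (𝟙_ C) :=
  (hT.eq_disc (hT.isOPT.id_channel _)).symm

theorem isEffect_disc (hT : T.IsSharpWithPurification) (A : C) : T.IsEffect (hT.disc A) :=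
  (hT.disc_channel A).isTransf

theorem isEffect_compl (hT : T.IsSharpWithPurification) {A : C} {a : A ⟶ 𝟙_ C}
    (ha : T.IsEffect a) : T.IsEffect (hT.disc A - a) := by
  obtain ⟨g, hg⟩ := hT.isOPT.transf_compl ha
  have h1 := hT.eq_disc (hT.isOPT.sum_channel hg)
  have h2 : hT.disc A - a = g := by rw [← h1]; simp
  rw [h2]
  exact ⟨Bool, inferInstance, _, false, hg, rfl⟩

theorem pair_le_disc (hT : T.IsSharpWithPurification) {A : C} {a : A ⟶ 𝟙_ C} {ρ : 𝟙_ C ⟶ A}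
    (ha : T.IsEffect a) (hρ : T.IsState ρ) : T.pair a ρ ≤ T.pair (hT.disc A) ρ := by
  have := hT.isOPT.pair_nonneg (hT.isEffect_compl ha) hρ
  simpa using this

theorem pair_disc_channel (hT : T.IsSharpWithPurification) {A : C} {ρ : 𝟙_ C ⟶ A}
    (hρ : T.IsChannel ρ) : T.pair (hT.disc A) ρ = 1 := by
  rw [pair, hT.comp_disc hρ, hT.disc_tensorUnit, hT.isOPT.prob_id]

theorem pair_disc_nonneg (hT : T.IsSharpWithPurification) {A : C} {ρ : 𝟙_ C ⟶ A}
    (hρ : T.IsState ρ) : 0 ≤ T.pair (hT.disc A) ρ :=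
  hT.isOPT.pair_nonneg (hT.isEffect_disc A) hρ

theorem sum_pair_disc (hT : T.IsSharpWithPurification) {A : C} {X : Type} [Fintype X] [Nonempty X]
    {D : X → (𝟙_ C ⟶ A)} (hD : T.IsTest D) : ∑ x, T.pair (hT.disc A) (D x) = 1 := by
  rw [← pair_sum_right]
  exact hT.pair_disc_channel (hT.isOPT.sum_channel hD)

theorem pair_disc_le_one (hT : T.IsSharpWithPurification) {A : C} {ρ : 𝟙_ C ⟶ A}
    (hρ : T.IsState ρ) : T.pair (hT.disc A) ρ ≤ 1 := by
  obtain ⟨g, hg⟩ := hT.isOPT.transf_compl hρ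
  have h1 := hT.sum_pair_disc hg
  have h2 : T.IsState g := ⟨Bool, inferInstance, _, false, hg, rfl⟩
  have h3 := hT.pair_disc_nonneg h2
  simp at h1
  linarith

theorem pair_le_one (hT : T.IsSharpWithPurification) {A : C} {a : A ⟶ 𝟙_ C} {ρ : 𝟙_ C ⟶ A}
    (ha : T.IsEffect a) (hρ : T.IsState ρ) : T.pair a ρ ≤ 1 :=
  (hT.pair_le_disc ha hρ).trans (hT.pair_disc_le_one hρ)

theorem stateNorm_eq (hT : T.IsSharpWithPurification) {A : C} {ρ : 𝟙_ C ⟶ A}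
    (hρ : T.IsState ρ) : T.stateNorm ρ = T.pair (hT.disc A) ρ := by
  refine IsGreatest.csSup_eq ⟨⟨_, hT.isEffect_disc A, rfl⟩, ?_⟩
  rintro x ⟨a, ha, rfl⟩
  exact hT.pair_le_disc ha hρ

theorem effectNorm_eq_one (hT : T.IsSharpWithPurification) {A : C} {a : A ⟶ 𝟙_ C} {ρ : 𝟙_ C ⟶ A}
    (ha : T.IsEffect a) (hρ : T.IsState ρ) (h1 : T.pair a ρ = 1) : T.effectNorm a = 1 := by
  refine IsGreatest.csSup_eq ⟨⟨ρ, hρ, h1.symm⟩, ?_⟩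
  rintro x ⟨σ, hσ, rfl⟩
  exact hT.pair_le_one ha hσ

/-- Effects of `A` alone separate the vectors of `St_ℝ(A)`: an ancillary system can be absorbed into
the effect. -/
theorem state_ext (hT : T.IsSharpWithPurification) {A : C} {ξ : 𝟙_ C ⟶ A}
    (h : ∀ a : A ⟶ 𝟙_ C, T.IsEffect a → T.pair a ξ = 0) : ξ = 0 := by
  refine hT.isOPT.separated _ _ ξ fun S ρ E hρ hE => ?_
  -- Grouping the ancillary state with the test on `A ⊗ S` gives an effect of `A`.
  let a : A ⟶ 𝟙_ C := (ρ_ A).inv ≫ A ◁ (ρ ≫ (λ_ S).hom) ≫ E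
  have ha : T.IsEffect a := by
    refine hT.isOPT.transf_comp (hT.isOPT.right_inv_channel A).isTransf
      (hT.isOPT.transf_comp (hT.isOPT.transf_whiskerLeft (hT.isOPT.transf_comp hρ
        (hT.isOPT.left_hom_channel S).isTransf) A) hE)
  have h0 := h a ha
  have : ξ ≫ a = ρ ≫ ξ ▷ S ≫ E := by
    have h1 : ξ ≫ (ρ_ A).inv = (ρ_ _).inv ≫ ξ ▷ 𝟙_ C := rightUnitor_inv_naturality ξ
    simp only [a]
    rw [reassoc_of% h1, ← whisker_exchange_assoc]
    simp [← unitors_inv_equal]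
  rwa [pair, this] at h0

/-- States of `A` alone separate the vectors of `Eff_ℝ(A)`: an ancillary system can be absorbed into
the state. -/
theorem effect_ext (hT : T.IsSharpWithPurification) {A : C} {e : A ⟶ 𝟙_ C}
    (h : ∀ ρ : 𝟙_ C ⟶ A, T.IsState ρ → T.pair e ρ = 0) : e = 0 := by
  refine hT.isOPT.separated _ _ e fun S ρ E hρ hE => ?_
  have hσ : T.IsState (rmap ρ ((λ_ S).inv ≫ E)) :=
    hT.isOPT.transf_comp hρ (hT.isOPT.transf_comp (hT.isOPT.transf_whiskerLeft
      (hT.isOPT.transf_comp (hT.isOPT.left_inv_channel S).isTransf hE) A)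
      (hT.isOPT.right_hom_channel A).isTransf)
  have h0 := h _ hσ
  rw [← pair_lmap] at h0
  simpa [pair, lmap] using h0

theorem exists_state_one (hT : T.IsSharpWithPurification) (A : C) :
    ∃ ρ : 𝟙_ C ⟶ A, T.IsState ρ ∧ T.pair (hT.disc A) ρ = 1 := by
  obtain ⟨a, ha, ρ, hρ, h1⟩ := hT.pure_sharpness A
  exact ⟨ρ, hρ, le_antisymm (hT.pair_disc_le_one hρ) (h1 ▸ hT.pair_le_disc ha.1 hρ)⟩

/-- A state on which the deterministic effect vanishes is zero. -/
theorem state_eq_zero (hT : T.IsSharpWithPurification) {A : C} {ρ : 𝟙_ C ⟶ A}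
    (hρ : T.IsState ρ) (h : T.pair (hT.disc A) ρ = 0) : ρ = 0 :=
  hT.state_ext fun _ ha => le_antisymm (h ▸ hT.pair_le_disc ha hρ) (hT.isOPT.pair_nonneg ha hρ)

/-- A test may be replaced by another one when one of its two outcomes occurs. -/
theorem test_retry (hT : T.IsSharpWithPurification) {A : C} {σ σ' ρ ρ' : 𝟙_ C ⟶ A}
    (h1 : T.IsTest (fun b : Bool => bif b then σ else σ'))
    (h2 : T.IsTest (fun b : Bool => bif b then ρ else ρ')) :
    T.IsTest (fun b : Bool => bif b then σ + T.pair (hT.disc A) σ' • ρ else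
      T.pair (hT.disc A) σ' • ρ') := by
  have hg : ∀ b : Bool, T.IsTest (fun c : Bool =>
      bif b then (bif c then 𝟙 A else 0) else (hT.disc A ≫ bif c then ρ else ρ')) := by
    rintro (_ | _)
    · exact hT.isOPT.channel_comp_test (hT.disc_channel A) h2
    · have := hT.isOPT.test_smul (hT.isOPT.id_channel A)
        (p := fun b : Bool => bif b then (1 : ℝ) else 0) (by rintro (_ | _) <;> simp) (by simp)
      have := hT.isOPT.test_reindex this (Equiv.prodPUnit Bool).symm
      convert this using 2 with b
      cases b <;> simp
  have h3 := hT.causality.conditioned_test _ _ _ Bool (fun _ => Bool) _ _ h1 hg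
  have h4 := hT.isOPT.coarse_test _ _ Bool _ _ (fun z : (_ : Bool) × Bool => z.2)
    (fun b => ⟨⟨true, b⟩, rfl⟩) h3
  convert h4 using 2 with b
  rw [Finset.sum_filter, Fintype.sum_sigma]
  have := hT.isOPT.comp_eq_smul σ' (hT.disc A)
  cases b <;> simp [reassoc_of% this]

/-- Non-zero states can be normalised: the preparation is repeated until it succeeds, and the set
of states is closed. -/
theorem isState_normalize (hT : T.IsSharpWithPurification) {A : C} {ρ : 𝟙_ C ⟶ A}
    (hρ : T.IsState ρ) (h0 : 0 < T.pair (hT.disc A) ρ) :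
    T.IsState ((T.pair (hT.disc A) ρ)⁻¹ • ρ) := by
  set t := T.pair (hT.disc A) ρ with ht
  have ht1 : t ≤ 1 := hT.pair_disc_le_one hρ
  obtain ⟨ρ', hρ'⟩ := hT.isOPT.transf_compl hρ
  have key : ∀ n : ℕ, ∃ σ', T.IsTest (fun b : Bool =>
      bif b then ((1 - (1 - t) ^ (n + 1)) / t) • ρ else σ') := by
    intro n
    induction n with
    | zero => exact ⟨ρ', by simpa [h0.ne'] using hρ'⟩
    | succ n ih =>
      obtain ⟨σ', hσ'⟩ := ih
      refine ⟨T.pair (hT.disc A) σ' • ρ', ?_⟩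
      convert hT.test_retry hσ' hρ' using 3 with b
      have := hT.sum_pair_disc hσ'
      simp only [Fintype.sum_bool, cond_true, cond_false, pair_smul_right, ← ht] at this
      have h5 : T.pair (hT.disc A) σ' = (1 - t) ^ (n + 1) := by
        field_simp at this
        linarith
      rw [h5, ← add_smul]
      congr 1
      field_simp
      ring
  refine hT.isOPT.closed_states A (fun n => ((1 - (1 - t) ^ (n + 1)) / t) • ρ) _
    (fun n => ?_) (fun a _ => ?_)
  · obtain ⟨σ', hσ'⟩ := key n
    exact ⟨Bool, inferInstance, _, true, hσ', rfl⟩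
  · simp only [pair_smul_right]
    refine Tendsto.mul_const _ ?_
    have h1 : Tendsto (fun n : ℕ => (1 - t) ^ (n + 1)) atTop (𝓝 0) :=
      (tendsto_pow_atTop_nhds_zero_of_lt_one (by linarith) (by linarith)).comp
        (tendsto_add_atTop_nat 1)
    have h2 := (h1.const_sub 1).div_const t
    simpa using h2

theorem inCone_comp (hT : T.IsSharpWithPurification) {A B : C} {ξ : 𝟙_ C ⟶ A} (hξ : T.InCone ξ)
    {f : A ⟶ B} (hf : T.IsTransf f) : T.InCone (ξ ≫ f) := by
  obtain ⟨s, hs, ρ, hρ, rfl⟩ := hξ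
  exact ⟨s, hs, ρ ≫ f, hT.isOPT.transf_comp hρ hf, by simp⟩

theorem inCone_pair_nonneg (hT : T.IsSharpWithPurification) {A : C} {ξ : 𝟙_ C ⟶ A}
    (hξ : T.InCone ξ) {a : A ⟶ 𝟙_ C} (ha : T.IsEffect a) : 0 ≤ T.pair a ξ := by
  obtain ⟨s, hs, ρ, hρ, rfl⟩ := hξ
  simpa using mul_nonneg hs (hT.isOPT.pair_nonneg ha hρ)

theorem inCone_disc_nonneg (hT : T.IsSharpWithPurification) {A : C} {ξ : 𝟙_ C ⟶ A}
    (hξ : T.InCone ξ) : 0 ≤ T.pair (hT.disc A) ξ := hT.inCone_pair_nonneg hξ (hT.isEffect_disc A)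

theorem inCone_pair_le_disc (hT : T.IsSharpWithPurification) {A : C} {ξ : 𝟙_ C ⟶ A}
    (hξ : T.InCone ξ) {a : A ⟶ 𝟙_ C} (ha : T.IsEffect a) :
    T.pair a ξ ≤ T.pair (hT.disc A) ξ := by
  have := hT.inCone_pair_nonneg hξ (hT.isEffect_compl ha)
  simpa using this

theorem inCone_eq_zero (hT : T.IsSharpWithPurification) {A : C} {ξ : 𝟙_ C ⟶ A}
    (hξ : T.InCone ξ) (h : T.pair (hT.disc A) ξ = 0) : ξ = 0 :=
  hT.state_ext fun _ ha =>
    le_antisymm (h ▸ hT.inCone_pair_le_disc hξ ha) (hT.inCone_pair_nonneg hξ ha)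

theorem inCone_zero (hT : T.IsSharpWithPurification) {A : C} : T.InCone (0 : 𝟙_ C ⟶ A) := by
  obtain ⟨ρ, hρ, -⟩ := hT.exists_state_one A
  exact ⟨0, le_rfl, ρ, hρ, by simp⟩

theorem isState_of_inCone (hT : T.IsSharpWithPurification) {A : C} {ξ : 𝟙_ C ⟶ A}
    (hξ : T.InCone ξ) (h : T.pair (hT.disc A) ξ ≤ 1) : T.IsState ξ := by
  obtain ⟨r, hr, ρ, hρ, rfl⟩ := hξ
  rcases (hT.pair_disc_nonneg hρ).eq_or_lt with h0 | h0
  · rw [hT.state_eq_zero hρ h0.symm, smul_zero, ← zero_smul ℝ ρ]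
    exact hT.isOPT.transf_smul hρ le_rfl zero_le_one
  · have := hT.isOPT.transf_smul (hT.isState_normalize hρ h0) (p := r * T.pair (hT.disc A) ρ)
      (by positivity) (by simpa using h)
    rwa [smul_smul, mul_assoc, mul_inv_cancel₀ h0.ne', mul_one] at this

theorem isChannel_of_inCone (hT : T.IsSharpWithPurification) {A : C} {ξ : 𝟙_ C ⟶ A}
    (hξ : T.InCone ξ) (h : T.pair (hT.disc A) ξ = 1) : T.IsChannel ξ := by
  obtain ⟨g, hg⟩ := hT.isOPT.transf_compl (hT.isState_of_inCone hξ h.le)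
  have h1 := hT.sum_pair_disc hg
  have h2 : T.IsState g := ⟨Bool, inferInstance, _, false, hg, rfl⟩
  have h3 : g = 0 := hT.state_eq_zero h2 (by simpa [h] using h1)
  simpa [h3] using hT.isOPT.sum_channel hg

/-- The tests of states are the families in the cone of states of total probability one. -/
theorem test_of_inCone (hT : T.IsSharpWithPurification) {A : C} {X : Type} [Fintype X]
    {σ : X → (𝟙_ C ⟶ A)} (hσ : ∀ x, T.InCone (σ x))
    (h1 : ∑ x, T.pair (hT.disc A) (σ x) = 1) : T.IsTest σ := by
  classical
  obtain ⟨ρ, hρ, hρ1⟩ := hT.exists_state_one A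
  have hex : ∀ x, ∃ τ : 𝟙_ C ⟶ A, T.IsChannel τ ∧ T.pair (hT.disc A) (σ x) • τ = σ x := by
    intro x
    rcases (hT.inCone_disc_nonneg (hσ x)).eq_or_lt with h0 | h0
    · exact ⟨ρ, hT.isChannel_of_inCone hρ.inCone hρ1, by
        rw [hT.inCone_eq_zero (hσ x) h0.symm]; simp⟩
    · refine ⟨(T.pair (hT.disc A) (σ x))⁻¹ • σ x,
        hT.isChannel_of_inCone ((hσ x).smul (by positivity)) (by simp [h0.ne']), ?_⟩
      rw [smul_smul, mul_inv_cancel₀ h0.ne', one_smul]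
  choose τ hτ hτσ using hex
  have hs : T.IsTest (fun x => T.pair (hT.disc A) (σ x) • 𝟙 (𝟙_ C)) := by
    rw [hT.isOPT.scalar_test]
    simpa [hT.isOPT.prob_id] using ⟨fun x => hT.inCone_disc_nonneg (hσ x), h1⟩
  have h2 := hT.causality.conditioned_test _ _ _ X (fun _ => Unit) _ (fun x _ => τ x) hs hτ
  have := hT.isOPT.test_reindex h2 (Equiv.sigmaPUnit X).symm
  simpa [hτσ] using this

theorem inCone_add (hT : T.IsSharpWithPurification) {A : C} {ξ η : 𝟙_ C ⟶ A}
    (hξ : T.InCone ξ) (hη : T.InCone η) : T.InCone (ξ + η) := by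
  have h1 := hT.inCone_disc_nonneg hξ
  have h2 := hT.inCone_disc_nonneg hη
  set s := T.pair (hT.disc A) (ξ + η) with hs
  have hs' : s = T.pair (hT.disc A) ξ + T.pair (hT.disc A) η := by simp [hs]
  rcases (show 0 ≤ s by linarith).eq_or_lt with h0 | h0
  · rw [hT.inCone_eq_zero hξ (by linarith), zero_add]
    exact hη
  · have ht : T.IsTest (fun b : Bool => s⁻¹ • bif b then ξ else η) := by
      refine hT.test_of_inCone ?_ ?_
      · rintro (_ | _)
        exacts [hη.smul (by positivity), hξ.smul (by positivity)]
      · simp only [Fintype.sum_bool, cond_true, cond_false, pair_smul_right]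
        rw [← mul_add, ← hs', inv_mul_cancel₀ h0.ne']
    have := (hT.isOPT.sum_channel ht).isTransf.inCone.smul h0.le
    simpa [← smul_add, smul_smul, h0.ne'] using this

theorem inCone_sum (hT : T.IsSharpWithPurification) {A : C} {ι : Type*} (s : Finset ι)
    {ξ : ι → (𝟙_ C ⟶ A)} (hξ : ∀ i ∈ s, T.InCone (ξ i)) : T.InCone (∑ i ∈ s, ξ i) := by
  classical
  induction s using Finset.induction_on with
  | empty => simpa using hT.inCone_zero
  | insert i s hi ih =>
    rw [Finset.sum_insert hi]
    exact hT.inCone_add (hξ i (by simp)) (ih fun j hj => hξ j (by simp [hj]))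

/-- The cone of states is closed. -/
theorem inCone_of_tendsto (hT : T.IsSharpWithPurification) {A : C} {ξ : ℕ → (𝟙_ C ⟶ A)}
    {η : 𝟙_ C ⟶ A} (hξ : ∀ n, T.InCone (ξ n))
    (h : ∀ a : A ⟶ 𝟙_ C, T.IsEffect a →
      Tendsto (fun n => T.pair a (ξ n)) atTop (𝓝 (T.pair a η))) : T.InCone η := by
  obtain ⟨M, hM⟩ := (h _ (hT.isEffect_disc A)).bddAbove_range
  have hM' : ∀ n, T.pair (hT.disc A) (ξ n) ≤ max M 1 := fun n =>
    (hM ⟨n, rfl⟩).trans (le_max_left _ _)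
  have hpos : 0 < max M 1 := by positivity
  have : T.IsState ((max M 1)⁻¹ • η) := by
    refine hT.isOPT.closed_states A (fun n => (max M 1)⁻¹ • ξ n) _ (fun n => ?_) fun a ha => ?_
    · refine hT.isState_of_inCone ((hξ n).smul (by positivity)) ?_
      rw [pair_smul_right, inv_mul_le_one₀ hpos]
      exact hM' n
    · simpa using (h a ha).const_mul _
  have := this.inCone.smul hpos.le
  rwa [smul_smul, mul_inv_cancel₀ hpos.ne', one_smul] at this

end IsSharpWithPurification

/-! ### Purity -/

theorem IsOPT.reversible_of_iso {A B : C} (i : A ≅ B) (h1 : T.IsChannel i.hom)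
    (h2 : T.IsChannel i.inv) : T.IsReversible i.hom := ⟨h1, i.inv, h2, by simp, by simp⟩

theorem IsOPT.reversible_associator (h : T.IsOPT) (A B D : C) :
    T.IsReversible (α_ A B D).hom :=
  reversible_of_iso _ (h.assoc_hom_channel A B D) (h.assoc_inv_channel A B D)

theorem IsOPT.reversible_leftUnitor (h : T.IsOPT) (A : C) : T.IsReversible (λ_ A).hom :=
  reversible_of_iso _ (h.left_hom_channel A) (h.left_inv_channel A)

theorem IsOPT.reversible_rightUnitor (h : T.IsOPT) (A : C) : T.IsReversible (ρ_ A).hom :=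
  reversible_of_iso _ (h.right_hom_channel A) (h.right_inv_channel A)

theorem IsOPT.reversible_leftUnitor_inv (h : T.IsOPT) (A : C) : T.IsReversible (λ_ A).inv :=
  reversible_of_iso (λ_ A).symm (h.left_inv_channel A) (h.left_hom_channel A)

theorem IsOPT.reversible_rightUnitor_inv (h : T.IsOPT) (A : C) : T.IsReversible (ρ_ A).inv :=
  reversible_of_iso (ρ_ A).symm (h.right_inv_channel A) (h.right_hom_channel A)

theorem IsOPT.reversible_braiding (h : T.IsOPT) (A B : C) : T.IsReversible (β_ A B).hom :=
  reversible_of_iso _ (h.braiding_channel A B)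
    (by rw [← SymmetricCategory.braiding_swap_eq_inv_braiding]; exact h.braiding_channel B A)

theorem IsOPT.isPure_comp_reversible (h : T.IsOPT) {A B D : C} {f : A ⟶ B} {U : B ⟶ D}
    (hf : T.IsPure f) (hU : T.IsReversible U) : T.IsPure (f ≫ U) := by
  obtain ⟨hU, V, hV, hUV, hVU⟩ := hU
  refine ⟨h.transf_comp hf.1 hU.isTransf, fun Y _ E S hE hS hsum => ?_⟩
  obtain ⟨p, hp, hp1, hpE⟩ := hf.2 Y (fun y => E y ≫ V) S (h.test_comp_channel hE hV) hS
    (by rw [← Preadditive.sum_comp, hsum, Category.assoc, hUV, Category.comp_id])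
  refine ⟨p, hp, hp1, fun j hj => ?_⟩
  have := congrArg (· ≫ U) (hpE j hj)
  simpa [hVU] using this

theorem IsOPT.isPure_reversible_comp (h : T.IsOPT) {A B D : C} {f : B ⟶ D} {U : A ⟶ B}
    (hf : T.IsPure f) (hU : T.IsReversible U) : T.IsPure (U ≫ f) := by
  obtain ⟨hU, V, hV, hUV, hVU⟩ := hU
  refine ⟨h.transf_comp hU.isTransf hf.1, fun Y _ E S hE hS hsum => ?_⟩
  obtain ⟨p, hp, hp1, hpE⟩ := hf.2 Y (fun y => V ≫ E y) S (h.channel_comp_test hV hE) hS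
    (by rw [← Preadditive.comp_sum, hsum, ← Category.assoc, hVU, Category.id_comp])
  refine ⟨p, hp, hp1, fun j hj => ?_⟩
  have := congrArg (U ≫ ·) (hpE j hj)
  simpa [reassoc_of% hUV] using this

theorem IsPureNormState.inCone {A : C} {α : 𝟙_ C ⟶ A}
    (hα : T.IsPureNormState α) : T.InCone α := hα.1.1.inCone

namespace IsSharpWithPurification

theorem isPureNormState_iff (hT : T.IsSharpWithPurification) {A : C} {α : 𝟙_ C ⟶ A} :
    T.IsPureNormState α ↔ T.IsPure α ∧ T.pair (hT.disc A) α = 1 := by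
  constructor
  · rintro ⟨h1, h2⟩
    exact ⟨h1, by rwa [← hT.stateNorm_eq h1.1]⟩
  · rintro ⟨h1, h2⟩
    exact ⟨h1, by rwa [hT.stateNorm_eq h1.1]⟩

theorem pair_disc_pure (hT : T.IsSharpWithPurification) {A : C} {α : 𝟙_ C ⟶ A}
    (hα : T.IsPureNormState α) : T.pair (hT.disc A) α = 1 := (hT.isPureNormState_iff.1 hα).2

/-- Pure states have only trivial decompositions in the cone of states: a decomposition is completed
to a test. -/
theorem extremal_of_isPure (hT : T.IsSharpWithPurification) {A : C} {α σ τ : 𝟙_ C ⟶ A}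
    (hα : T.IsPure α) (hσ : T.InCone σ) (hτ : T.InCone τ) (h : σ + τ = α) :
    ∃ p : ℝ, σ = p • α := by
  obtain ⟨ρ, hρ, hρ1⟩ := hT.exists_state_one A
  have h1 := hT.pair_disc_le_one hα.1
  have h2 : T.pair (hT.disc A) σ + T.pair (hT.disc A) τ = T.pair (hT.disc A) α := by simp [← h]
  -- The missing probability is assigned to a third outcome.
  let D : Bool ⊕ Unit → (𝟙_ C ⟶ A) :=
    Sum.elim (fun b => bif b then σ else τ) (fun _ => (1 - T.pair (hT.disc A) α) • ρ)
  have hD : T.IsTest D := by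
    refine hT.test_of_inCone ?_ ?_
    · rintro ((_ | _) | _)
      exacts [hτ, hσ, hρ.inCone.smul (by linarith)]
    · simp [D, hρ1]
      linarith
  obtain ⟨p, -, -, hp⟩ := hα.2 _ D {Sum.inl true, Sum.inl false} hD (by simp) (by simp [D, h])
  exact ⟨p (Sum.inl true), by simpa [D] using hp (Sum.inl true) (by simp)⟩

/-- A normalised pure state spans an extreme ray of the cone of states. -/
theorem pure_extremal (hT : T.IsSharpWithPurification) {A : C} {α σ τ : 𝟙_ C ⟶ A}
    (hα : T.IsPureNormState α) (hσ : T.InCone σ) (hτ : T.InCone τ) (h : σ + τ = α) :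
    σ = T.pair (hT.disc A) σ • α := by
  obtain ⟨p, rfl⟩ := hT.extremal_of_isPure hα.1 hσ hτ h
  simp [hT.pair_disc_pure hα]

theorem isPureNormState_of_extremal (hT : T.IsSharpWithPurification) {A : C} {α : 𝟙_ C ⟶ A}
    (hα : T.InCone α) (h1 : T.pair (hT.disc A) α = 1)
    (h : ∀ σ τ : 𝟙_ C ⟶ A, T.InCone σ → T.InCone τ → σ + τ = α → ∃ p : ℝ, σ = p • α) :
    T.IsPureNormState α := by
  classical
  refine hT.isPureNormState_iff.2 ⟨⟨hT.isState_of_inCone hα h1.le, fun Y _ D S hD hS hsum => ?_⟩,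
    h1⟩
  have hDK : ∀ j, T.InCone (D j) := fun j => IsTransf.inCone ⟨Y, inferInstance, D, j, hD, rfl⟩
  refine ⟨fun j => T.pair (hT.disc A) (D j), fun j _ => hT.inCone_disc_nonneg (hDK j), ?_, ?_⟩
  · rw [← pair_sum_right, hsum, h1]
  · intro j hj
    obtain ⟨p, hp⟩ := h (D j) (∑ i ∈ S.erase j, D i) (hDK j) (hT.inCone_sum _ fun i _ => hDK i)
      (by rw [Finset.add_sum_erase _ _ hj, hsum])
    have hp1 : T.pair (hT.disc A) (D j) = p := by simp [hp, h1]
    change D j = T.pair (hT.disc A) (D j) • α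
    rw [hp1, hp]

theorem pure_normalize (hT : T.IsSharpWithPurification) {A : C} {α : 𝟙_ C ⟶ A}
    (hα : T.IsPure α) (h0 : 0 < T.pair (hT.disc A) α) :
    T.IsPureNormState ((T.pair (hT.disc A) α)⁻¹ • α) := by
  refine hT.isPureNormState_of_extremal (hα.1.inCone.smul (by positivity)) (by simp [h0.ne'])
    fun σ τ hσ hτ h => ?_
  obtain ⟨p, hp⟩ := hT.extremal_of_isPure hα (hσ.smul h0.le) (hτ.smul h0.le)
    (by rw [← smul_add, h, smul_smul, mul_inv_cancel₀ h0.ne', one_smul])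
  refine ⟨p, ?_⟩
  rw [smul_comm, ← hp, smul_smul, inv_mul_cancel₀ h0.ne', one_smul]

theorem exists_pure_smul (hT : T.IsSharpWithPurification) {A : C} {ξ : 𝟙_ C ⟶ A}
    (hξ : T.IsPure ξ) (h0 : 0 < T.pair (hT.disc A) ξ) :
    ∃ α : 𝟙_ C ⟶ A, T.IsPureNormState α ∧ ξ = T.pair (hT.disc A) ξ • α :=
  ⟨_, hT.pure_normalize hξ h0, by rw [smul_smul, mul_inv_cancel₀ h0.ne', one_smul]⟩

/-! ### Marginals and purifications -/

theorem pair_disc_comp (hT : T.IsSharpWithPurification) {A B : C} {f : A ⟶ B}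
    (hf : T.IsChannel f) (ξ : 𝟙_ C ⟶ A) :
    T.pair (hT.disc B) (ξ ≫ f) = T.pair (hT.disc A) ξ := by
  rw [← pair_comp, hT.comp_disc hf]

theorem pair_disc_rmap (hT : T.IsSharpWithPurification) {A B : C} (Φ : 𝟙_ C ⟶ A ⊗ B) :
    T.pair (hT.disc A) (rmap Φ (hT.disc B)) = T.pair (hT.disc (A ⊗ B)) Φ :=
  hT.pair_disc_comp (hT.isOPT.channel_comp (hT.isOPT.channel_whiskerLeft (hT.disc_channel B) A)
    (hT.isOPT.right_hom_channel A)) Φ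

theorem pair_disc_lmap (hT : T.IsSharpWithPurification) {A B : C} (Φ : 𝟙_ C ⟶ A ⊗ B) :
    T.pair (hT.disc B) (lmap Φ (hT.disc A)) = T.pair (hT.disc (A ⊗ B)) Φ := by
  rw [pair_lmap, pair_disc_rmap]

theorem inCone_rmap (hT : T.IsSharpWithPurification) {A B : C} {Φ : 𝟙_ C ⟶ A ⊗ B}
    (hΦ : T.InCone Φ) {b : B ⟶ 𝟙_ C} (hb : T.IsEffect b) : T.InCone (rmap Φ b) :=
  hT.inCone_comp hΦ (hT.isOPT.transf_comp (hT.isOPT.transf_whiskerLeft hb A)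
    (hT.isOPT.right_hom_channel A).isTransf)

theorem inCone_lmap (hT : T.IsSharpWithPurification) {A B : C} {Φ : 𝟙_ C ⟶ A ⊗ B}
    (hΦ : T.InCone Φ) {e : A ⟶ 𝟙_ C} (he : T.IsEffect e) : T.InCone (lmap Φ e) :=
  hT.inCone_comp hΦ (hT.isOPT.transf_comp (hT.isOPT.transf_whiskerRight he B)
    (hT.isOPT.left_hom_channel B).isTransf)

theorem isPurification_iff (hT : T.IsSharpWithPurification) {A B : C} {Φ : 𝟙_ C ⟶ A ⊗ B}
    {ρ : 𝟙_ C ⟶ A} :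
    T.IsPurification Φ ρ ↔ T.IsPureNormState Φ ∧ rmap Φ (hT.disc B) = ρ := by
  constructor
  · rintro ⟨h1, e, he, h2⟩
    exact ⟨h1, by rwa [hT.eq_disc he] at h2⟩
  · rintro ⟨h1, h2⟩
    exact ⟨h1, _, hT.disc_channel B, h2⟩

theorem exists_purification (hT : T.IsSharpWithPurification) {A : C} {ρ : 𝟙_ C ⟶ A}
    (hρ : T.InCone ρ) (h1 : T.pair (hT.disc A) ρ = 1) :
    ∃ (B : C) (Φ : 𝟙_ C ⟶ A ⊗ B), T.IsPureNormState Φ ∧ rmap Φ (hT.disc B) = ρ := by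
  have hs := hT.isState_of_inCone hρ h1.le
  obtain ⟨B, Φ, hΦ⟩ := hT.purification_exists A ρ ⟨hs, by rw [hT.stateNorm_eq hs, h1]⟩
  exact ⟨B, Φ, hT.isPurification_iff.1 hΦ⟩

theorem exists_reversible (hT : T.IsSharpWithPurification) {A B : C} {Φ Ψ : 𝟙_ C ⟶ A ⊗ B}
    (hΦ : T.IsPureNormState Φ) (hΨ : T.IsPureNormState Ψ)
    (h : rmap Φ (hT.disc B) = rmap Ψ (hT.disc B)) :
    ∃ U : B ⟶ B, T.IsReversible U ∧ Ψ = Φ ≫ A ◁ U :=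
  hT.purification_unique A B _ Φ Ψ (hT.isPurification_iff.2 ⟨hΦ, h⟩)
    (hT.isPurification_iff.2 ⟨hΨ, rfl⟩)

theorem pure_comp_reversible (hT : T.IsSharpWithPurification) {A B : C} {α : 𝟙_ C ⟶ A}
    (hα : T.IsPureNormState α) {U : A ⟶ B} (hU : T.IsReversible U) :
    T.IsPureNormState (α ≫ U) :=
  hT.isPureNormState_iff.2 ⟨hT.isOPT.isPure_comp_reversible hα.1 hU,
    by rw [hT.pair_disc_comp hU.1, hT.pair_disc_pure hα]⟩

/-- A transformation that occurs in a decomposition of the identity multiplies each state by a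
probability: it does so on a purification, and the probability is read off from the marginal. -/
theorem comp_of_sum_eq_id (hT : T.IsSharpWithPurification) {A S : C} {Y : Type} [Fintype Y]
    {D : Y → (A ⟶ A)} {s : Finset Y} (hD : T.IsTest D) (hs : s.Nonempty)
    (hsum : ∑ j ∈ s, D j = 𝟙 A) {j : Y} (hj : j ∈ s) {ρ : 𝟙_ C ⟶ A ⊗ S} (hρ : T.InCone ρ)
    (h1 : T.pair (hT.disc _) ρ = 1) :
    ρ ≫ D j ▷ S = T.pair (D j ≫ hT.disc A) (rmap ρ (hT.disc S)) • ρ := by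
  obtain ⟨B, Ψ, hΨ, hΨρ⟩ := hT.exists_purification hρ h1
  have ht : T.IsTest (fun y => Ψ ≫ D y ▷ S ▷ B) :=
    hT.isOPT.channel_comp_test (hT.isChannel_of_inCone hΨ.inCone (hT.pair_disc_pure hΨ))
      (hT.isOPT.test_whiskerRight (hT.isOPT.test_whiskerRight hD S) B)
  have hsum' : ∑ y ∈ s, Ψ ≫ D y ▷ S ▷ B = Ψ := by
    rw [← Preadditive.comp_sum, ← sum_whiskerRight, ← sum_whiskerRight, hsum]
    simp
  obtain ⟨p, -, -, hp⟩ := hΨ.1.2 Y _ s ht hs hsum'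
  have h2 : ρ ≫ D j ▷ S = p j • ρ := by
    have h3 := congrArg (fun Ξ => rmap Ξ (hT.disc B)) (hp j hj)
    have h4 : rmap (Ψ ≫ D j ▷ S ▷ B) (hT.disc B) = rmap Ψ (hT.disc B) ≫ D j ▷ S := by
      simp only [rmap, Category.assoc]
      rw [← whisker_exchange_assoc, rightUnitor_naturality]
    have h5 : rmap (p j • Ψ) (hT.disc B) = p j • rmap Ψ (hT.disc B) := by simp [rmap]
    simp only [h4, h5, hΨρ] at h3
    exact h3
  have h6 : T.pair (D j ≫ hT.disc A) (rmap ρ (hT.disc S)) = p j := by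
    have h7 : rmap ρ (hT.disc S) ≫ D j = rmap (ρ ≫ D j ▷ S) (hT.disc S) := by
      simp only [rmap, Category.assoc]
      rw [← whisker_exchange_assoc, rightUnitor_naturality]
    rw [pair_comp, h7, hT.pair_disc_rmap, h2, pair_smul_right, h1, mul_one]
  rw [h6, h2]

/-- No information without disturbance: the identity is pure. -/
theorem isPure_id (hT : T.IsSharpWithPurification) (A : C) : T.IsPure (𝟙 A) := by
  refine ⟨(hT.isOPT.id_channel A).isTransf, fun Y _ D s hD hs hsum => ?_⟩
  have hDT : ∀ j, T.IsTransf (D j) := fun j => ⟨Y, inferInstance, D, j, hD, rfl⟩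
  have hq : ∀ j ∈ s, ∀ ρ : 𝟙_ C ⟶ A, T.InCone ρ → T.pair (hT.disc A) ρ = 1 →
      ρ ≫ D j = T.pair (D j ≫ hT.disc A) ρ • ρ := by
    intro j hj ρ hρ h1
    have h2 := hT.comp_of_sum_eq_id hD hs hsum hj (S := 𝟙_ C) (ρ := ρ ≫ (ρ_ A).inv)
      (hT.inCone_comp hρ (hT.isOPT.right_inv_channel A).isTransf)
      (by rw [hT.pair_disc_comp (hT.isOPT.right_inv_channel A), h1])
    have h3 : rmap (ρ ≫ (ρ_ A).inv) (hT.disc (𝟙_ C)) = ρ := by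
      simp [rmap, hT.disc_tensorUnit]
    rw [h3] at h2
    have h4 := congrArg (· ≫ (ρ_ A).hom) h2
    simpa using h4
  obtain ⟨ρ₀, hρ₀, hρ₁⟩ := hT.exists_state_one A
  -- The probability is the same for all states, as is seen from mixtures.
  have hconst : ∀ j ∈ s, ∀ ρ : 𝟙_ C ⟶ A, T.InCone ρ → T.pair (hT.disc A) ρ = 1 →
      T.pair (D j ≫ hT.disc A) ρ = T.pair (D j ≫ hT.disc A) ρ₀ := by
    intro j hj ρ hρ h1
    by_contra hne
    have h2 := hq j hj ((1 / 2 : ℝ) • ρ + (1 / 2 : ℝ) • ρ₀)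
      (hT.inCone_add (hρ.smul (by norm_num)) (hρ₀.inCone.smul (by norm_num)))
      (by simp only [pair_add_right, pair_smul_right, h1, hρ₁]; norm_num)
    simp only [Preadditive.add_comp, Linear.smul_comp, hq j hj ρ hρ h1,
      hq j hj ρ₀ hρ₀.inCone hρ₁, pair_add_right, pair_smul_right] at h2
    set x := T.pair (D j ≫ hT.disc A) ρ
    set y := T.pair (D j ≫ hT.disc A) ρ₀
    have h3 : ((x - y) / 4) • (ρ - ρ₀) = 0 := by
      rw [← sub_eq_zero] at h2
      rw [← h2]
      module
    rcases smul_eq_zero.1 h3 with h4 | h4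
    · exact hne (by linarith)
    · exact hne (by simp only [x, y, sub_eq_zero.1 h4])
  refine ⟨fun j => T.pair (D j ≫ hT.disc A) ρ₀, fun j hj => ?_, ?_, fun j hj => ?_⟩
  · exact hT.isOPT.pair_nonneg (hT.isOPT.transf_comp (hDT j) (hT.isEffect_disc A)) hρ₀
  · rw [← pair_sum_left, ← Preadditive.sum_comp, hsum, Category.id_comp, hρ₁]
  · rw [← sub_eq_zero]
    refine hT.isOPT.separated _ _ _ fun S ρ E hρ hE => ?_
    have : ρ ≫ D j ▷ S = T.pair (D j ≫ hT.disc A) ρ₀ • ρ := by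
      rcases (hT.pair_disc_nonneg hρ).eq_or_lt with h0 | h0
      · simp [hT.state_eq_zero hρ h0.symm]
      · have h2 := hT.inCone_rmap hρ.inCone (hT.isEffect_disc S)
        have h3 := hT.comp_of_sum_eq_id hD hs hsum hj
          (hρ.inCone.smul (inv_nonneg.2 h0.le)) (by simp [h0.ne'])
        have h4 : rmap ((T.pair (hT.disc (A ⊗ S)) ρ)⁻¹ • ρ) (hT.disc S)
            = (T.pair (hT.disc (A ⊗ S)) ρ)⁻¹ • rmap ρ (hT.disc S) := by simp [rmap]
        rw [h4, hconst j hj _ (h2.smul (inv_nonneg.2 h0.le)) (by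
          rw [pair_smul_right, hT.pair_disc_rmap, inv_mul_cancel₀ h0.ne'])] at h3
        have h5 := congrArg (T.pair (hT.disc (A ⊗ S)) ρ • ·) h3
        simpa [smul_smul, h0.ne', mul_comm, mul_left_comm] using h5
    have h6 : (D j - T.pair (D j ≫ hT.disc A) ρ₀ • 𝟙 A) ▷ S
        = D j ▷ S - T.pair (D j ≫ hT.disc A) ρ₀ • 𝟙 (A ⊗ S) := by
      rw [eq_sub_iff_add_eq, ← id_whiskerRight, ← MonoidalLinear.smul_whiskerRight,
        ← MonoidalPreadditive.add_whiskerRight, sub_add_cancel]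
    rw [h6, ← Category.assoc, Preadditive.comp_sub, this]
    simp

theorem isPure_whiskerRight (hT : T.IsSharpWithPurification) {A B : C} {f : A ⟶ B}
    (hf : T.IsPure f) (S : C) : T.IsPure (f ▷ S) := by
  simpa using hT.purity_preservation_par _ _ _ _ f (𝟙 S) hf (hT.isPure_id S)

theorem isPure_whiskerLeft (hT : T.IsSharpWithPurification) {A B : C} {f : A ⟶ B}
    (hf : T.IsPure f) (S : C) : T.IsPure (S ◁ f) := by
  simpa using hT.purity_preservation_par _ _ _ _ (𝟙 S) f (hT.isPure_id S) hf

theorem isPure_comp (hT : T.IsSharpWithPurification) {A B D : C} {f : A ⟶ B} {g : B ⟶ D}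
    (hf : T.IsPure f) (hg : T.IsPure g) : T.IsPure (f ≫ g) :=
  hT.purity_preservation_seq _ _ _ f g hf hg

theorem isPure_lmap (hT : T.IsSharpWithPurification) {A B : C} {Φ : 𝟙_ C ⟶ A ⊗ B}
    (hΦ : T.IsPure Φ) {e : A ⟶ 𝟙_ C} (he : T.IsPure e) : T.IsPure (lmap Φ e) :=
  hT.isPure_comp hΦ (hT.isOPT.isPure_comp_reversible (hT.isPure_whiskerRight he B)
    (hT.isOPT.reversible_leftUnitor B))

theorem isPure_rmap (hT : T.IsSharpWithPurification) {A B : C} {Φ : 𝟙_ C ⟶ A ⊗ B}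
    (hΦ : T.IsPure Φ) {b : B ⟶ 𝟙_ C} (hb : T.IsPure b) : T.IsPure (rmap Φ b) :=
  hT.isPure_comp hΦ (hT.isOPT.isPure_comp_reversible (hT.isPure_whiskerLeft hb A)
    (hT.isOPT.reversible_rightUnitor A))

theorem isPure_insL (hT : T.IsSharpWithPurification) {B : C} {ψ : 𝟙_ C ⟶ B}
    (hψ : T.IsPure ψ) (X : C) : T.IsPure (insL ψ X) :=
  hT.isOPT.isPure_reversible_comp (hT.isPure_whiskerRight hψ X)
    (hT.isOPT.reversible_leftUnitor_inv X)

theorem isPure_insR (hT : T.IsSharpWithPurification) {B : C} {ψ : 𝟙_ C ⟶ B}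
    (hψ : T.IsPure ψ) (X : C) : T.IsPure (insR ψ X) :=
  hT.isOPT.isPure_reversible_comp (hT.isPure_whiskerLeft hψ X)
    (hT.isOPT.reversible_rightUnitor_inv X)

theorem isChannel_insL (hT : T.IsSharpWithPurification) {B : C} {ψ : 𝟙_ C ⟶ B}
    (hψ : T.IsPureNormState ψ) (X : C) : T.IsChannel (insL ψ X) :=
  hT.isOPT.channel_comp (hT.isOPT.left_inv_channel X) (hT.isOPT.channel_whiskerRight
    (hT.isChannel_of_inCone hψ.inCone (hT.pair_disc_pure hψ)) X)

theorem isChannel_insR (hT : T.IsSharpWithPurification) {B : C} {ψ : 𝟙_ C ⟶ B}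
    (hψ : T.IsPureNormState ψ) (X : C) : T.IsChannel (insR ψ X) :=
  hT.isOPT.channel_comp (hT.isOPT.right_inv_channel X) (hT.isOPT.channel_whiskerLeft
    (hT.isChannel_of_inCone hψ.inCone (hT.pair_disc_pure hψ)) X)

end IsSharpWithPurification

/-! ### States as mixtures of pure states -/

/-- The span of the order interval `[0, σ]` in the cone of states. -/
def intervalSpan (T : ProbTheory C) {A : C} (σ : 𝟙_ C ⟶ A) :
    Submodule ℝ (𝟙_ C ⟶ A) := Submodule.span ℝ {τ | T.InCone τ ∧ T.InCone (σ - τ)}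

namespace IsSharpWithPurification

/-- From `σ` one may subtract a largest multiple of a given non-zero vector of the cone. -/
theorem exists_max_sub (hT : T.IsSharpWithPurification) {A : C} {σ τ : 𝟙_ C ⟶ A}
    (hσ : T.InCone σ) (hτ : T.InCone τ) (hτ0 : τ ≠ 0) :
    ∃ t : ℝ, T.InCone (σ - t • τ) ∧ ∀ s : ℝ, T.InCone (σ - s • τ) → s ≤ t := by
  have hpos : 0 < T.pair (hT.disc A) τ := (hT.inCone_disc_nonneg hτ).lt_of_ne
    fun h => hτ0 (hT.inCone_eq_zero hτ h.symm)
  let S : Set ℝ := {t | T.InCone (σ - t • τ)}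
  have hne : S.Nonempty := ⟨0, by simpa [S] using hσ⟩
  have hbdd : BddAbove S := by
    refine ⟨T.pair (hT.disc A) σ / T.pair (hT.disc A) τ, fun t ht => ?_⟩
    have := hT.inCone_disc_nonneg ht
    rw [le_div_iff₀ hpos]
    simpa using this
  obtain ⟨s, -, hs, hsS⟩ := exists_seq_tendsto_sSup hne hbdd
  refine ⟨sSup S, hT.inCone_of_tendsto (ξ := fun n => σ - s n • τ) hsS fun a _ => ?_,
    fun t ht => le_csSup hbdd ht⟩
  simpa using tendsto_const_nhds.sub (hs.mul_const (T.pair a τ))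

/-- Subtracting a largest multiple of `τ` from `σ ≥ τ` leads to a face of smaller dimension. -/
theorem finrank_intervalSpan_lt (hT : T.IsSharpWithPurification) {A : C} {σ τ : 𝟙_ C ⟶ A}
    (hτ : T.InCone τ) (hστ : T.InCone (σ - τ)) {t : ℝ}
    (ht : T.InCone (σ - t • τ)) (hmax : ∀ s : ℝ, T.InCone (σ - s • τ) → s ≤ t) :
    Module.finrank ℝ (T.intervalSpan (σ - t • τ)) < Module.finrank ℝ (T.intervalSpan σ) := by
  have := hT.isOPT.finite_system A
  have ht1 : 1 ≤ t := hmax 1 (by simpa using hστ)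
  have hle : T.intervalSpan (σ - t • τ) ≤ T.intervalSpan σ := by
    refine Submodule.span_mono fun x hx => ⟨hx.1, ?_⟩
    have := hT.inCone_add hx.2 (hτ.smul (r := t) (by linarith))
    convert this using 1
    abel
  refine lt_of_le_of_ne (Submodule.finrank_mono hle) fun heq => ?_
  have hmem : τ ∈ T.intervalSpan (σ - t • τ) := by
    rw [Submodule.eq_of_le_of_finrank_eq hle heq]
    exact Submodule.subset_span ⟨hτ, hστ⟩
  have key : ∀ y ∈ T.intervalSpan (σ - t • τ), ∃ M : ℝ, 0 ≤ M ∧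
      T.InCone (M • (σ - t • τ) - y) ∧ T.InCone (M • (σ - t • τ) + y) := by
    intro y hy
    induction hy using Submodule.span_induction with
    | mem y hy =>
      exact ⟨1, zero_le_one, by simpa using hy.2, by simpa using hT.inCone_add ht hy.1⟩
    | zero => exact ⟨0, le_rfl, by simpa using hT.inCone_zero, by simpa using hT.inCone_zero⟩
    | add y z _ _ hy hz =>
      obtain ⟨M, hM, h1, h2⟩ := hy
      obtain ⟨N, hN, h3, h4⟩ := hz
      refine ⟨M + N, by positivity, ?_, ?_⟩
      · convert hT.inCone_add h1 h3 using 1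
        module
      · convert hT.inCone_add h2 h4 using 1
        module
    | smul c y _ hy =>
      obtain ⟨M, hM, h1, h2⟩ := hy
      refine ⟨|c| * M, by positivity, ?_⟩
      rcases le_total 0 c with hc | hc
      · rw [abs_of_nonneg hc]
        constructor
        · convert h1.smul hc using 1
          module
        · convert h2.smul hc using 1
          module
      · rw [abs_of_nonpos hc]
        constructor
        · convert h2.smul (neg_nonneg.2 hc) using 1
          module
        · convert h1.smul (neg_nonneg.2 hc) using 1
          module
  obtain ⟨M, hM, h1, -⟩ := key τ hmem
  have h2 : T.InCone (σ - (t + (M + 1)⁻¹) • τ) := by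
    convert (hT.inCone_add h1 ht).smul (r := (M + 1)⁻¹) (by positivity) using 1
    have : (M + 1) ≠ 0 := by positivity
    match_scalars
    · field_simp
    · field_simp
      ring
  have h3 := hmax _ h2
  have : 0 < (M + 1)⁻¹ := by positivity
  linarith

/-- Every vector in the cone of states is a sum of multiples of normalised pure states: a vector
that is not on an extreme ray is a sum of two vectors in faces of smaller dimension. -/
theorem inCone_induction (hT : T.IsSharpWithPurification) {A : C} {P : (𝟙_ C ⟶ A) → Prop}
    (zero : P 0) (add : ∀ ξ η, T.InCone ξ → T.InCone η → P ξ → P η → P (ξ + η))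
    (pure : ∀ α, T.IsPureNormState α → ∀ r : ℝ, 0 < r → P (r • α))
    {σ : 𝟙_ C ⟶ A} (hσ : T.InCone σ) : P σ := by
  suffices h : ∀ n : ℕ, ∀ σ : 𝟙_ C ⟶ A, Module.finrank ℝ (T.intervalSpan σ) = n → T.InCone σ →
      ∀ r : ℝ, 0 < r → P (r • σ) by
    simpa using h _ σ rfl hσ 1 one_pos
  intro n
  induction n using Nat.strong_induction_on with
  | _ n ih =>
    rintro σ rfl hσ r hr
    rcases (hT.inCone_disc_nonneg hσ).eq_or_lt with h0 | h0
    · rw [hT.inCone_eq_zero hσ h0.symm, smul_zero]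
      exact zero
    by_cases hex : ∀ τ, T.InCone τ → T.InCone (σ - τ) → ∃ p : ℝ, τ = p • σ
    · have hα : T.IsPureNormState ((T.pair (hT.disc A) σ)⁻¹ • σ) := by
        refine hT.isPureNormState_of_extremal (hσ.smul (by positivity)) (by simp [h0.ne'])
          fun τ τ' hτ hτ' h => ?_
        obtain ⟨p, hp⟩ := hex (T.pair (hT.disc A) σ • τ) (hτ.smul h0.le) (by
          have : σ - T.pair (hT.disc A) σ • τ = T.pair (hT.disc A) σ • τ' := by
            rw [eq_sub_of_add_eq' h, smul_sub, smul_smul, mul_inv_cancel₀ h0.ne', one_smul]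
          rw [this]
          exact hτ'.smul h0.le)
        refine ⟨p, ?_⟩
        rw [smul_comm, ← hp, smul_smul, inv_mul_cancel₀ h0.ne', one_smul]
      have := pure _ hα (r * T.pair (hT.disc A) σ) (by positivity)
      rwa [smul_smul, mul_assoc, mul_inv_cancel₀ h0.ne', mul_one] at this
    · push Not at hex
      obtain ⟨τ, hτ, hστ, hne⟩ := hex
      have hτ0 : τ ≠ 0 := fun h => hne 0 (by simp [h])
      obtain ⟨t, ht, htmax⟩ := hT.exists_max_sub hσ hτ hτ0
      have ht1 : 1 ≤ t := htmax 1 (by simpa using hστ)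
      set σ' := σ - t • τ with hσ'
      have hσ'0 : σ' ≠ 0 := by
        intro h
        refine hne t⁻¹ ?_
        rw [sub_eq_zero.1 h, smul_smul, inv_mul_cancel₀ (by linarith), one_smul]
      have hσσ' : T.InCone (σ - σ') := by
        rw [hσ', sub_sub_cancel]
        exact hτ.smul (by linarith)
      obtain ⟨s, hs, hsmax⟩ := hT.exists_max_sub hσ ht hσ'0
      have hs1 : 1 ≤ s := hsmax 1 (by simpa using hσσ')
      have e : r • σ = r • (σ - s • σ') + (r * s) • σ' := by module
      rw [e]
      have hrs : 0 < r * s := mul_pos hr (by linarith)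
      exact add _ _ (hs.smul hr.le) (ht.smul hrs.le)
        (ih _ (hT.finrank_intervalSpan_lt ht hσσ' hs hsmax) _ rfl hs r hr)
        (ih _ (hT.finrank_intervalSpan_lt hτ hστ ht htmax) _ rfl ht _ hrs)

theorem exists_pure_le (hT : T.IsSharpWithPurification) {A : C} {σ : 𝟙_ C ⟶ A}
    (hσ : T.InCone σ) (h0 : σ ≠ 0) :
    ∃ α : 𝟙_ C ⟶ A, T.IsPureNormState α ∧ ∃ r : ℝ, 0 < r ∧ T.InCone (σ - r • α) := by
  revert h0
  refine hT.inCone_induction (P := fun σ => σ ≠ 0 → ∃ α : 𝟙_ C ⟶ A, T.IsPureNormState α ∧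
    ∃ r : ℝ, 0 < r ∧ T.InCone (σ - r • α)) (fun h => absurd rfl h) ?_ ?_ hσ
  · intro ξ η hξ hη h1 h2 h3
    by_cases hξ0 : ξ = 0
    · subst hξ0
      simpa using h2 (by simpa using h3)
    · obtain ⟨α, hα, r, hr, h⟩ := h1 hξ0
      exact ⟨α, hα, r, hr, by simpa [add_sub_right_comm] using hT.inCone_add h hη⟩
  · intro α hα r hr _
    exact ⟨α, hα, r, hr, by simpa using hT.inCone_zero⟩

theorem exists_pure (hT : T.IsSharpWithPurification) (A : C) :
    ∃ α : 𝟙_ C ⟶ A, T.IsPureNormState α := by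
  obtain ⟨ρ, hρ, h1⟩ := hT.exists_state_one A
  obtain ⟨α, hα, -⟩ := hT.exists_pure_le hρ.inCone (fun h => by simp [h] at h1)
  exact ⟨α, hα⟩

theorem span_pure (hT : T.IsSharpWithPurification) (A : C) :
    Submodule.span ℝ {α : 𝟙_ C ⟶ A | T.IsPureNormState α} = ⊤ := by
  rw [eq_top_iff, ← hT.isOPT.span_transf (𝟙_ C) A, Submodule.span_le]
  intro ρ hρ
  refine hT.inCone_induction (P := fun σ => σ ∈ Submodule.span ℝ
    {α : 𝟙_ C ⟶ A | T.IsPureNormState α}) (Submodule.zero_mem _)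
    (fun _ _ _ _ => Submodule.add_mem _) (fun α hα r _ => ?_) (IsTransf.inCone hρ)
  exact Submodule.smul_mem _ _ (Submodule.subset_span hα)

theorem linearMap_ext_pure (hT : T.IsSharpWithPurification) {A : C} {W : Type*} [AddCommGroup W]
    [Module ℝ W] {f g : (𝟙_ C ⟶ A) →ₗ[ℝ] W}
    (h : ∀ α : 𝟙_ C ⟶ A, T.IsPureNormState α → f α = g α) : f = g :=
  LinearMap.ext_on (hT.span_pure A) h

theorem effect_ext_pure (hT : T.IsSharpWithPurification) {A : C} {e e' : A ⟶ 𝟙_ C}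
    (h : ∀ α : 𝟙_ C ⟶ A, T.IsPureNormState α → T.pair e α = T.pair e' α) : e = e' := by
  have h1 : T.pairR e = T.pairR e' := hT.linearMap_ext_pure h
  rw [← sub_eq_zero]
  refine hT.effect_ext fun ρ _ => ?_
  have := LinearMap.congr_fun h1 ρ
  simpa [sub_eq_zero] using this

/-! ### Sharp effects and the states they identify -/

theorem pure_comp (hT : T.IsSharpWithPurification) {A B : C} {α : 𝟙_ C ⟶ A}
    (hα : T.IsPureNormState α) {f : A ⟶ B} (hf : T.IsPure f) (hf' : T.IsChannel f) :
    T.IsPureNormState (α ≫ f) :=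
  hT.isPureNormState_iff.2 ⟨hT.isPure_comp hα.1 hf,
    by rw [hT.pair_disc_comp hf', hT.pair_disc_pure hα]⟩

/-- Reversible channels act transitively on pure states, since pure states of `A` purify the
trivial system. -/
theorem exists_reversible_pure (hT : T.IsSharpWithPurification) {A : C} {α α' : 𝟙_ C ⟶ A}
    (hα : T.IsPureNormState α) (hα' : T.IsPureNormState α') :
    ∃ U : A ⟶ A, T.IsReversible U ∧ α' = α ≫ U := by
  have h1 := hT.pure_comp_reversible hα (hT.isOPT.reversible_leftUnitor_inv A)
  have h2 := hT.pure_comp_reversible hα' (hT.isOPT.reversible_leftUnitor_inv A)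
  obtain ⟨U, hU, h⟩ := hT.exists_reversible h1 h2 (by
    refine hT.isOPT.prob_injective ?_
    have h3 := hT.pair_disc_rmap (α ≫ (λ_ A).inv)
    have h4 := hT.pair_disc_rmap (α' ≫ (λ_ A).inv)
    rw [hT.pair_disc_pure h1] at h3
    rw [hT.pair_disc_pure h2] at h4
    simp only [pair, hT.disc_tensorUnit, Category.comp_id] at h3 h4
    rw [h3, h4])
  refine ⟨U, hU, ?_⟩
  have h5 := congrArg (· ≫ (λ_ A).hom) h
  simpa [leftUnitor_naturality] using h5

/-- If a pure effect occurs with certainty on `ρ`, then `ρ` is pure: applying the effect to a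
purification of `ρ` shows that the purifying system is in a pure state. -/
theorem isPureNormState_of_pair_eq_one (hT : T.IsSharpWithPurification) {A : C} {a : A ⟶ 𝟙_ C}
    (ha : T.IsPure a) {ρ : 𝟙_ C ⟶ A} (hρ : T.InCone ρ) (h1 : T.pair (hT.disc A) ρ = 1)
    (haρ : T.pair a ρ = 1) : T.IsPureNormState ρ := by
  obtain ⟨B, Φ, hΦ, hΦρ⟩ := hT.exists_purification hρ h1
  have hβ1 : T.pair (hT.disc B) (lmap Φ a) = 1 := by rw [pair_lmap, hΦρ, haρ]
  have hβ : T.IsPureNormState (lmap Φ a) :=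
    hT.isPureNormState_iff.2 ⟨hT.isPure_lmap hΦ.1 ha, hβ1⟩
  have h0 : lmap Φ (hT.disc A - a) = 0 := by
    refine hT.inCone_eq_zero (hT.inCone_lmap hΦ.inCone (hT.isEffect_compl ha.1)) ?_
    rw [pair_lmap, hΦρ, pair_sub_left, h1, haρ, sub_self]
  have h2 : lmap Φ (hT.disc A) = lmap Φ a := by
    rwa [lmap_sub, sub_eq_zero] at h0
  obtain ⟨ψ, hψ⟩ := hT.exists_pure A
  have hΩ := hT.pure_comp_reversible hΦ (hT.isOPT.reversible_braiding A B)
  have hΩ' := hT.pure_comp hβ (hT.isPure_insR hψ.1 B) (hT.isChannel_insR hψ B)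
  obtain ⟨U, hU, h⟩ := hT.exists_reversible hΩ' hΩ (by
    rw [rmap_braiding, h2, hT.isOPT.rmap_insR, hT.pair_disc_pure hψ, one_smul])
  have h3 := congrArg (fun Ξ => lmap Ξ (hT.disc B)) h
  simp only [lmap_braiding, lmap_whiskerLeft, hT.isOPT.lmap_insR, hβ1, one_smul, hΦρ] at h3
  rw [h3]
  exact hT.pure_comp_reversible hψ hU

/-- A pure effect occurs with certainty on at most one normalised state, since a mixture of two such
states would be pure. -/
theorem eq_of_pair_eq_one (hT : T.IsSharpWithPurification) {A : C} {a : A ⟶ 𝟙_ C}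
    (ha : T.IsPure a) {ρ σ : 𝟙_ C ⟶ A} (hρ : T.InCone ρ) (hρ1 : T.pair (hT.disc A) ρ = 1)
    (haρ : T.pair a ρ = 1) (hσ : T.InCone σ) (hσ1 : T.pair (hT.disc A) σ = 1)
    (haσ : T.pair a σ = 1) : ρ = σ := by
  have h1 : T.InCone ((1 / 2 : ℝ) • ρ) := hρ.smul (by norm_num)
  have h2 : T.InCone ((1 / 2 : ℝ) • σ) := hσ.smul (by norm_num)
  have h3 : T.IsPureNormState ((1 / 2 : ℝ) • ρ + (1 / 2 : ℝ) • σ) :=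
    hT.isPureNormState_of_pair_eq_one ha (hT.inCone_add h1 h2)
      (by simp only [pair_add_right, pair_smul_right, hρ1, hσ1]; norm_num)
      (by simp only [pair_add_right, pair_smul_right, haρ, haσ]; norm_num)
  have h4 := hT.pure_extremal h3 h1 h2 rfl
  have h5 := hT.pure_extremal h3 h2 h1 (add_comm _ _)
  simp only [pair_smul_right, hρ1, hσ1, mul_one] at h4 h5
  have h6 : (1 / 2 : ℝ) • ρ = (1 / 2 : ℝ) • σ := h4.trans h5.symm
  exact smul_right_injective _ (by norm_num : (1 / 2 : ℝ) ≠ 0) h6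

/-- Every normalised pure state, not only the one given by Pure Sharpness, is identified by a pure
effect, since reversible channels act transitively. -/
theorem exists_sharp (hT : T.IsSharpWithPurification) {A : C} {α : 𝟙_ C ⟶ A}
    (hα : T.IsPureNormState α) : ∃ a : A ⟶ 𝟙_ C, T.IsPure a ∧ T.pair a α = 1 := by
  obtain ⟨a, ha, ρ, hρ, h1⟩ := hT.pure_sharpness A
  have hρ1 : T.pair (hT.disc A) ρ = 1 :=
    le_antisymm (hT.pair_disc_le_one hρ) (h1 ▸ hT.pair_le_disc ha.1 hρ)
  have hρp := hT.isPureNormState_of_pair_eq_one ha hρ.inCone hρ1 h1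
  obtain ⟨U, hU, h⟩ := hT.exists_reversible_pure hα hρp
  exact ⟨U ≫ a, hT.isOPT.isPure_reversible_comp ha hU, by rw [pair_comp, ← h, h1]⟩

/-! ### Steering -/

theorem inCone_tens (hT : T.IsSharpWithPurification) {A B : C} {ρ : 𝟙_ C ⟶ A} {σ : 𝟙_ C ⟶ B}
    (hρ : T.InCone ρ) (hσ : T.IsState σ) : T.InCone (ρ ≫ insR σ A) :=
  hT.inCone_comp hρ (hT.isOPT.transf_comp (hT.isOPT.right_inv_channel A).isTransf
    (hT.isOPT.transf_whiskerLeft hσ A))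

/-- An extension `S` of the marginal on `A` of a pure state `Φ` of `A ⊗ B` is obtained from `Φ`
by a pure channel `g` on `B`, up to discarding a system `E` and up to an ancilla in the state `ψ`:
`Ω` is a purification of `S`. -/
theorem exists_extension (hT : T.IsSharpWithPurification) {A B D : C} {Φ : 𝟙_ C ⟶ A ⊗ B}
    (hΦ : T.IsPureNormState Φ) {S : 𝟙_ C ⟶ A ⊗ D} (hS : T.InCone S)
    (h : rmap S (hT.disc D) = rmap Φ (hT.disc B)) :
    ∃ (E : C) (Ω : 𝟙_ C ⟶ A ⊗ (D ⊗ E)) (ψ : 𝟙_ C ⟶ B) (g : B ⟶ B ⊗ (D ⊗ E)),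
      T.IsPureNormState Ω ∧ T.IsPureNormState ψ ∧ T.IsPure g ∧ T.IsChannel g ∧
      Φ ≫ A ◁ g = Ω ≫ A ◁ insL ψ (D ⊗ E) ∧
      ∀ e : A ⟶ 𝟙_ C, rmap (lmap Ω e) (hT.disc E) = lmap S e := by
  have hS1 : T.pair (hT.disc (A ⊗ D)) S = 1 := by
    rw [← hT.pair_disc_rmap, h, hT.pair_disc_rmap, hT.pair_disc_pure hΦ]
  obtain ⟨E, Ω₀, hΩ₀, hΩ₀S⟩ := hT.exists_purification hS hS1
  have hΩ := hT.pure_comp_reversible hΩ₀ (hT.isOPT.reversible_associator A D E)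
  set Ω := Ω₀ ≫ (α_ A D E).hom with hΩdef
  have hΩS : ∀ e : A ⟶ 𝟙_ C, rmap (lmap Ω e) (hT.disc E) = lmap S e := fun e => by
    rw [hΩdef, rmap_lmap_assoc, hΩ₀S]
  obtain ⟨ψ, hψ⟩ := hT.exists_pure B
  obtain ⟨ψ', hψ'⟩ := hT.exists_pure (D ⊗ E)
  have hΩmarg : rmap Ω (hT.disc (D ⊗ E)) = rmap Φ (hT.disc B) := by
    rw [← sub_eq_zero]
    refine hT.state_ext fun a _ => ?_
    rw [pair_sub_right, sub_eq_zero, ← pair_lmap, ← hT.pair_disc_rmap, hΩS, pair_lmap, h]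
  have hw : ∀ {X Y : C} {f : X ⟶ Y} {Ξ : 𝟙_ C ⟶ A ⊗ X}, T.IsPureNormState Ξ → T.IsPure f →
      T.IsChannel f → T.IsPureNormState (Ξ ≫ A ◁ f) := fun hΞ hf hf' =>
    hT.pure_comp hΞ (hT.isPure_whiskerLeft hf A) (hT.isOPT.channel_whiskerLeft hf' A)
  obtain ⟨U, hU, hUe⟩ := hT.exists_reversible
    (hw hΦ (hT.isPure_insR hψ'.1 B) (hT.isChannel_insR hψ' B))
    (hw hΩ (hT.isPure_insL hψ.1 (D ⊗ E)) (hT.isChannel_insL hψ (D ⊗ E)))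
    (by rw [rmap_whiskerLeft, rmap_whiskerLeft, hT.comp_disc (hT.isChannel_insR hψ' B),
      hT.comp_disc (hT.isChannel_insL hψ _), hΩmarg])
  exact ⟨E, Ω, ψ, insR ψ' B ≫ U, hΩ, hψ,
    hT.isOPT.isPure_comp_reversible (hT.isPure_insR hψ'.1 B) hU,
    hT.isOPT.channel_comp (hT.isChannel_insR hψ' B) hU.1, by rw [hUe]; simp, hΩS⟩

/-- A functional `e` that annihilates a purification of `ρ` vanishes on all states in the
decompositions of `ρ`. -/
theorem pair_eq_zero_of_lmap (hT : T.IsSharpWithPurification) {A B : C} {Φ : 𝟙_ C ⟶ A ⊗ B}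
    (hΦ : T.IsPureNormState Φ) {e : A ⟶ 𝟙_ C} (he : lmap Φ e = 0) {σ : 𝟙_ C ⟶ A}
    (hσ : T.InCone σ) (hσ' : T.InCone (rmap Φ (hT.disc B) - σ)) : T.pair e σ = 0 := by
  set ρ := rmap Φ (hT.disc B) with hρ
  have hρ1 : T.pair (hT.disc A) ρ = 1 := by rw [hρ, hT.pair_disc_rmap, hT.pair_disc_pure hΦ]
  have heρ : T.pair e ρ = 0 := by rw [hρ, ← pair_lmap, he, pair_zero_right]
  obtain ⟨γ, hγ⟩ := hT.exists_pure A
  -- The decomposition is recorded in a second copy of `A` by two states `γ`, `δ`.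
  have key : ∀ δ : 𝟙_ C ⟶ A, T.IsPureNormState δ → ∀ c : A ⟶ 𝟙_ C,
      T.pair e σ * T.pair c γ + T.pair e (ρ - σ) * T.pair c δ = 0 := by
    intro δ hδ c
    obtain ⟨E, Ω, ψ, g, -, hψ, -, -, hg, hΩ⟩ := hT.exists_extension hΦ
      (S := σ ≫ insR γ A + (ρ - σ) ≫ insR δ A)
      (hT.inCone_add (hT.inCone_tens hσ hγ.1.1) (hT.inCone_tens hσ' hδ.1.1))
      (by simp only [rmap_add_state, hT.isOPT.rmap_insR, hT.pair_disc_pure hγ,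
        hT.pair_disc_pure hδ, one_smul, add_sub_cancel]; rfl)
    have h1 : lmap Ω e = 0 := by
      have h2 := congrArg (fun Ξ => lmap (lmap Ξ e) (hT.disc B)) hg
      simp only [lmap_whiskerLeft, he, hT.isOPT.lmap_insL, hT.pair_disc_pure hψ, one_smul] at h2
      simpa [lmap] using h2.symm
    have h3 := hΩ e
    rw [h1, lmap_add_state, hT.isOPT.lmap_insR, hT.isOPT.lmap_insR] at h3
    have h4 := congrArg (T.pair c) h3
    simpa [rmap] using h4.symm
  by_contra hne
  have hall : ∀ δ : 𝟙_ C ⟶ A, T.IsPureNormState δ → δ = γ := by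
    intro δ hδ
    rw [← sub_eq_zero]
    refine hT.state_ext fun c _ => ?_
    have h5 := key δ hδ c
    rw [pair_sub_right, heρ] at h5
    have h6 : T.pair e σ * (T.pair c δ - T.pair c γ) = 0 := by linarith
    rw [pair_sub_right]
    exact (mul_eq_zero.1 h6).resolve_left hne
  -- With a single pure state, all states are proportional to `ρ`.
  have hray : ∀ τ : 𝟙_ C ⟶ A, τ = T.pair (hT.disc A) τ • γ := by
    intro τ
    have h7 : LinearMap.id = (T.pairR (hT.disc A)).smulRight γ :=
      hT.linearMap_ext_pure fun δ hδ => by simp [hall δ hδ, hT.pair_disc_pure hγ]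
    simpa using LinearMap.congr_fun h7 τ
  have h8 : T.pair e γ = 0 := by
    rw [hray ρ, hρ1, one_smul] at heρ
    exact heρ
  exact hne (by rw [hray σ, pair_smul_right, h8, mul_zero])

end IsSharpWithPurification

end Sharp

/-! ### Invariant inner products -/

open MeasureTheory in
/-- A bounded spanning set `S` of a finite-dimensional real vector space determines an inner product
that is preserved by all linear automorphisms that preserve `S`: it is obtained by integrating
`(c x) * (c y)` over all `c` in the polar of `S`. -/
theorem exists_invariant_form {V : Type*} [AddCommGroup V] [Module ℝ V] [FiniteDimensional ℝ V]
    {S : Set V} (hspan : Submodule.span ℝ S = ⊤)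
    (hbdd : ∀ f : Module.Dual ℝ V, ∃ M : ℝ, ∀ x ∈ S, |f x| ≤ M) :
    ∃ Q : V →ₗ[ℝ] V →ₗ[ℝ] ℝ, (∀ x y, Q x y = Q y x) ∧ (∀ x, x ≠ 0 → 0 < Q x x) ∧
      ∀ g : V ≃ₗ[ℝ] V, (∀ x, g x ∈ S ↔ x ∈ S) → ∀ x y, Q (g x) (g y) = Q x y := by
  classical
  let b := Module.finBasis ℝ V
  let e : Module.Dual ℝ V ≃ₗ[ℝ] (Fin (Module.finrank ℝ V) → ℝ) := b.dualBasis.equivFun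
  have he : ∀ c i, e.symm c (b i) = c i := by
    intro c i
    have h1 : e (e.symm c) i = c i := by rw [e.apply_symm_apply]
    rw [← h1]
    simp [e]
  let P : Set (Fin (Module.finrank ℝ V) → ℝ) := {c | ∀ x ∈ S, |e.symm c x| ≤ 1}
  have hcont : ∀ x, Continuous fun c => e.symm c x := fun x =>
    LinearMap.continuous_of_finiteDimensional
      ((LinearMap.applyₗ x).comp e.symm.toLinearMap : (Fin _ → ℝ) →ₗ[ℝ] ℝ)
  have hPclosed : IsClosed P := by
    have : P = ⋂ x ∈ S, {c | |e.symm c x| ≤ 1} := by ext; simp [P]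
    rw [this]
    exact isClosed_biInter fun x _ => isClosed_le (hcont x).abs continuous_const
  have hPbdd : Bornology.IsBounded P := by
    have key : ∀ x : V, ∃ M : ℝ, ∀ c ∈ P, |e.symm c x| ≤ M := by
      intro x
      have hx : x ∈ Submodule.span ℝ S := hspan ▸ Submodule.mem_top
      induction hx using Submodule.span_induction with
      | mem x hx => exact ⟨1, fun c hc => hc x hx⟩
      | zero => exact ⟨0, by simp⟩
      | add x y _ _ hx hy =>
        obtain ⟨M, hM⟩ := hx
        obtain ⟨N, hN⟩ := hy
        refine ⟨M + N, fun c hc => ?_⟩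
        rw [map_add]
        exact (abs_add_le _ _).trans (add_le_add (hM c hc) (hN c hc))
      | smul r x _ hx =>
        obtain ⟨M, hM⟩ := hx
        refine ⟨|r| * M, fun c hc => ?_⟩
        rw [map_smul, smul_eq_mul, abs_mul]
        exact mul_le_mul_of_nonneg_left (hM c hc) (abs_nonneg r)
    choose M hM using fun i => key (b i)
    rw [← Bornology.forall_isBounded_image_eval_iff]
    intro i
    refine (Metric.isBounded_closedBall (x := (0 : ℝ)) (r := M i)).subset ?_
    rintro _ ⟨c, hc, rfl⟩
    have := hM i c hc
    rw [he] at this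
    simpa using this
  have hPcomp : IsCompact P := Metric.isCompact_of_isClosed_isBounded hPclosed hPbdd
  -- The polar of a bounded set is a neighbourhood of zero.
  have hPnhds : P ∈ 𝓝 (0 : Fin (Module.finrank ℝ V) → ℝ) := by
    choose M hM using fun i => hbdd (b.coord i)
    have hM' : ∀ i, ∀ x ∈ S, |b.repr x i| ≤ |M i| := fun i x hx =>
      (hM i x hx).trans (le_abs_self _)
    have h1 : Continuous fun c : Fin (Module.finrank ℝ V) → ℝ => ∑ i, |c i| * |M i| := by
      fun_prop
    have h2 : ∀ᶠ c in 𝓝 (0 : Fin (Module.finrank ℝ V) → ℝ), ∑ i, |c i| * |M i| < 1 :=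
      h1.tendsto' 0 0 (by simp) |>.eventually (gt_mem_nhds one_pos)
    filter_upwards [h2] with c hc x hx
    have h3 : e.symm c x = ∑ i, b.repr x i * c i := by
      conv_lhs => rw [← b.sum_repr x]
      simp only [map_sum, map_smul, he, smul_eq_mul]
    rw [h3]
    refine (Finset.abs_sum_le_sum_abs _ _).trans (le_trans (Finset.sum_le_sum fun i _ => ?_) hc.le)
    rw [abs_mul, mul_comm]
    exact mul_le_mul_of_nonneg_left (hM' i x hx) (abs_nonneg _)
  have hint : ∀ x y, IntegrableOn (fun c => e.symm c x * e.symm c y) P := fun x y =>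
    ((hcont x).mul (hcont y)).continuousOn.integrableOn_compact hPcomp
  let Q : V →ₗ[ℝ] V →ₗ[ℝ] ℝ := LinearMap.mk₂ ℝ (fun x y => ∫ c in P, e.symm c x * e.symm c y)
    (fun x x' y => by
      simp only [map_add, add_mul]
      exact integral_add (hint x y) (hint x' y))
    (fun r x y => by
      simp only [map_smul, smul_eq_mul, mul_assoc]
      exact integral_const_mul _ _)
    (fun x y y' => by
      simp only [map_add, mul_add]
      exact integral_add (hint x y) (hint x y'))
    (fun r x y => by
      simp only [map_smul, smul_eq_mul, mul_left_comm]
      exact integral_const_mul _ _)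
  refine ⟨Q, fun x y => ?_, fun x hx => ?_, fun g hg x y => ?_⟩
  · simp only [Q, LinearMap.mk₂_apply, mul_comm]
  · simp only [Q, LinearMap.mk₂_apply]
    rw [setIntegral_pos_iff_support_of_nonneg_ae
      (ae_of_all _ fun c => mul_self_nonneg _) (hint x x)]
    have hopen : IsOpen ({c | e.symm c x ≠ 0} ∩ interior P) :=
      ((hcont x).isOpen_preimage _ isOpen_ne).inter isOpen_interior
    refine (hopen.measure_pos volume ?_).trans_le (measure_mono ?_)
    · obtain ⟨f, hf⟩ : ∃ f : Module.Dual ℝ V, f x ≠ 0 := by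
        by_contra! h
        exact hx ((Module.forall_dual_apply_eq_zero_iff ℝ x).1 h)
      have h1 : Tendsto (fun n : ℕ => ((n : ℝ) + 1)⁻¹ • e f) atTop (𝓝 0) := by
        have h2 : Tendsto (fun n : ℕ => ((n : ℝ) + 1)⁻¹) atTop (𝓝 0) := by
          simpa [one_div] using tendsto_one_div_add_atTop_nhds_zero_nat (𝕜 := ℝ)
        simpa using h2.smul_const (e f)
      obtain ⟨n, hn⟩ := (h1.eventually (interior_mem_nhds.2 hPnhds)).exists
      refine ⟨_, ?_, hn⟩
      have : ((n : ℝ) + 1) ≠ 0 := by positivity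
      simp [hf, this]
    · rintro c ⟨h1, h2⟩
      exact ⟨mul_self_ne_zero.2 h1, interior_subset h2⟩
  · -- The transpose of `g` preserves the polar, hence it has determinant `±1`.
    let f : (Fin (Module.finrank ℝ V) → ℝ) ≃ₗ[ℝ] (Fin (Module.finrank ℝ V) → ℝ) :=
      e.symm.trans (g.dualMap.trans e)
    have hf : ∀ c x, e.symm (f c) x = e.symm c (g x) := fun c x => by simp [f]
    have hfP : f ⁻¹' P = P := by
      ext c
      simp only [P, Set.mem_preimage, Set.mem_ofPred_eq, hf]
      constructor
      · intro h x hx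
        simpa using h (g.symm x) (by rw [← hg]; simpa using hx)
      · exact fun h x hx => h _ ((hg x).2 hx)
    have hdet : LinearMap.det f.toLinearMap ≠ 0 := (LinearEquiv.isUnit_det' f).ne_zero
    have h1 := Measure.addHaar_preimage_linearMap volume hdet P
    have h2 : f.toLinearMap ⁻¹' P = P := hfP
    rw [h2] at h1
    have h0 : volume P ≠ 0 := (Measure.measure_pos_of_mem_nhds volume hPnhds).ne'
    have h3 : ENNReal.ofReal |(LinearMap.det f.toLinearMap)⁻¹| = 1 := by
      have h4 : 1 * volume P = ENNReal.ofReal |(LinearMap.det f.toLinearMap)⁻¹| * volume P := by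
        rw [one_mul]; exact h1
      exact ((ENNReal.mul_left_inj h0 hPcomp.measure_lt_top.ne).1 h4).symm
    have hmp : MeasurePreserving f volume volume := by
      refine ⟨f.toLinearMap.continuous_of_finiteDimensional.measurable, ?_⟩
      have := Measure.map_linearMap_addHaar_eq_smul_addHaar (μ := volume) hdet
      rw [h3, one_smul] at this
      exact this
    have hemb : MeasurableEmbedding f :=
      f.toContinuousLinearEquiv.toHomeomorph.measurableEmbedding
    have h5 := hmp.setIntegral_preimage_emb hemb (fun c => e.symm c x * e.symm c y) P
    rw [hfP] at h5
    simp only [hf] at h5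
    simpa only [Q, LinearMap.mk₂_apply] using h5

section Sharp

variable {C : Type u} [Category.{v} C] [MonoidalCategory C] [SymmetricCategory C]
  [Preadditive C] [Linear ℝ C] [MonoidalPreadditive C] [MonoidalLinear ℝ C] {T : ProbTheory C}

namespace IsSharpWithPurification

/-- Every functional on `St_ℝ(A)` is the pairing with an element of `Eff_ℝ(A)`. -/
theorem exists_pairR_eq (hT : T.IsSharpWithPurification) {A : C}
    (f : Module.Dual ℝ (𝟙_ C ⟶ A)) : ∃ e : A ⟶ 𝟙_ C, T.pairR e = f := by
  have := hT.isOPT.finite_system A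
  let L : (A ⟶ 𝟙_ C) →ₗ[ℝ] Module.Dual ℝ (𝟙_ C ⟶ A) :=
    { toFun := T.pairR
      map_add' := fun a b => by ext; simp
      map_smul' := fun r a => by ext; simp }
  have h1 : (LinearMap.range L).dualCoannihilator = ⊥ := by
    rw [eq_bot_iff]
    intro ξ hξ
    rw [Submodule.mem_dualCoannihilator] at hξ
    exact hT.state_ext fun a _ => hξ _ ⟨a, rfl⟩
  have h2 := Subspace.dualCoannihilator_dualAnnihilator_eq (W := LinearMap.range L)
  rw [h1, Submodule.dualAnnihilator_bot] at h2
  have h3 : f ∈ LinearMap.range L := h2 ▸ Submodule.mem_top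
  exact h3

theorem exists_abs_pair_le (hT : T.IsSharpWithPurification) {A : C} (e : A ⟶ 𝟙_ C) :
    ∃ M : ℝ, ∀ ρ : 𝟙_ C ⟶ A, T.InCone ρ → T.pair (hT.disc A) ρ = 1 → |T.pair e ρ| ≤ M := by
  have he : e ∈ Submodule.span ℝ {f : A ⟶ 𝟙_ C | T.IsTransf f} :=
    hT.isOPT.span_transf A (𝟙_ C) ▸ Submodule.mem_top
  induction he using Submodule.span_induction with
  | mem a ha =>
    refine ⟨1, fun ρ hρ h1 => ?_⟩
    rw [abs_of_nonneg (hT.inCone_pair_nonneg hρ ha), ← h1]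
    exact hT.inCone_pair_le_disc hρ ha
  | zero => exact ⟨0, by simp⟩
  | add x y _ _ hx hy =>
    obtain ⟨M, hM⟩ := hx
    obtain ⟨N, hN⟩ := hy
    refine ⟨M + N, fun ρ hρ h1 => ?_⟩
    rw [pair_add_left]
    exact (abs_add_le _ _).trans (add_le_add (hM ρ hρ h1) (hN ρ hρ h1))
  | smul r x _ hx =>
    obtain ⟨M, hM⟩ := hx
    refine ⟨|r| * M, fun ρ hρ h1 => ?_⟩
    rw [pair_smul_left, abs_mul]
    exact mul_le_mul_of_nonneg_left (hM ρ hρ h1) (abs_nonneg r)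

/-- The normalised states. -/
def normStates (hT : T.IsSharpWithPurification) (A : C) :
    Set (𝟙_ C ⟶ A) := {ρ | T.InCone ρ ∧ T.pair (hT.disc A) ρ = 1}

theorem pure_mem_normStates (hT : T.IsSharpWithPurification) {A : C} {α : 𝟙_ C ⟶ A}
    (hα : T.IsPureNormState α) : α ∈ hT.normStates A := ⟨hα.inCone, hT.pair_disc_pure hα⟩

/-- The linear automorphism of `St_ℝ(A)` given by a pair of inverse transformations. -/
def compEquiv {A : C} (U V : A ⟶ A) (h1 : U ≫ V = 𝟙 A) (h2 : V ≫ U = 𝟙 A) :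
    (𝟙_ C ⟶ A) ≃ₗ[ℝ] (𝟙_ C ⟶ A) where
  toFun ξ := ξ ≫ U
  invFun ξ := ξ ≫ V
  map_add' := by simp
  map_smul' := by simp
  left_inv ξ := by simp [h1]
  right_inv ξ := by simp [h2]

theorem comp_mem_normStates (hT : T.IsSharpWithPurification) {A : C} {U : A ⟶ A}
    (hU : T.IsChannel U) {ρ : 𝟙_ C ⟶ A} (hρ : ρ ∈ hT.normStates A) :
    ρ ≫ U ∈ hT.normStates A :=
  ⟨hT.inCone_comp hρ.1 hU.isTransf, by rw [hT.pair_disc_comp hU, hρ.2]⟩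

/-- `St_ℝ(A)` has an inner product that is invariant under reversible channels. -/
theorem exists_invariant_inner (hT : T.IsSharpWithPurification) (A : C) :
    ∃ Q : (𝟙_ C ⟶ A) →ₗ[ℝ] (𝟙_ C ⟶ A) →ₗ[ℝ] ℝ, (∀ x y, Q x y = Q y x) ∧
      (∀ x, x ≠ 0 → 0 < Q x x) ∧
      ∀ U : A ⟶ A, T.IsReversible U → ∀ x y, Q (x ≫ U) (y ≫ U) = Q x y := by
  have := hT.isOPT.finite_system A
  obtain ⟨Q, hQs, hQp, hQ⟩ := exists_invariant_form (S := hT.normStates A)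
    (by
      rw [eq_top_iff, ← hT.span_pure A]
      exact Submodule.span_mono fun α hα => hT.pure_mem_normStates hα)
    (fun f => by
      obtain ⟨e, rfl⟩ := hT.exists_pairR_eq f
      obtain ⟨M, hM⟩ := hT.exists_abs_pair_le e
      exact ⟨M, fun x hx => hM x hx.1 hx.2⟩)
  refine ⟨Q, hQs, hQp, ?_⟩
  rintro U ⟨hU, V, hV, h1, h2⟩ x y
  refine hQ (compEquiv U V h1 h2) (fun ρ => ⟨fun h => ?_, hT.comp_mem_normStates hU⟩) x y
  have := hT.comp_mem_normStates hV h
  simpa [compEquiv, h1] using this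

/-- Every system has a normalised state that is invariant under reversible channels: the one of
smallest norm for an invariant inner product. -/
theorem exists_invariant_state (hT : T.IsSharpWithPurification) (A : C) :
    ∃ χ : 𝟙_ C ⟶ A, T.InCone χ ∧ T.pair (hT.disc A) χ = 1 ∧
      ∀ U : A ⟶ A, T.IsReversible U → χ ≫ U = χ := by
  have := hT.isOPT.finite_system A
  obtain ⟨Q, hQs, hQp, hQ⟩ := hT.exists_invariant_inner A
  let φ : (𝟙_ C ⟶ A) ≃ₗ[ℝ] (Fin (Module.finrank ℝ (𝟙_ C ⟶ A)) → ℝ) :=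
    (Module.finBasis ℝ (𝟙_ C ⟶ A)).equivFun
  let K := φ.symm ⁻¹' (hT.normStates A)
  have hpair : ∀ e : A ⟶ 𝟙_ C, Continuous fun c => T.pair e (φ.symm c) := fun e =>
    ((T.pairR e).comp φ.symm.toLinearMap).continuous_of_finiteDimensional
  have hKclosed : IsClosed K := by
    refine IsSeqClosed.isClosed fun x c hx hxc => ?_
    have h1 : ∀ e : A ⟶ 𝟙_ C, Tendsto (fun n => T.pair e (φ.symm (x n))) atTop
        (𝓝 (T.pair e (φ.symm c))) := fun e => ((hpair e).tendsto c).comp hxc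
    refine ⟨hT.inCone_of_tendsto (fun n => (hx n).1) fun a _ => h1 a, ?_⟩
    refine tendsto_nhds_unique (h1 (hT.disc A)) ?_
    simp only [(hx _).2]
    exact tendsto_const_nhds
  have hKbdd : Bornology.IsBounded K := by
    rw [← Bornology.forall_isBounded_image_eval_iff]
    intro i
    obtain ⟨e, he⟩ := hT.exists_pairR_eq ((LinearMap.proj i).comp φ.toLinearMap)
    obtain ⟨M, hM⟩ := hT.exists_abs_pair_le e
    refine (Metric.isBounded_closedBall (x := (0 : ℝ)) (r := M)).subset ?_
    rintro _ ⟨c, hc, rfl⟩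
    have h1 := hM _ hc.1 hc.2
    have h2 := LinearMap.congr_fun he (φ.symm c)
    simp only [pairR_apply, LinearMap.comp_apply, LinearEquiv.coe_coe, LinearEquiv.apply_symm_apply,
      LinearMap.proj_apply] at h2
    rw [h2] at h1
    simpa using h1
  have hKcomp : IsCompact K := Metric.isCompact_of_isClosed_isBounded hKclosed hKbdd
  have hKne : K.Nonempty := by
    obtain ⟨ρ, hρ, hρ1⟩ := hT.exists_state_one A
    exact ⟨φ ρ, by simpa [K, normStates] using ⟨hρ.inCone, hρ1⟩⟩
  have hQcont : Continuous fun c => Q (φ.symm c) (φ.symm c) := by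
    have h1 : ∀ c, Q (φ.symm c) (φ.symm c) = ∑ i, c i * Q (φ.symm (Pi.single i 1)) (φ.symm c) := by
      intro c
      have h2 : φ.symm c = ∑ i, c i • φ.symm (Pi.single i 1) := by
        conv_lhs => rw [pi_eq_sum_univ' c]
        simp
      nth_rewrite 1 [h2]
      simp
    simp only [h1]
    refine continuous_finsetSum _ fun i _ => (continuous_apply i).mul ?_
    exact ((Q (φ.symm (Pi.single i 1))).comp
      φ.symm.toLinearMap).continuous_of_finiteDimensional
  obtain ⟨c, hc, hmin⟩ := hKcomp.exists_isMinOn hKne hQcont.continuousOn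
  set χ := φ.symm c with hχ
  have hmin' : ∀ ρ ∈ hT.normStates A, Q χ χ ≤ Q ρ ρ := fun ρ hρ => by
    have := hmin (show φ ρ ∈ K by simpa [K] using hρ)
    simpa [hχ] using this
  refine ⟨χ, hc.1, hc.2, fun U hU => ?_⟩
  have hUχ := hT.comp_mem_normStates hU.1 hc
  -- The midpoint of `χ` and its image would have smaller norm if these were different.
  by_contra hne
  have h1 := hmin' ((1 / 2 : ℝ) • (χ ≫ U) + (1 / 2 : ℝ) • χ)
    ⟨hT.inCone_add (hUχ.1.smul (by norm_num)) (hc.1.smul (by norm_num)), by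
      have h2 : T.pair (hT.disc A) χ = 1 := hc.2
      have h3 : T.pair (hT.disc A) (χ ≫ U) = 1 := hUχ.2
      simp only [pair_add_right, pair_smul_right, h2, h3]
      norm_num⟩
  have h4 := hQp _ (sub_ne_zero.2 hne)
  have h5 := hQ U hU χ χ
  have h6 := hQs χ (χ ≫ U)
  simp only [map_add, map_sub, map_smul, LinearMap.add_apply, LinearMap.sub_apply,
    LinearMap.smul_apply, smul_eq_mul] at h1 h4
  linarith

/-! ### The effect associated with a pure state -/

/-- An invariant state dominates a common multiple of all pure states. -/
theorem exists_invariant_state_ge (hT : T.IsSharpWithPurification) (A : C) :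
    ∃ χ : 𝟙_ C ⟶ A, T.InCone χ ∧ T.pair (hT.disc A) χ = 1 ∧
      (∀ U : A ⟶ A, T.IsReversible U → χ ≫ U = χ) ∧
      ∃ r : ℝ, 0 < r ∧ ∀ α : 𝟙_ C ⟶ A, T.IsPureNormState α → T.InCone (χ - r • α) := by
  obtain ⟨χ, hχ, hχ1, hinv⟩ := hT.exists_invariant_state A
  obtain ⟨α, hα, r, hr, h⟩ := hT.exists_pure_le hχ (fun h => by simp [h] at hχ1)
  refine ⟨χ, hχ, hχ1, hinv, r, hr, fun α' hα' => ?_⟩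
  obtain ⟨U, hU, rfl⟩ := hT.exists_reversible_pure hα hα'
  have := hT.inCone_comp h hU.1.isTransf
  simpa [Preadditive.sub_comp, hinv U hU] using this

/-- A purification of a state that dominates multiples of all pure states is faithful. -/
theorem lmap_injective (hT : T.IsSharpWithPurification) {A B : C} {Φ : 𝟙_ C ⟶ A ⊗ B}
    (hΦ : T.IsPureNormState Φ) {r : ℝ} (hr : 0 < r)
    (h : ∀ α : 𝟙_ C ⟶ A, T.IsPureNormState α → T.InCone (rmap Φ (hT.disc B) - r • α))
    {e e' : A ⟶ 𝟙_ C} (he : lmap Φ e = lmap Φ e') : e = e' := by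
  refine hT.effect_ext_pure fun α hα => ?_
  have h0 : lmap Φ (e - e') = 0 := by rw [lmap_sub, he, sub_self]
  have h1 := hT.pair_eq_zero_of_lmap hΦ h0 (hα.inCone.smul hr.le) (h α hα)
  rw [pair_smul_right, pair_sub_left] at h1
  have := (mul_eq_zero.1 h1).resolve_left hr.ne'
  linarith

theorem inCone_sub_rmap (hT : T.IsSharpWithPurification) {A B : C} {Φ : 𝟙_ C ⟶ A ⊗ B}
    (hΦ : T.InCone Φ) {b : B ⟶ 𝟙_ C} (hb : T.IsEffect b) :
    T.InCone (rmap Φ (hT.disc B) - rmap Φ b) := by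
  rw [← rmap_sub]
  exact hT.inCone_rmap hΦ (hT.isEffect_compl hb)

theorem inCone_sub_lmap (hT : T.IsSharpWithPurification) {A B : C} {Φ : 𝟙_ C ⟶ A ⊗ B}
    (hΦ : T.InCone Φ) {e : A ⟶ 𝟙_ C} (he : T.IsEffect e) :
    T.InCone (lmap Φ (hT.disc A) - lmap Φ e) := by
  rw [← lmap_sub]
  exact hT.inCone_lmap hΦ (hT.isEffect_compl he)

/-- The correspondence between a pure state `α` with a sharp effect `a` and a pure state `β` with a
sharp effect `b` of the purifying system, for a state `ρ` on which no sharp effect identifying a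
pure state is more probable than `a`. -/
theorem exists_partner (hT : T.IsSharpWithPurification) {A B : C} {Φ : 𝟙_ C ⟶ A ⊗ B}
    (hΦ : T.IsPureNormState Φ) {a : A ⟶ 𝟙_ C} (ha : T.IsPure a) {α : 𝟙_ C ⟶ A}
    (hα : T.IsPureNormState α) (haα : T.pair a α = 1)
    (hp : 0 < T.pair a (rmap Φ (hT.disc B)))
    (hmax : ∀ ψ : 𝟙_ C ⟶ A, T.IsPureNormState ψ → ∃ c : A ⟶ 𝟙_ C, T.IsEffect c ∧
      T.pair c ψ = 1 ∧ T.pair c (rmap Φ (hT.disc B)) ≤ T.pair a (rmap Φ (hT.disc B))) :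
    ∃ β : 𝟙_ C ⟶ B, T.IsPureNormState β ∧
      lmap Φ a = T.pair a (rmap Φ (hT.disc B)) • β ∧
      ∀ b : B ⟶ 𝟙_ C, T.IsPure b → T.pair b β = 1 →
        rmap Φ b = T.pair a (rmap Φ (hT.disc B)) • α := by
  set p := T.pair a (rmap Φ (hT.disc B)) with hpdef
  have hu : T.pair (hT.disc B) (lmap Φ a) = p := by rw [pair_lmap]
  obtain ⟨β, hβ, hβe⟩ := hT.exists_pure_smul (hT.isPure_lmap hΦ.1 ha) (by rw [hu]; exact hp)
  rw [hu] at hβe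
  refine ⟨β, hβ, hβe, fun b hb hbβ => ?_⟩
  have h1 : T.pair a (rmap Φ b) = p := by
    rw [← pair_lmap, hβe, pair_smul_right, hbβ, mul_one]
  have h2 : p ≤ T.pair (hT.disc A) (rmap Φ b) :=
    h1 ▸ hT.inCone_pair_le_disc (hT.inCone_rmap hΦ.inCone hb.1) ha.1
  obtain ⟨α₁, hα₁, hα₁e⟩ := hT.exists_pure_smul (hT.isPure_rmap hΦ.1 hb) (hp.trans_le h2)
  set q := T.pair (hT.disc A) (rmap Φ b) with hq
  obtain ⟨c, hc, hcα, hcp⟩ := hmax α₁ hα₁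
  have h3 : q ≤ p := by
    have h4 := hT.inCone_pair_nonneg (hT.inCone_sub_rmap hΦ.inCone hb.1) hc
    rw [hα₁e, pair_sub_right, pair_smul_right, hcα, mul_one] at h4
    linarith
  have h5 : q = p := le_antisymm h3 h2
  rw [h5] at hα₁e
  rw [hα₁e, pair_smul_right] at h1
  have h6 : T.pair a α₁ = 1 := by
    have : p * (T.pair a α₁ - 1) = 0 := by linarith
    linarith [(mul_eq_zero.1 this).resolve_left hp.ne']
  rw [hα₁e, hT.eq_of_pair_eq_one ha hα₁.inCone (hT.pair_disc_pure hα₁) h6 hα.inCone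
    (hT.pair_disc_pure hα) haα]

/-- There is only one pure effect that gives a given pure state with certainty. -/
theorem sharp_unique (hT : T.IsSharpWithPurification) {A : C} {a a' : A ⟶ 𝟙_ C}
    (ha : T.IsPure a) (ha' : T.IsPure a') {α : 𝟙_ C ⟶ A} (hα : T.IsPureNormState α)
    (haα : T.pair a α = 1) (haα' : T.pair a' α = 1) : a = a' := by
  obtain ⟨χ, hχ, hχ1, hinv, r, hr, hχr⟩ := hT.exists_invariant_state_ge A
  obtain ⟨B, Φ, hΦ, rfl⟩ := hT.exists_purification hχ hχ1
  set χ := rmap Φ (hT.disc B) with hχdef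
  have hpos : ∀ c : A ⟶ 𝟙_ C, T.IsPure c → T.pair c α = 1 → 0 < T.pair c χ := by
    intro c hc hcα
    have := hT.inCone_pair_nonneg (hχr α hα) hc.1
    rw [pair_sub_right, pair_smul_right, hcα] at this
    linarith
  have hmax : ∀ c : A ⟶ 𝟙_ C, T.IsPure c → T.pair c α = 1 → ∀ ψ : 𝟙_ C ⟶ A,
      T.IsPureNormState ψ → ∃ d : A ⟶ 𝟙_ C, T.IsEffect d ∧ T.pair d ψ = 1 ∧
        T.pair d χ ≤ T.pair c χ := by
    intro c hc hcα ψ hψ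
    obtain ⟨U, hU, hUe⟩ := hT.exists_reversible_pure hψ hα
    exact ⟨U ≫ c, hT.isOPT.transf_comp hU.1.isTransf hc.1, by rw [pair_comp, ← hUe, hcα],
      by rw [pair_comp, hinv U hU]⟩
  have hle : ∀ c d : A ⟶ 𝟙_ C, T.IsPure c → T.pair c α = 1 → T.IsPure d → T.pair d α = 1 →
      T.pair c χ ≤ T.pair d χ := by
    intro c d hc hcα hd hdα
    obtain ⟨β, hβ, -, h⟩ := hT.exists_partner hΦ hc hα hcα (hpos c hc hcα) (hmax c hc hcα)
    obtain ⟨b, hb, hbβ⟩ := hT.exists_sharp hβ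
    have := hT.inCone_pair_nonneg (hT.inCone_sub_rmap hΦ.inCone hb.1) hd.1
    rw [h b hb hbβ, pair_sub_right, pair_smul_right, hdα] at this
    linarith
  have hpp : T.pair a' χ = T.pair a χ := le_antisymm (hle _ _ ha' haα' ha haα)
    (hle _ _ ha haα ha' haα')
  have hp := hpos a ha haα
  obtain ⟨β, hβ, hβe, h⟩ := hT.exists_partner hΦ ha hα haα hp (hmax a ha haα)
  obtain ⟨β', hβ', hβe', -⟩ := hT.exists_partner hΦ ha' hα haα' (hpos a' ha' haα')
    (hmax a' ha' haα')
  rw [← hχdef] at hβe hβe'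
  rw [hpp] at hβe'
  obtain ⟨b, hb, hbβ⟩ := hT.exists_sharp hβ
  have h1 : T.pair b β' = 1 := by
    have h2 : T.pair b (lmap Φ a') = T.pair a χ := by
      rw [pair_lmap, h b hb hbβ, pair_smul_right, haα', mul_one]
    rw [hβe', pair_smul_right] at h2
    have : T.pair a χ * (T.pair b β' - 1) = 0 := by linarith
    linarith [(mul_eq_zero.1 this).resolve_left hp.ne']
  have h3 : β = β' := hT.eq_of_pair_eq_one hb hβ.inCone (hT.pair_disc_pure hβ) hbβ hβ'.inCone
    (hT.pair_disc_pure hβ') h1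
  exact hT.lmap_injective hΦ hr hχr (by rw [hβe, hβe', h3])

open Classical in
/-- The pure effect `α†` that gives the normalised pure state `α` with certainty; the value at
other vectors is `0`. -/
noncomputable def dag (hT : T.IsSharpWithPurification) {A : C} (α : 𝟙_ C ⟶ A) : A ⟶ 𝟙_ C :=
  if h : T.IsPureNormState α then (hT.exists_sharp h).choose else 0

section dag

variable {A : C} {α ψ : 𝟙_ C ⟶ A}

theorem isPure_dag (hT : T.IsSharpWithPurification) (hα : T.IsPureNormState α) :
    T.IsPure (hT.dag α) := by
  rw [dag, dif_pos hα]
  exact (hT.exists_sharp hα).choose_spec.1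

theorem pair_dag_self (hT : T.IsSharpWithPurification) (hα : T.IsPureNormState α) :
    T.pair (hT.dag α) α = 1 := by
  rw [dag, dif_pos hα]
  exact (hT.exists_sharp hα).choose_spec.2

theorem eq_dag (hT : T.IsSharpWithPurification) (hα : T.IsPureNormState α) {a : A ⟶ 𝟙_ C}
    (ha : T.IsPure a) (h : T.pair a α = 1) : a = hT.dag α :=
  hT.sharp_unique ha (hT.isPure_dag hα) hα h (hT.pair_dag_self hα)

theorem pair_dag_nonneg (hT : T.IsSharpWithPurification) (hα : T.IsPureNormState α)
    {ξ : 𝟙_ C ⟶ A} (hξ : T.InCone ξ) : 0 ≤ T.pair (hT.dag α) ξ :=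
  hT.inCone_pair_nonneg hξ (hT.isPure_dag hα).1

theorem pair_dag_le (hT : T.IsSharpWithPurification) (hα : T.IsPureNormState α)
    {ξ : 𝟙_ C ⟶ A} (hξ : T.InCone ξ) : T.pair (hT.dag α) ξ ≤ T.pair (hT.disc A) ξ :=
  hT.inCone_pair_le_disc hξ (hT.isPure_dag hα).1

theorem pair_dag_le_one (hT : T.IsSharpWithPurification) (hα : T.IsPureNormState α)
    (hψ : T.IsPureNormState ψ) : T.pair (hT.dag α) ψ ≤ 1 :=
  hT.pair_disc_pure hψ ▸ hT.pair_dag_le hα hψ.inCone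

/-- A vector of the cone on which `α†` is as probable as the deterministic effect is a multiple of
`α`. -/
theorem eq_smul_of_pair_dag (hT : T.IsSharpWithPurification) (hα : T.IsPureNormState α)
    {ξ : 𝟙_ C ⟶ A} (hξ : T.InCone ξ) (h : T.pair (hT.dag α) ξ = T.pair (hT.disc A) ξ) :
    ξ = T.pair (hT.disc A) ξ • α := by
  rcases (hT.inCone_disc_nonneg hξ).eq_or_lt with h0 | h0
  · rw [← h0, zero_smul, hT.inCone_eq_zero hξ h0.symm]
  · rw [← hT.eq_of_pair_eq_one (hT.isPure_dag hα) (hξ.smul (inv_nonneg.2 h0.le))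
      (by simp [h0.ne']) (by simp [h, h0.ne']) hα.inCone (hT.pair_disc_pure hα)
      (hT.pair_dag_self hα), smul_smul, mul_inv_cancel₀ h0.ne', one_smul]

theorem eq_of_pair_dag (hT : T.IsSharpWithPurification) (hα : T.IsPureNormState α)
    (hψ : T.IsPureNormState ψ) (h : T.pair (hT.dag α) ψ = 1) : ψ = α := by
  have := hT.eq_smul_of_pair_dag hα hψ.inCone (by rw [h, hT.pair_disc_pure hψ])
  rwa [hT.pair_disc_pure hψ, one_smul] at this

theorem dag_comp (hT : T.IsSharpWithPurification) {B : C} (hα : T.IsPureNormState α) {U : A ⟶ B}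
    {V : B ⟶ A} (hU : T.IsChannel U) (hV : T.IsChannel V) (h1 : U ≫ V = 𝟙 A)
    (h2 : V ≫ U = 𝟙 B) : hT.dag (α ≫ U) = V ≫ hT.dag α := by
  refine (hT.eq_dag (hT.pure_comp_reversible hα ⟨hU, V, hV, h1, h2⟩)
    (hT.isOPT.isPure_reversible_comp (hT.isPure_dag hα) ⟨hV, U, hU, h2, h1⟩) ?_).symm
  rw [pair_comp, Category.assoc, h1, Category.comp_id, hT.pair_dag_self hα]

/-- The correspondence of pure states given by a purification of a state `ρ` on which no `ψ†` is
more probable than `α†`. -/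
theorem exists_partner_dag (hT : T.IsSharpWithPurification) {B : C} {Φ : 𝟙_ C ⟶ A ⊗ B}
    (hΦ : T.IsPureNormState Φ) (hα : T.IsPureNormState α) {p : ℝ} (hp : 0 < p)
    (h : T.pair (hT.dag α) (rmap Φ (hT.disc B)) = p)
    (hmax : ∀ ψ : 𝟙_ C ⟶ A, T.IsPureNormState ψ →
      T.pair (hT.dag ψ) (rmap Φ (hT.disc B)) ≤ p) :
    ∃ β : 𝟙_ C ⟶ B, T.IsPureNormState β ∧ lmap Φ (hT.dag α) = p • β ∧
      rmap Φ (hT.dag β) = p • α := by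
  subst h
  obtain ⟨β, hβ, h1, h2⟩ := hT.exists_partner hΦ (hT.isPure_dag hα) hα (hT.pair_dag_self hα) hp
    fun ψ hψ => ⟨_, (hT.isPure_dag hψ).1, hT.pair_dag_self hψ, hmax ψ hψ⟩
  exact ⟨β, hβ, h1, h2 _ (hT.isPure_dag hβ) (hT.pair_dag_self hβ)⟩

/-- The most probable `α†` on `ρ` belongs to an eigenstate of `ρ`. -/
theorem inCone_sub_of_max (hT : T.IsSharpWithPurification) {ρ : 𝟙_ C ⟶ A} (hρ : T.InCone ρ)
    (hα : T.IsPureNormState α)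
    (hmax : ∀ ψ : 𝟙_ C ⟶ A, T.IsPureNormState ψ →
      T.pair (hT.dag ψ) ρ ≤ T.pair (hT.dag α) ρ) :
    T.InCone (ρ - T.pair (hT.dag α) ρ • α) := by
  rcases (hT.pair_dag_nonneg hα hρ).eq_or_lt with h0 | h0
  · rw [← h0]
    simpa using hρ
  have hs := h0.trans_le (hT.pair_dag_le hα hρ)
  set s := T.pair (hT.disc A) ρ with hsdef
  obtain ⟨B, Φ, hΦ, hΦρ⟩ := hT.exists_purification (hρ.smul (inv_nonneg.2 hs.le))
    (by rw [pair_smul_right, ← hsdef, inv_mul_cancel₀ hs.ne'])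
  obtain ⟨β, hβ, -, h1⟩ := hT.exists_partner_dag hΦ hα
    (p := s⁻¹ * T.pair (hT.dag α) ρ) (by positivity) (by rw [hΦρ, pair_smul_right])
    (fun ψ hψ => by
      rw [hΦρ, pair_smul_right]
      exact mul_le_mul_of_nonneg_left (hmax ψ hψ) (inv_nonneg.2 hs.le))
  have h2 := (hT.inCone_sub_rmap hΦ.inCone (hT.isPure_dag hβ).1).smul hs.le
  rw [h1, hΦρ, smul_sub, smul_smul, smul_smul, mul_inv_cancel_left₀ hs.ne',
    mul_inv_cancel₀ hs.ne', one_smul] at h2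
  exact h2

end dag

/-! ### Orthogonal pure states and frames -/

/-- The state left invariant by all reversible channels is maximally mixed. -/
theorem exists_flat (hT : T.IsSharpWithPurification) (A : C) :
    ∃ (χ : 𝟙_ C ⟶ A) (p : ℝ), T.InCone χ ∧ T.pair (hT.disc A) χ = 1 ∧ 0 < p ∧
      ∀ α : 𝟙_ C ⟶ A, T.IsPureNormState α → T.pair (hT.dag α) χ = p := by
  obtain ⟨χ, hχ, hχ1, hinv, r, hr, hχr⟩ := hT.exists_invariant_state_ge A
  obtain ⟨α, hα⟩ := hT.exists_pure A
  refine ⟨χ, T.pair (hT.dag α) χ, hχ, hχ1, ?_, fun ψ hψ => ?_⟩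
  · have := hT.pair_dag_nonneg hα (hχr α hα)
    rw [pair_sub_right, pair_smul_right, hT.pair_dag_self hα] at this
    linarith
  · obtain ⟨U, ⟨hU, V, hV, h1, h2⟩, rfl⟩ := hT.exists_reversible_pure hα hψ
    rw [hT.dag_comp hα hU hV h1 h2, pair_comp, hinv V ⟨hV, U, hU, h2, h1⟩]

/-- The maximally mixed state: a normalised state on which all effects `α†` are equally
probable. -/
noncomputable def flat (hT : T.IsSharpWithPurification) (A : C) : 𝟙_ C ⟶ A :=
  (hT.exists_flat A).choose

/-- The probability of the effects `α†` on the maximally mixed state. -/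
noncomputable def flatVal (hT : T.IsSharpWithPurification) (A : C) : ℝ :=
  (hT.exists_flat A).choose_spec.choose

section frames

variable {A B : C}

theorem inCone_flat (hT : T.IsSharpWithPurification) (A : C) : T.InCone (hT.flat A) :=
  (hT.exists_flat A).choose_spec.choose_spec.1

theorem pair_disc_flat (hT : T.IsSharpWithPurification) (A : C) :
    T.pair (hT.disc A) (hT.flat A) = 1 := (hT.exists_flat A).choose_spec.choose_spec.2.1

theorem flatVal_pos (hT : T.IsSharpWithPurification) (A : C) : 0 < hT.flatVal A :=
  (hT.exists_flat A).choose_spec.choose_spec.2.2.1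

theorem pair_dag_flat (hT : T.IsSharpWithPurification) {α : 𝟙_ C ⟶ A}
    (hα : T.IsPureNormState α) : T.pair (hT.dag α) (hT.flat A) = hT.flatVal A :=
  (hT.exists_flat A).choose_spec.choose_spec.2.2.2 α hα

/-- Every pure state is an eigenstate of the maximally mixed state, with eigenvalue `flatVal`. -/
theorem inCone_flat_sub (hT : T.IsSharpWithPurification) {α : 𝟙_ C ⟶ A}
    (hα : T.IsPureNormState α) : T.InCone (hT.flat A - hT.flatVal A • α) := by
  have := hT.inCone_sub_of_max (hT.inCone_flat A) hα
    (fun ψ hψ => by rw [hT.pair_dag_flat hψ, hT.pair_dag_flat hα])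
  rwa [hT.pair_dag_flat hα] at this

/-- Orthogonality of pure states is symmetric: if `α†` vanishes on `ψ`, then `α` remains an
eigenstate of the maximally mixed state after `ψ` has been subtracted. -/
theorem pair_dag_eq_zero_symm (hT : T.IsSharpWithPurification) {α ψ : 𝟙_ C ⟶ A}
    (hα : T.IsPureNormState α) (hψ : T.IsPureNormState ψ) (h : T.pair (hT.dag α) ψ = 0) :
    T.pair (hT.dag ψ) α = 0 := by
  have hp := hT.flatVal_pos A
  have h1 : T.pair (hT.dag α) (hT.flat A - hT.flatVal A • ψ) = hT.flatVal A := by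
    rw [pair_sub_right, pair_smul_right, h, hT.pair_dag_flat hα, mul_zero, sub_zero]
  have h2 := hT.inCone_sub_of_max (hT.inCone_flat_sub hψ) hα fun φ hφ => by
    rw [h1, pair_sub_right, pair_smul_right, hT.pair_dag_flat hφ]
    have := mul_nonneg hp.le (hT.pair_dag_nonneg hφ hψ.inCone)
    linarith
  have h3 := hT.pair_dag_nonneg hψ h2
  rw [h1, pair_sub_right, pair_sub_right, pair_smul_right, pair_smul_right, hT.pair_dag_self hψ,
    hT.pair_dag_flat hψ] at h3
  refine le_antisymm ?_ (hT.pair_dag_nonneg hψ hα.inCone)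
  by_contra hne
  have := mul_pos hp (not_le.1 hne)
  linarith

/-- A finite set of pairwise orthogonal normalised pure states. -/
def IsOrtho (hT : T.IsSharpWithPurification) (s : Finset (𝟙_ C ⟶ A)) : Prop :=
  (∀ α ∈ s, T.IsPureNormState α) ∧
    ∀ α ∈ s, ∀ ψ ∈ s, α ≠ ψ → T.pair (hT.dag α) ψ = 0

open Classical in
theorem isOrtho_insert (hT : T.IsSharpWithPurification) {s : Finset (𝟙_ C ⟶ A)}
    (hs : hT.IsOrtho s) {ψ : 𝟙_ C ⟶ A} (hψ : T.IsPureNormState ψ)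
    (h : ∀ α ∈ s, T.pair (hT.dag α) ψ = 0) : hT.IsOrtho (insert ψ s) := by
  refine ⟨fun α hα => ?_, fun α hα φ hφ hne => ?_⟩
  · rcases Finset.mem_insert.1 hα with rfl | hα
    exacts [hψ, hs.1 α hα]
  · rcases Finset.mem_insert.1 hα with rfl | hα'
    · rcases Finset.mem_insert.1 hφ with rfl | hφ'
      · exact absurd rfl hne
      · exact hT.pair_dag_eq_zero_symm (hs.1 φ hφ') hψ (h φ hφ')
    · rcases Finset.mem_insert.1 hφ with rfl | hφ'
      · exact h α hα'
      · exact hs.2 α hα' φ hφ' hne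

theorem isOrtho_subset (hT : T.IsSharpWithPurification) {s t : Finset (𝟙_ C ⟶ A)}
    (ht : hT.IsOrtho t) (hst : s ⊆ t) : hT.IsOrtho s :=
  ⟨fun α hα => ht.1 α (hst hα), fun α hα ψ hψ => ht.2 α (hst hα) ψ (hst hψ)⟩

theorem isOrtho_empty (hT : T.IsSharpWithPurification) :
    hT.IsOrtho (∅ : Finset (𝟙_ C ⟶ A)) := by simp [IsOrtho]

theorem pair_dag_sum (hT : T.IsSharpWithPurification) {s : Finset (𝟙_ C ⟶ A)}
    (hs : hT.IsOrtho s) {α : 𝟙_ C ⟶ A} (hα : α ∈ s) : T.pair (hT.dag α) (∑ ψ ∈ s, ψ) = 1 := by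
  rw [pair_sum_right, Finset.sum_eq_single α (fun ψ hψ hne => hs.2 α hα ψ hψ hne.symm)
    (fun h => absurd hα h), hT.pair_dag_self (hs.1 α hα)]

theorem pair_dag_sum_of_ortho (hT : T.IsSharpWithPurification) {s : Finset (𝟙_ C ⟶ A)}
    {α : 𝟙_ C ⟶ A} (h : ∀ ψ ∈ s, T.pair (hT.dag α) ψ = 0) :
    T.pair (hT.dag α) (∑ ψ ∈ s, ψ) = 0 := by
  rw [pair_sum_right]
  exact Finset.sum_eq_zero h

theorem pair_disc_sum (hT : T.IsSharpWithPurification) {s : Finset (𝟙_ C ⟶ A)}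
    (hs : hT.IsOrtho s) : T.pair (hT.disc A) (∑ ψ ∈ s, ψ) = s.card := by
  rw [pair_sum_right, Finset.sum_congr rfl fun ψ hψ => hT.pair_disc_pure (hs.1 ψ hψ)]
  simp

/-- Orthogonal eigenstates of a state for its largest eigenvalue can be subtracted together. -/
theorem inCone_sub_sum (hT : T.IsSharpWithPurification) {ρ : 𝟙_ C ⟶ A} (hρ : T.InCone ρ) {p : ℝ}
    (hp : 0 ≤ p) (hmax : ∀ ψ : 𝟙_ C ⟶ A, T.IsPureNormState ψ → T.pair (hT.dag ψ) ρ ≤ p)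
    {s : Finset (𝟙_ C ⟶ A)} (hs : hT.IsOrtho s) (h : ∀ α ∈ s, T.pair (hT.dag α) ρ = p) :
    T.InCone (ρ - p • ∑ α ∈ s, α) := by
  classical
  induction s using Finset.induction_on with
  | empty => simpa using hρ
  | insert α s hαs ih =>
    have hs' := hT.isOrtho_subset hs (Finset.subset_insert α s)
    have h1 := ih hs' fun ψ hψ => h ψ (Finset.mem_insert_of_mem hψ)
    have hα := hs.1 α (Finset.mem_insert_self α s)
    have h2 : T.pair (hT.dag α) (ρ - p • ∑ α ∈ s, α) = p := by
      rw [pair_sub_right, pair_smul_right, h α (Finset.mem_insert_self α s),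
        hT.pair_dag_sum_of_ortho fun ψ hψ => hs.2 α (Finset.mem_insert_self α s) ψ
          (Finset.mem_insert_of_mem hψ) (fun h => hαs (h ▸ hψ)), mul_zero, sub_zero]
    have h3 := hT.inCone_sub_of_max h1 hα fun ψ hψ => by
      rw [h2, pair_sub_right, pair_smul_right]
      have h4 := hT.pair_dag_nonneg hψ
        (hT.inCone_sum s fun i hi => (hs'.1 i hi).inCone (α := i))
      have h5 := mul_nonneg hp h4
      linarith [hmax ψ hψ]
    rw [h2] at h3
    rw [Finset.sum_insert hαs]
    convert h3 using 1
    module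

theorem inCone_flat_sub_sum (hT : T.IsSharpWithPurification) {s : Finset (𝟙_ C ⟶ A)}
    (hs : hT.IsOrtho s) : T.InCone (hT.flat A - hT.flatVal A • ∑ α ∈ s, α) :=
  hT.inCone_sub_sum (hT.inCone_flat A) (hT.flatVal_pos A).le
    (fun _ hψ => (hT.pair_dag_flat hψ).le) hs fun α hα => hT.pair_dag_flat (hs.1 α hα)

/-- Every orthogonal set extends to a frame, that is, an orthogonal set whose sum is a multiple of
the maximally mixed state: a pure state in the decomposition of what is left of the maximally mixed
state is orthogonal to all states of the set. -/
theorem exists_frame (hT : T.IsSharpWithPurification) {s : Finset (𝟙_ C ⟶ A)}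
    (hs : hT.IsOrtho s) : ∃ t : Finset (𝟙_ C ⟶ A), s ⊆ t ∧ hT.IsOrtho t ∧
      hT.flat A = hT.flatVal A • ∑ α ∈ t, α := by
  classical
  have hp := hT.flatVal_pos A
  obtain ⟨N, hN⟩ := exists_nat_gt (1 / hT.flatVal A)
  suffices h : ∀ (n : ℕ) (s : Finset (𝟙_ C ⟶ A)), hT.IsOrtho s → N ≤ s.card + n →
      ∃ t : Finset (𝟙_ C ⟶ A), s ⊆ t ∧ hT.IsOrtho t ∧
        hT.flat A = hT.flatVal A • ∑ α ∈ t, α from h N s hs (by omega)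
  intro n
  induction n with
  | zero =>
    intro s hs hcard
    exfalso
    have h1 := hT.inCone_disc_nonneg (hT.inCone_flat_sub_sum hs)
    rw [pair_sub_right, pair_smul_right, hT.pair_disc_flat, hT.pair_disc_sum hs] at h1
    have h2 : (N : ℝ) ≤ s.card := by exact_mod_cast hcard
    rw [div_lt_iff₀ hp] at hN
    nlinarith
  | succ n ih =>
    intro s hs hcard
    by_cases h0 : hT.flat A - hT.flatVal A • ∑ α ∈ s, α = 0
    · exact ⟨s, subset_rfl, hs, sub_eq_zero.1 h0⟩
    obtain ⟨ψ, hψ, r, hr, h⟩ := hT.exists_pure_le (hT.inCone_flat_sub_sum hs) h0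
    have horth : ∀ α ∈ s, T.pair (hT.dag α) ψ = 0 := by
      intro α hα
      have h1 := hT.pair_dag_nonneg (hs.1 α hα) h
      rw [pair_sub_right, pair_sub_right, pair_smul_right, pair_smul_right,
        hT.pair_dag_flat (hs.1 α hα), hT.pair_dag_sum hs hα] at h1
      refine le_antisymm ?_ (hT.pair_dag_nonneg (hs.1 α hα) hψ.inCone)
      by_contra hne
      have := mul_pos hr (not_le.1 hne)
      linarith
    have hψs : ψ ∉ s := fun hmem => by
      have := horth ψ hmem
      rw [hT.pair_dag_self hψ] at this
      exact one_ne_zero this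
    obtain ⟨t, hst, ht⟩ := ih (insert ψ s) (hT.isOrtho_insert hs hψ horth)
      (by rw [Finset.card_insert_of_notMem hψs]; omega)
    exact ⟨t, (Finset.subset_insert ψ s).trans hst, ht⟩

/-- All frames have the same number of elements. -/
theorem flatVal_mul_card (hT : T.IsSharpWithPurification) {t : Finset (𝟙_ C ⟶ A)}
    (ht : hT.IsOrtho t) (hsum : hT.flat A = hT.flatVal A • ∑ α ∈ t, α) :
    hT.flatVal A * t.card = 1 := by
  rw [← hT.pair_disc_sum ht, ← pair_smul_right, ← hsum, hT.pair_disc_flat]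

/-- An upper bound on the eigenvalues of one marginal of a pure state bounds those of the other. -/
theorem pair_dag_marginal_le (hT : T.IsSharpWithPurification) {Φ : 𝟙_ C ⟶ A ⊗ B}
    (hΦ : T.IsPureNormState Φ) {p : ℝ} (hp : 0 ≤ p)
    (hmax : ∀ ψ : 𝟙_ C ⟶ A, T.IsPureNormState ψ →
      T.pair (hT.dag ψ) (rmap Φ (hT.disc B)) ≤ p) {β : 𝟙_ C ⟶ B} (hβ : T.IsPureNormState β) :
    T.pair (hT.dag β) (lmap Φ (hT.disc A)) ≤ p := by
  rw [pair_lmap]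
  have hK := hT.inCone_rmap hΦ.inCone (hT.isPure_dag hβ).1
  rcases (hT.inCone_disc_nonneg hK).eq_or_lt with h0 | h0
  · rw [← h0]
    exact hp
  obtain ⟨α, hα, hαe⟩ := hT.exists_pure_smul (hT.isPure_rmap hΦ.1 (hT.isPure_dag hβ)) h0
  have h1 := hT.pair_dag_nonneg hα (hT.inCone_sub_rmap hΦ.inCone (hT.isPure_dag hβ).1)
  rw [hαe, pair_sub_right, pair_smul_right, hT.pair_dag_self hα, mul_one] at h1
  linarith [hmax α hα]

/-- A purification of the maximally mixed state of `A` sends each frame of `A` to an orthogonal set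
of the purifying system that diagonalises the other marginal. -/
theorem exists_partner_frame (hT : T.IsSharpWithPurification) {Φ : 𝟙_ C ⟶ A ⊗ B}
    (hΦ : T.IsPureNormState Φ) (hflat : rmap Φ (hT.disc B) = hT.flat A)
    {t : Finset (𝟙_ C ⟶ A)} (ht : hT.IsOrtho t)
    (hsum : hT.flat A = hT.flatVal A • ∑ α ∈ t, α) :
    ∃ s : Finset (𝟙_ C ⟶ B), hT.IsOrtho s ∧
      lmap Φ (hT.disc A) = hT.flatVal A • ∑ β ∈ s, β ∧
      lmap Φ (∑ α ∈ t, hT.dag α) = hT.flatVal A • ∑ β ∈ s, β := by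
  classical
  have hp := hT.flatVal_pos A
  have hex : ∀ α : 𝟙_ C ⟶ A, α ∈ t → ∃ β : 𝟙_ C ⟶ B, T.IsPureNormState β ∧
      lmap Φ (hT.dag α) = hT.flatVal A • β ∧ rmap Φ (hT.dag β) = hT.flatVal A • α :=
    fun α hα => hT.exists_partner_dag hΦ (ht.1 α hα) hp
      (by rw [hflat, hT.pair_dag_flat (ht.1 α hα)])
      (fun ψ hψ => by rw [hflat, hT.pair_dag_flat hψ])
  choose! β hβ h1 h2 using hex
  have horth : ∀ α ∈ t, ∀ ψ ∈ t, α ≠ ψ → T.pair (hT.dag (β α)) (β ψ) = 0 := by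
    intro α hα ψ hψ hne
    have h3 : T.pair (hT.dag (β α)) (lmap Φ (hT.dag ψ)) = 0 := by
      rw [pair_lmap, h2 α hα, pair_smul_right, ht.2 ψ hψ α hα hne.symm, mul_zero]
    rw [h1 ψ hψ, pair_smul_right] at h3
    exact (mul_eq_zero.1 h3).resolve_left hp.ne'
  have hinj : Set.InjOn β (t : Set (𝟙_ C ⟶ A)) := by
    intro α hα ψ hψ he
    by_contra hne
    have := horth α hα ψ hψ hne
    rw [he, hT.pair_dag_self (hβ ψ hψ)] at this
    exact one_ne_zero this
  have hs : hT.IsOrtho (t.image β) := by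
    refine ⟨fun b hb => ?_, fun b hb b' hb' hne => ?_⟩
    · obtain ⟨α, hα, rfl⟩ := Finset.mem_image.1 hb
      exact hβ α hα
    · obtain ⟨α, hα, rfl⟩ := Finset.mem_image.1 hb
      obtain ⟨ψ, hψ, rfl⟩ := Finset.mem_image.1 hb'
      exact horth α hα ψ hψ fun h => hne (by rw [h])
  refine ⟨t.image β, hs, ?_, ?_⟩
  · rw [← sub_eq_zero]
    refine hT.inCone_eq_zero (hT.inCone_sub_sum (hT.inCone_lmap hΦ.inCone (hT.isEffect_disc A))
      hp.le (fun ψ hψ => hT.pair_dag_marginal_le hΦ hp.le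
        (fun φ hφ => by rw [hflat, hT.pair_dag_flat hφ]) hψ) hs ?_) ?_
    · intro b hb
      obtain ⟨α, hα, rfl⟩ := Finset.mem_image.1 hb
      rw [pair_lmap, h2 α hα, pair_smul_right, hT.pair_disc_pure (ht.1 α hα), mul_one]
    · rw [pair_sub_right, pair_smul_right, hT.pair_disc_sum hs, hT.pair_disc_lmap,
        hT.pair_disc_pure hΦ, Finset.card_image_of_injOn hinj, hT.flatVal_mul_card ht hsum,
        sub_self]
  · rw [Finset.sum_image hinj, Finset.smul_sum]
    have h3 : ∀ s : Finset (𝟙_ C ⟶ A), s ⊆ t →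
        lmap Φ (∑ α ∈ s, hT.dag α) = ∑ α ∈ s, hT.flatVal A • β α := by
      intro s
      induction s using Finset.induction_on with
      | empty => intro _; simp [lmap]
      | insert α s hα ih =>
        intro hst
        rw [Finset.sum_insert hα, Finset.sum_insert hα, lmap_add,
          ih ((Finset.subset_insert α s).trans hst), h1 α (hst (Finset.mem_insert_self α s))]
    exact h3 t subset_rfl

theorem lmap_injective_flat (hT : T.IsSharpWithPurification) {Φ : 𝟙_ C ⟶ A ⊗ B}
    (hΦ : T.IsPureNormState Φ) (hflat : rmap Φ (hT.disc B) = hT.flat A) {e e' : A ⟶ 𝟙_ C}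
    (h : lmap Φ e = lmap Φ e') : e = e' :=
  hT.lmap_injective hΦ (hT.flatVal_pos A)
    (fun α hα => by rw [hflat]; exact hT.inCone_flat_sub hα) h

/-- The effects of a frame add up to the deterministic effect. -/
theorem sum_dag_frame (hT : T.IsSharpWithPurification) {t : Finset (𝟙_ C ⟶ A)}
    (ht : hT.IsOrtho t) (hsum : hT.flat A = hT.flatVal A • ∑ α ∈ t, α) :
    ∑ α ∈ t, hT.dag α = hT.disc A := by
  obtain ⟨B, Φ, hΦ, hflat⟩ := hT.exists_purification (hT.inCone_flat A) (hT.pair_disc_flat A)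
  obtain ⟨s, -, h1, h2⟩ := hT.exists_partner_frame hΦ hflat ht hsum
  exact hT.lmap_injective_flat hΦ hflat (h2.trans h1.symm)

/-- Every non-zero pure effect is proportional to some `ψ†`. -/
theorem exists_dag_smul (hT : T.IsSharpWithPurification) {e : A ⟶ 𝟙_ C} (he : T.IsPure e)
    {α : 𝟙_ C ⟶ A} (hα : T.IsPureNormState α) (hpos : 0 < T.pair e α) :
    ∃ (ψ : 𝟙_ C ⟶ A) (w : ℝ), T.IsPureNormState ψ ∧ 0 < w ∧ w ≤ 1 ∧ e = w • hT.dag ψ := by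
  classical
  have hp := hT.flatVal_pos A
  obtain ⟨B, Φ, hΦ, hflat⟩ := hT.exists_purification (hT.inCone_flat A) (hT.pair_disc_flat A)
  have hq : 0 < T.pair (hT.disc B) (lmap Φ e) := by
    rw [pair_lmap, hflat]
    have := hT.inCone_pair_nonneg (hT.inCone_flat_sub hα) he.1
    rw [pair_sub_right, pair_smul_right] at this
    have := mul_pos hp hpos
    linarith
  obtain ⟨β, hβ, hβe⟩ := hT.exists_pure_smul (hT.isPure_lmap hΦ.1 he) hq
  set q := T.pair (hT.disc B) (lmap Φ e) with hqdef
  -- `β†` has the largest possible probability on the marginal: the marginal is flat on the span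
  -- of a frame, and `β` is orthogonal to the states that complete this to a frame of `B`.
  obtain ⟨t, -, ht, hsum⟩ := hT.exists_frame (A := A) hT.isOrtho_empty
  obtain ⟨s, hs, hmarg, -⟩ := hT.exists_partner_frame hΦ hflat ht hsum
  obtain ⟨s', hss', hs', hsum'⟩ := hT.exists_frame hs
  have h1 : T.pair (hT.dag β) (∑ b ∈ s', b) = 1 := by
    have h2 := hT.pair_dag_flat hβ
    rw [hsum', pair_smul_right] at h2
    have : hT.flatVal B * (T.pair (hT.dag β) (∑ b ∈ s', b) - 1) = 0 := by linarith
    linarith [(mul_eq_zero.1 this).resolve_left (hT.flatVal_pos B).ne']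
  have h3 : ∀ b ∈ s' \ s, T.pair (hT.dag β) b = 0 := by
    intro b hb
    obtain ⟨hbs', hbs⟩ := Finset.mem_sdiff.1 hb
    have hbp := hs'.1 b hbs'
    refine hT.pair_dag_eq_zero_symm hbp hβ (le_antisymm ?_ (hT.pair_dag_nonneg hbp hβ.inCone))
    have h4 := hT.pair_dag_nonneg hbp (hT.inCone_sub_lmap hΦ.inCone he.1)
    rw [hβe, hmarg, pair_sub_right, pair_smul_right, pair_smul_right,
      hT.pair_dag_sum_of_ortho fun ψ hψ => hs'.2 b hbs' ψ (hss' hψ) fun h => hbs (h ▸ hψ)] at h4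
    by_contra hne
    have := mul_pos hq (not_le.1 hne)
    linarith
  have h5 : T.pair (hT.dag β) (∑ b ∈ s, b) = 1 := by
    rw [← h1, ← Finset.sum_sdiff hss', pair_add_right, hT.pair_dag_sum_of_ortho h3, zero_add]
  have hΦ' := hT.pure_comp_reversible hΦ (hT.isOPT.reversible_braiding A B)
  obtain ⟨ψ, hψ, -, h6⟩ := hT.exists_partner_dag hΦ' hβ hp
    (by rw [rmap_braiding, hmarg, pair_smul_right, h5, mul_one])
    (fun φ hφ => by
      rw [rmap_braiding]
      exact hT.pair_dag_marginal_le hΦ hp.le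
        (fun φ hφ => by rw [hflat, hT.pair_dag_flat hφ]) hφ)
  rw [rmap_braiding] at h6
  have h7 : e = (q / hT.flatVal A) • hT.dag ψ := by
    refine hT.lmap_injective_flat hΦ hflat ?_
    rw [hβe, lmap_smul, h6, smul_smul, div_mul_cancel₀ _ hp.ne']
  refine ⟨ψ, _, hψ, by positivity, ?_, h7⟩
  have h8 := hT.pair_le_one he.1 hψ.1.1
  rwa [h7, pair_smul_left, hT.pair_dag_self hψ, mul_one] at h8

end frames

/-! ### Two-dimensional faces -/

variable {A B : C} {α α' ψ : 𝟙_ C ⟶ A}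

theorem isOrtho_pair (hT : T.IsSharpWithPurification) (hα : T.IsPureNormState α)
    (hψ : T.IsPureNormState ψ) (h : T.pair (hT.dag α) ψ = 0) :
    ∃ s : Finset (𝟙_ C ⟶ A), hT.IsOrtho s ∧ α ∈ s ∧ ψ ∈ s ∧
      ∀ f : (𝟙_ C ⟶ A) → ℝ, ∑ φ ∈ s, f φ = f α + f ψ := by
  classical
  have hne : ψ ∉ ({α} : Finset (𝟙_ C ⟶ A)) := by
    rw [Finset.mem_singleton]
    rintro rfl
    rw [hT.pair_dag_self hα] at h
    exact one_ne_zero h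
  refine ⟨insert ψ {α}, hT.isOrtho_insert ⟨?_, ?_⟩ hψ ?_, by simp, by simp, fun f => ?_⟩
  · simpa using hα
  · simp
  · simpa using h
  · rw [Finset.sum_insert hne, Finset.sum_singleton, add_comm]

/-- No `φ†` has a probability above `1 / 2` on the even mixture of two orthogonal pure states. -/
theorem pair_dag_add_le (hT : T.IsSharpWithPurification) (hα : T.IsPureNormState α)
    (hψ : T.IsPureNormState ψ) (h : T.pair (hT.dag α) ψ = 0) {φ : 𝟙_ C ⟶ A}
    (hφ : T.IsPureNormState φ) : T.pair (hT.dag φ) α + T.pair (hT.dag φ) ψ ≤ 1 := by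
  obtain ⟨s, hs, -, -, hsum⟩ := hT.isOrtho_pair hα hψ h
  have h1 := hT.pair_dag_nonneg hφ (hT.inCone_flat_sub_sum hs)
  rw [pair_sub_right, pair_smul_right, hT.pair_dag_flat hφ, pair_sum_right, hsum] at h1
  have := hT.flatVal_pos A
  by_contra hlt
  nlinarith

theorem sum_pair_dag_frame (hT : T.IsSharpWithPurification) {t : Finset (𝟙_ C ⟶ A)}
    (ht : hT.IsOrtho t) (hsum : hT.flat A = hT.flatVal A • ∑ α ∈ t, α)
    (hα : T.IsPureNormState α) : ∑ φ ∈ t, T.pair (hT.dag φ) α = 1 := by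
  rw [← pair_sum_left, hT.sum_dag_frame ht hsum, hT.pair_disc_pure hα]

/-- Unless there is only one pure state, something is left of the maximally mixed state when `α` is
subtracted from it, and this is orthogonal to `α`. -/
theorem exists_ortho (hT : T.IsSharpWithPurification) (hα : T.IsPureNormState α)
    (hα' : T.IsPureNormState α') (h : α ≠ α') :
    ∃ γ : 𝟙_ C ⟶ A, T.IsPureNormState γ ∧ T.pair (hT.dag α) γ = 0 := by
  have hK := hT.inCone_flat_sub hα
  by_cases h0 : hT.flat A - hT.flatVal A • α = 0
  · exfalso
    have h1 : hT.flatVal A = 1 := by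
      have := congrArg (T.pair (hT.disc A)) h0
      rw [pair_sub_right, pair_smul_right, hT.pair_disc_flat, hT.pair_disc_pure hα,
        pair_zero_right] at this
      linarith
    have h2 := hT.inCone_eq_zero (hT.inCone_flat_sub hα') (by
      rw [pair_sub_right, pair_smul_right, hT.pair_disc_flat, hT.pair_disc_pure hα', h1]
      norm_num)
    rw [h1, one_smul, sub_eq_zero] at h0 h2
    exact h (h0.symm.trans h2)
  · obtain ⟨γ, hγ, r, hr, hle⟩ := hT.exists_pure_le hK h0
    refine ⟨γ, hγ, le_antisymm ?_ (hT.pair_dag_nonneg hα hγ.inCone)⟩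
    have h1 := hT.pair_dag_nonneg hα hle
    rw [pair_sub_right, pair_sub_right, pair_smul_right, pair_smul_right, hT.pair_dag_flat hα,
      hT.pair_dag_self hα] at h1
    by_contra hne
    have := mul_pos hr (not_le.1 hne)
    linarith

/-- A pure filter that on `α` and `α'` occurs with the probability of the complement of `α†`. It is
obtained by steering: in a purification of the mixture of `α` and `α'`, the outcomes of the test
`{α†, u - α†}` are recorded in orthogonal pure states of an ancilla, on which a pure effect then
selects the second outcome. -/
theorem exists_filter (hT : T.IsSharpWithPurification) (hα : T.IsPureNormState α)
    (hα' : T.IsPureNormState α') (h : α ≠ α') :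
    ∃ (X : C) (F : A ⟶ X), T.IsPure F ∧ T.pair (F ≫ hT.disc X) α = 0 ∧
      T.pair (F ≫ hT.disc X) α' = 1 - T.pair (hT.dag α) α' := by
  obtain ⟨γ, hγ, hαγ⟩ := hT.exists_ortho hα hα' h
  have hγα := hT.pair_dag_eq_zero_symm hα hγ hαγ
  have hα2 := hα.inCone.smul (by norm_num : (0 : ℝ) ≤ 1 / 2)
  have hα2' := hα'.inCone.smul (by norm_num : (0 : ℝ) ≤ 1 / 2)
  obtain ⟨Z, Ψ, hΨ, hΨρ⟩ := hT.exists_purification (hT.inCone_add hα2 hα2') (by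
    rw [pair_add_right, pair_smul_right, pair_smul_right, hT.pair_disc_pure hα,
      hT.pair_disc_pure hα']
    norm_num)
  have hΨs := hT.pure_comp_reversible hΨ (hT.isOPT.reversible_braiding A Z)
  have ha := (hT.isPure_dag hα).1
  obtain ⟨E, Ω, ψ, g, -, hψ, hg, -, hΩ, hΩS⟩ := hT.exists_extension hΨs
    (S := lmap Ψ (hT.dag α) ≫ insR α Z + lmap Ψ (hT.disc A - hT.dag α) ≫ insR γ Z)
    (hT.inCone_add (hT.inCone_tens (hT.inCone_lmap hΨ.inCone ha) hα.1.1)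
      (hT.inCone_tens (hT.inCone_lmap hΨ.inCone (hT.isEffect_compl ha)) hγ.1.1))
    (by
      rw [rmap_braiding, rmap_add_state, hT.isOPT.rmap_insR, hT.isOPT.rmap_insR,
        hT.pair_disc_pure hα, hT.pair_disc_pure hγ, one_smul, one_smul, ← lmap_add,
        add_sub_cancel])
  let k : A ⊗ E ⟶ E := hT.dag γ ▷ E ≫ (λ_ E).hom
  have hk : T.IsPure k := hT.isOPT.isPure_comp_reversible (hT.isPure_whiskerRight
    (hT.isPure_dag hγ) E) (hT.isOPT.reversible_leftUnitor E)
  have hins : insL ψ (A ⊗ E) ≫ A ◁ k = k ≫ insL ψ E := by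
    simp only [insL, Category.assoc]
    rw [← whisker_exchange, leftUnitor_inv_naturality_assoc]
  have hF : lmap Ψ ((g ≫ A ◁ k) ≫ hT.disc (A ⊗ E)) = lmap Ψ (hT.disc A - hT.dag α) := by
    rw [← sub_eq_zero]
    refine hT.state_ext fun z _ => ?_
    have h1 : lmap Ψ ((g ≫ A ◁ k) ≫ hT.disc (A ⊗ E)) = rmap Ω (k ≫ hT.disc E) := by
      rw [← rmap_braiding, Category.assoc, ← rmap_whiskerLeft, hΩ, rmap_whiskerLeft,
        reassoc_of% hins, hT.comp_disc (hT.isChannel_insL hψ E)]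
    have h2 : lmap Ω z ≫ k = lmap (lmap Ω z) (hT.dag γ) := rfl
    rw [pair_sub_right, h1, ← pair_lmap, pair_comp, h2, pair_lmap, hΩS, lmap_add_state,
      hT.isOPT.lmap_insR, hT.isOPT.lmap_insR, pair_add_right, pair_smul_right, pair_smul_right,
      hγα, hT.pair_dag_self hγ]
    ring
  have h0 : lmap Ψ ((g ≫ A ◁ k) ≫ hT.disc (A ⊗ E) - (hT.disc A - hT.dag α)) = 0 := by
    rw [lmap_sub, hF, sub_self]
  have h1 := hT.pair_eq_zero_of_lmap hΨ h0 hα2 (by rwa [hΨρ, add_sub_cancel_left])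
  have h2 := hT.pair_eq_zero_of_lmap hΨ h0 hα2' (by rwa [hΨρ, add_sub_cancel_right])
  rw [pair_smul_right, pair_sub_left, pair_sub_left, hT.pair_disc_pure hα,
    hT.pair_dag_self hα] at h1
  rw [pair_smul_right, pair_sub_left, pair_sub_left, hT.pair_disc_pure hα'] at h2
  exact ⟨A ⊗ E, g ≫ A ◁ k, hT.isPure_comp hg (hT.isPure_whiskerLeft hk A), by linarith,
    by linarith⟩

/-- Two pure states `α`, `α'` determine a pure state orthogonal to `α` whose effect is
complementary to `α†` on `α'`. -/
theorem exists_complement (hT : T.IsSharpWithPurification) (hα : T.IsPureNormState α)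
    (hα' : T.IsPureNormState α') (h : α ≠ α') :
    ∃ ψ : 𝟙_ C ⟶ A, T.IsPureNormState ψ ∧ T.pair (hT.dag α) ψ = 0 ∧
      T.pair (hT.dag α) α' + T.pair (hT.dag ψ) α' = 1 := by
  obtain ⟨X, F, hF, hFα, hFα'⟩ := hT.exists_filter hα hα' h
  have hlt : T.pair (hT.dag α) α' < 1 := (hT.pair_dag_le_one hα hα').lt_of_ne
    fun h1 => h (hT.eq_of_pair_dag hα hα' h1).symm
  rw [pair_comp] at hFα hFα'
  obtain ⟨ω, hω, hωe⟩ := hT.exists_pure_smul (hT.isPure_comp hα'.1 hF)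
    (by rw [hFα']; linarith)
  have h1 : T.pair (F ≫ hT.dag ω) α' = 1 - T.pair (hT.dag α) α' := by
    rw [pair_comp, hωe, hFα', pair_smul_right, hT.pair_dag_self hω, mul_one]
  have h2 : T.pair (F ≫ hT.dag ω) α = 0 := by
    have hK := hT.inCone_comp hα.inCone hF.1
    rw [pair_comp]
    exact le_antisymm (hFα ▸ hT.pair_dag_le hω hK) (hT.pair_dag_nonneg hω hK)
  obtain ⟨ψ, w, hψ, hw0, hw1, hψe⟩ := hT.exists_dag_smul
    (hT.isPure_comp hF (hT.isPure_dag hω)) hα' (by rw [h1]; linarith)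
  rw [hψe, pair_smul_left] at h1 h2
  have h3 := hT.pair_dag_eq_zero_symm hψ hα ((mul_eq_zero.1 h2).resolve_left hw0.ne')
  refine ⟨ψ, hψ, h3, le_antisymm ?_ ?_⟩
  · obtain ⟨s, hs, -, -, hsum⟩ := hT.isOrtho_pair hα hψ h3
    obtain ⟨t, hst, ht, htsum⟩ := hT.exists_frame hs
    rw [← hsum fun φ => T.pair (hT.dag φ) α', ← hT.sum_pair_dag_frame ht htsum hα']
    exact Finset.sum_le_sum_of_subset_of_nonneg hst
      fun φ hφ _ => hT.pair_dag_nonneg (ht.1 φ hφ) hα'.inCone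
  · have := mul_le_mul_of_nonneg_right hw1 (hT.pair_dag_nonneg hψ hα'.inCone)
    linarith

/-- Two pure states lie in a common face, on which the maximally mixed state is the mixture of each
of them with an orthogonal pure state. -/
theorem exists_common_sum (hT : T.IsSharpWithPurification) (hα : T.IsPureNormState α)
    (hα' : T.IsPureNormState α') (h : α ≠ α') :
    ∃ ψ κ : 𝟙_ C ⟶ A, T.IsPureNormState ψ ∧ T.IsPureNormState κ ∧
      T.pair (hT.dag α) ψ = 0 ∧ T.pair (hT.dag α') κ = 0 ∧ α + ψ = α' + κ := by
  classical
  obtain ⟨ψ, hψ, hαψ, h1⟩ := hT.exists_complement hα hα' h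
  obtain ⟨s, hs, hαs, hψs, hsum⟩ := hT.isOrtho_pair hα hψ hαψ
  have hs2 : s.card = 2 := by
    have := hsum fun _ => 1
    simp only [Finset.sum_const, nsmul_eq_mul, mul_one] at this
    have h2 : (s.card : ℝ) = (2 : ℕ) := by push_cast; linarith
    exact_mod_cast h2
  have hne : α ≠ ψ := by
    rintro rfl
    rw [hT.pair_dag_self hα] at hαψ
    exact one_ne_zero hαψ
  have hse : s = {α, ψ} := by
    refine (Finset.eq_of_subset_of_card_le ?_ ?_).symm
    · rw [Finset.insert_subset_iff, Finset.singleton_subset_iff]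
      exact ⟨hαs, hψs⟩
    · rw [hs2, Finset.card_pair hne]
  obtain ⟨t, hst, ht, htsum⟩ := hT.exists_frame hs
  have hzero : ∀ φ ∈ t \ s, T.pair (hT.dag φ) α' = 0 := by
    have h2 := hT.sum_pair_dag_frame ht htsum hα'
    rw [← Finset.sum_sdiff hst, hsum fun φ => T.pair (hT.dag φ) α', h1] at h2
    exact (Finset.sum_eq_zero_iff_of_nonneg fun φ hφ =>
      hT.pair_dag_nonneg (ht.1 φ (Finset.mem_sdiff.1 hφ).1) hα'.inCone).1 (by linarith)
  have hα't : α' ∉ t \ s := fun hmem => by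
    have := hzero α' hmem
    rw [hT.pair_dag_self hα'] at this
    exact one_ne_zero this
  obtain ⟨t', hst', ht', htsum'⟩ := hT.exists_frame
    (hT.isOrtho_insert (hT.isOrtho_subset ht Finset.sdiff_subset) hα' hzero)
  have hp := hT.flatVal_pos A
  -- All frames have the same number of elements, so that a single state `κ` completes `α'` and the
  -- part of the frame outside the face to a frame.
  have hcard : t'.card = t.card := by
    have h2 := hT.flatVal_mul_card ht htsum
    rw [← hT.flatVal_mul_card ht' htsum'] at h2
    exact_mod_cast (mul_left_cancel₀ hp.ne' h2).symm
  have hcard1 : (t' \ insert α' (t \ s)).card = 1 := by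
    have h2 := Finset.card_le_card hst
    rw [Finset.card_sdiff_of_subset hst', Finset.card_insert_of_notMem hα't,
      Finset.card_sdiff_of_subset hst]
    omega
  obtain ⟨κ, hκ⟩ := Finset.card_eq_one.1 hcard1
  have hκmem : κ ∈ t' \ insert α' (t \ s) := hκ ▸ Finset.mem_singleton_self κ
  obtain ⟨hκt, hκn⟩ := Finset.mem_sdiff.1 hκmem
  refine ⟨ψ, κ, hψ, ht'.1 κ hκt, hαψ, ht'.2 α' (hst' (Finset.mem_insert_self _ _)) κ hκt
    fun he => hκn (he ▸ Finset.mem_insert_self _ _), ?_⟩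
  have h3 : ∑ φ ∈ t, φ = ∑ φ ∈ t', φ :=
    smul_right_injective _ hp.ne' (htsum.symm.trans htsum')
  rw [← Finset.sum_sdiff hst, ← Finset.sum_sdiff hst', hκ, Finset.sum_insert hα't, hse,
    Finset.sum_pair hne, Finset.sum_singleton, ← hse] at h3
  have h4 : (∑ φ ∈ t \ s, φ) + (α + ψ) = (∑ φ ∈ t \ s, φ) + (α' + κ) := by
    rw [h3]
    abel
  exact add_left_cancel h4

/-- On the face of two orthogonal pure states `α` and `ψ`, a functional with maximum at `α` is a
combination of `α†` and `ψ†`. -/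
theorem pair_eq_of_max (hT : T.IsSharpWithPurification) (hα : T.IsPureNormState α)
    (hψ : T.IsPureNormState ψ) (h : T.pair (hT.dag α) ψ = 0) {Φ : 𝟙_ C ⟶ A ⊗ B}
    (hΦ : T.IsPureNormState Φ) (hΦc : rmap Φ (hT.disc B) = (1 / 2 : ℝ) • (α + ψ))
    {f : A ⟶ 𝟙_ C} (hf : T.InCone (lmap Φ f))
    (hmax : ∀ φ : 𝟙_ C ⟶ A, T.IsPureNormState φ → T.pair f φ ≤ T.pair f α) {σ : 𝟙_ C ⟶ A}
    (hσ : T.InCone σ) (hσc : T.InCone ((1 / 2 : ℝ) • (α + ψ) - σ)) :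
    T.pair f σ = T.pair f α * T.pair (hT.dag α) σ + T.pair f ψ * T.pair (hT.dag ψ) σ := by
  have h' := hT.pair_dag_eq_zero_symm hα hψ h
  have hle : ∀ φ : 𝟙_ C ⟶ A, T.IsPureNormState φ →
      T.pair (hT.dag φ) (rmap Φ (hT.disc B)) ≤ 1 / 2 := fun φ hφ => by
    rw [hΦc, pair_smul_right, pair_add_right]
    linarith [hT.pair_dag_add_le hα hψ h hφ]
  obtain ⟨ζ, hζ, hζ1, hζ2⟩ := hT.exists_partner_dag hΦ hα (p := 1 / 2) (by norm_num)
    (by rw [hΦc, pair_smul_right, pair_add_right, h, hT.pair_dag_self hα]; norm_num) hle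
  obtain ⟨ζ', hζ', hζ1', hζ2'⟩ := hT.exists_partner_dag hΦ hψ (p := 1 / 2) (by norm_num)
    (by rw [hΦc, pair_smul_right, pair_add_right, h', hT.pair_dag_self hψ]; norm_num) hle
  have hζf : T.pair (hT.dag ζ) (lmap Φ f) = 1 / 2 * T.pair f α := by
    rw [pair_lmap, hζ2, pair_smul_right]
  have hf0 : 0 ≤ T.pair f α := by
    have := hT.pair_dag_nonneg hζ hf
    linarith
  have hK : T.InCone (lmap Φ f - T.pair (hT.dag ζ) (lmap Φ f) • ζ) := by
    refine hT.inCone_sub_of_max hf hζ fun z hz => ?_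
    have hz2 := hT.pair_dag_marginal_le hΦ (by norm_num) hle hz
    rw [pair_lmap] at hz2
    rw [hζf, pair_lmap]
    have hzK := hT.inCone_rmap hΦ.inCone (hT.isPure_dag hz).1
    rcases (hT.inCone_disc_nonneg hzK).eq_or_lt with h0 | h0
    · rw [hT.inCone_eq_zero hzK h0.symm, pair_zero_right]
      positivity
    · obtain ⟨φ, hφ, hφe⟩ := hT.exists_pure_smul (hT.isPure_rmap hΦ.1 (hT.isPure_dag hz)) h0
      rw [hφe, pair_smul_right]
      exact (mul_le_mul_of_nonneg_left (hmax φ hφ) h0.le).trans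
        (mul_le_mul_of_nonneg_right hz2 hf0)
  -- What remains after subtracting the `ζ` component is supported on `ζ'`, since `ζ†` and `ζ'†`
  -- add up to the deterministic effect on the vectors `lmap Φ e`.
  have hu : ∀ e : A ⟶ 𝟙_ C, T.pair (hT.disc B) (lmap Φ e) =
      T.pair (hT.dag ζ) (lmap Φ e) + T.pair (hT.dag ζ') (lmap Φ e) := fun e => by
    rw [pair_lmap, pair_lmap, pair_lmap, hΦc, hζ2, hζ2', smul_add, pair_add_right]
  have hη : lmap Φ (f - T.pair f α • hT.dag α) =
      lmap Φ f - T.pair (hT.dag ζ) (lmap Φ f) • ζ := by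
    rw [lmap_sub, lmap_smul, hζ1, hζf, smul_smul, mul_comm]
  have hη1 : T.pair (hT.dag ζ) (lmap Φ (f - T.pair f α • hT.dag α)) = 0 := by
    rw [hη, pair_sub_right, pair_smul_right, hT.pair_dag_self hζ, mul_one, sub_self]
  have hη2 : T.pair (hT.dag ζ') (lmap Φ (f - T.pair f α • hT.dag α)) = 1 / 2 * T.pair f ψ := by
    rw [pair_lmap, hζ2', pair_smul_right, pair_sub_left, pair_smul_left, h]
    ring
  have hη3 := hT.eq_smul_of_pair_dag hζ' (hη ▸ hK) (by rw [hu, hη1, zero_add])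
  rw [hu, hη1, hη2, zero_add] at hη3
  have hzero : lmap Φ (f - T.pair f α • hT.dag α - T.pair f ψ • hT.dag ψ) = 0 := by
    rw [lmap_sub, hη3, lmap_smul, hζ1', smul_smul, mul_comm, sub_self]
  have := hT.pair_eq_zero_of_lmap hΦ hzero hσ (by rwa [hΦc])
  rw [pair_sub_left, pair_sub_left, pair_smul_left, pair_smul_left] at this
  linarith

/-- Every functional becomes positive on the purifying system after adding a multiple of the
deterministic effect. -/
theorem exists_inCone_lmap_add (hT : T.IsSharpWithPurification) {Φ : 𝟙_ C ⟶ A ⊗ B}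
    (hΦ : T.InCone Φ) (e : A ⟶ 𝟙_ C) : ∃ r : ℝ, T.InCone (lmap Φ (e + r • hT.disc A)) := by
  suffices h : (∃ r : ℝ, T.InCone (lmap Φ (e + r • hT.disc A))) ∧
      ∃ r : ℝ, T.InCone (lmap Φ (-e + r • hT.disc A)) from h.1
  have he : e ∈ Submodule.span ℝ {f : A ⟶ 𝟙_ C | T.IsTransf f} :=
    hT.isOPT.span_transf A (𝟙_ C) ▸ Submodule.mem_top
  induction he using Submodule.span_induction with
  | mem a ha =>
    refine ⟨⟨0, ?_⟩, 1, ?_⟩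
    · simpa using hT.inCone_lmap hΦ ha
    · have := hT.inCone_lmap hΦ (hT.isEffect_compl ha)
      rwa [one_smul, neg_add_eq_sub]
  | zero => refine ⟨⟨0, ?_⟩, 0, ?_⟩ <;> simpa [lmap] using hT.inCone_zero
  | add a b _ _ ha hb =>
    obtain ⟨⟨r, hr⟩, r', hr'⟩ := ha
    obtain ⟨⟨s, hs⟩, s', hs'⟩ := hb
    refine ⟨⟨r + s, ?_⟩, r' + s', ?_⟩
    · convert hT.inCone_add hr hs using 1
      rw [← lmap_add]
      congr 1
      module
    · convert hT.inCone_add hr' hs' using 1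
      rw [← lmap_add]
      congr 1
      module
  | smul x a _ ha =>
    obtain ⟨⟨r, hr⟩, r', hr'⟩ := ha
    rcases le_total 0 x with hx | hx
    · refine ⟨⟨x * r, ?_⟩, x * r', ?_⟩
      · convert hr.smul hx using 1
        rw [← lmap_smul]
        congr 1
        module
      · convert hr'.smul hx using 1
        rw [← lmap_smul]
        congr 1
        module
    · refine ⟨⟨-x * r', ?_⟩, -x * r, ?_⟩
      · convert hr'.smul (neg_nonneg.2 hx) using 1
        rw [← lmap_smul]
        congr 1
        module
      · convert hr.smul (neg_nonneg.2 hx) using 1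
        rw [← lmap_smul]
        congr 1
        module

/-! ### Symmetry of the pairing of pure states -/

/-- An inner product for which all pure states have the same length is determined on a face of two
orthogonal pure states by the effects of these states. -/
theorem inner_eq (hT : T.IsSharpWithPurification)
    {Q : (𝟙_ C ⟶ A) →ₗ[ℝ] (𝟙_ C ⟶ A) →ₗ[ℝ] ℝ} {N : ℝ}
    (hN : ∀ φ : 𝟙_ C ⟶ A, T.IsPureNormState φ → Q φ φ = N)
    (hle : ∀ φ φ' : 𝟙_ C ⟶ A, T.IsPureNormState φ → T.IsPureNormState φ' → Q φ φ' ≤ N)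
    (hα : T.IsPureNormState α) (hψ : T.IsPureNormState ψ) (h : T.pair (hT.dag α) ψ = 0)
    (hα' : T.IsPureNormState α') (hα'c : T.InCone (α + ψ - α')) :
    Q α α' = N * T.pair (hT.dag α) α' + Q α ψ * (1 - T.pair (hT.dag α) α') := by
  obtain ⟨B, Φ, hΦ, hΦc⟩ := hT.exists_purification (ρ := (1 / 2 : ℝ) • (α + ψ))
    ((hT.inCone_add hα.inCone hψ.inCone).smul (by norm_num)) (by
      rw [pair_smul_right, pair_add_right, hT.pair_disc_pure hα, hT.pair_disc_pure hψ]
      norm_num)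
  have hσ := hα'.inCone.smul (by norm_num : (0 : ℝ) ≤ 1 / 2)
  have hσc : T.InCone ((1 / 2 : ℝ) • (α + ψ) - (1 / 2 : ℝ) • α') := by
    rw [← smul_sub]
    exact hα'c.smul (by norm_num)
  obtain ⟨e, he⟩ := hT.exists_pairR_eq (Q α)
  have heQ : ∀ ξ, T.pair e ξ = Q α ξ := fun ξ => by rw [← he, pairR_apply]
  obtain ⟨r, hr⟩ := hT.exists_inCone_lmap_add hΦ.inCone e
  have h1 := hT.pair_eq_of_max hα hψ h hΦ hΦc hr (fun φ hφ => by
    rw [pair_add_left, pair_add_left, heQ, heQ, pair_smul_left, pair_smul_left,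
      hT.pair_disc_pure hα, hT.pair_disc_pure hφ, hN α hα]
    linarith [hle α φ hα hφ]) hσ hσc
  have h2 := hT.pair_eq_of_max hα hψ h hΦ hΦc
    (hT.inCone_lmap hΦ.inCone (hT.isEffect_disc A)) (fun φ hφ => by
      rw [hT.pair_disc_pure hα, hT.pair_disc_pure hφ]) hσ hσc
  simp only [pair_add_left, pair_smul_left, pair_smul_right, heQ, hT.pair_disc_pure hα,
    hT.pair_disc_pure hψ, hT.pair_disc_pure hα', hN α hα] at h1 h2
  have h3 : T.pair (hT.dag ψ) α' = 1 - T.pair (hT.dag α) α' := by linarith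
  rw [h3] at h1
  linarith

/-- Both sides can be read off from the value at `(α, α')` of an invariant inner product `Q`: the
two complements `ψ`, `κ` of `α`, `α'` in their common face satisfy `Q α ψ = Q α' κ`, because the
norm of `α + ψ = α' + κ` can be computed in two ways. -/
theorem pair_dag_comm (hT : T.IsSharpWithPurification) (hα : T.IsPureNormState α)
    (hα' : T.IsPureNormState α') : T.pair (hT.dag α) α' = T.pair (hT.dag α') α := by
  by_cases hne : α = α'
  · rw [hne]
  obtain ⟨Q, hQs, hQp, hQ⟩ := hT.exists_invariant_inner A
  have hN : ∀ φ : 𝟙_ C ⟶ A, T.IsPureNormState φ → Q φ φ = Q α α := fun φ hφ => by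
    obtain ⟨U, hU, rfl⟩ := hT.exists_reversible_pure hα hφ
    exact hQ U hU α α
  have hsub : ∀ φ φ' : 𝟙_ C ⟶ A, T.IsPureNormState φ → T.IsPureNormState φ' →
      Q (φ - φ') (φ - φ') = 2 * (Q α α - Q φ φ') := fun φ φ' hφ hφ' => by
    simp only [map_sub, LinearMap.sub_apply, hN φ hφ, hN φ' hφ', hQs φ' φ]
    ring
  have hlt : ∀ φ φ' : 𝟙_ C ⟶ A, T.IsPureNormState φ → T.IsPureNormState φ' → φ ≠ φ' →
      Q φ φ' < Q α α := fun φ φ' hφ hφ' h => by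
    have h1 := hQp _ (sub_ne_zero.2 h)
    rw [hsub φ φ' hφ hφ'] at h1
    linarith
  have hle : ∀ φ φ' : 𝟙_ C ⟶ A, T.IsPureNormState φ → T.IsPureNormState φ' →
      Q φ φ' ≤ Q α α := fun φ φ' hφ hφ' => by
    by_cases h : φ = φ'
    · rw [h, hN φ' hφ']
    · exact (hlt φ φ' hφ hφ' h).le
  obtain ⟨ψ, κ, hψ, hκ, hαψ, hακ, hsum⟩ := hT.exists_common_sum hα hα' hne
  have h1 := hT.inner_eq hN hle hα hψ hαψ hα' (by
    rw [hsum, add_sub_cancel_left]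
    exact hκ.inCone)
  have h2 := hT.inner_eq hN hle hα' hκ hακ hα (by
    rw [← hsum, add_sub_cancel_left]
    exact hψ.inCone)
  have h3 : Q α ψ = Q α' κ := by
    have h4 : Q (α + ψ) (α + ψ) = Q (α' + κ) (α' + κ) := by rw [hsum]
    simp only [map_add, LinearMap.add_apply, hN α' hα', hN ψ hψ, hN κ hκ, hQs ψ α,
      hQs κ α'] at h4
    linarith
  have h4 := hlt α ψ hα hψ (by
    rintro rfl
    rw [hT.pair_dag_self hα] at hαψ
    exact one_ne_zero hαψ)
  rw [hQs α' α, h1, ← h3] at h2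
  have h5 : (Q α α - Q α ψ) * (T.pair (hT.dag α) α' - T.pair (hT.dag α') α) = 0 := by
    linarith
  linarith [(mul_eq_zero.1 h5).resolve_left (by linarith)]

/-! ### The dagger -/

/-- By the symmetry of `(α†|α')`, the linear map that agrees with `α ↦ α†` on a basis of pure states
agrees with it on all pure states. -/
theorem exists_linear_dag (hT : T.IsSharpWithPurification) (A : C) :
    ∃ D : (𝟙_ C ⟶ A) →ₗ[ℝ] (A ⟶ 𝟙_ C), ∀ α : 𝟙_ C ⟶ A, T.IsPureNormState α →
      D α = hT.dag α := by
  obtain ⟨s, hs, hspan, hlin⟩ := exists_linearIndependent ℝ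
    {α : 𝟙_ C ⟶ A | T.IsPureNormState α}
  let b : Module.Basis s ℝ (𝟙_ C ⟶ A) := Module.Basis.mk hlin (by
    rw [Subtype.range_coe, hspan, hT.span_pure A])
  have hb : ∀ i : s, b i = i := fun i => by simp [b]
  let D : (𝟙_ C ⟶ A) →ₗ[ℝ] (A ⟶ 𝟙_ C) := b.constr ℝ fun i : s => hT.dag (i : 𝟙_ C ⟶ A)
  refine ⟨D, fun α hα => hT.effect_ext_pure fun φ hφ => ?_⟩
  let L : (𝟙_ C ⟶ A) →ₗ[ℝ] ℝ :=
    { toFun := fun ξ => T.pair (D ξ) φ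
      map_add' := by simp
      map_smul' := by simp }
  have hL : L = T.pairR (hT.dag φ) := b.ext fun i => by
    have h1 : L (b i) = T.pair (hT.dag (i : 𝟙_ C ⟶ A)) φ := by
      change T.pair (D (b i)) φ = _
      rw [b.constr_basis]
    rw [h1, pairR_apply, hb, hT.pair_dag_comm (hs i.2) hφ]
  have h2 : T.pair (D α) φ = T.pair (hT.dag φ) α := LinearMap.congr_fun hL α
  rw [h2, hT.pair_dag_comm hφ hα]

theorem isDagger_iff (hT : T.IsSharpWithPurification) {D : (𝟙_ C ⟶ A) →ₗ[ℝ] (A ⟶ 𝟙_ C)} :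
    T.IsDagger A D ↔ ∀ α : 𝟙_ C ⟶ A, T.IsPureNormState α → D α = hT.dag α := by
  refine ⟨fun h α hα => hT.eq_dag hα (h α hα).1.1 (h α hα).2.1, fun h α hα => ?_⟩
  rw [h α hα]
  exact ⟨⟨hT.isPure_dag hα, hT.effectNorm_eq_one (hT.isPure_dag hα).1 hα.1.1
    (hT.pair_dag_self hα)⟩, hT.pair_dag_self hα, fun b hb h1 => hT.eq_dag hα hb.1 h1⟩

theorem isDagger_dagger (hT : T.IsSharpWithPurification) (A : C) : T.IsDagger A (T.dagger A) := by
  obtain ⟨D, hD⟩ := hT.exists_linear_dag A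
  exact Classical.epsilon_spec (p := T.IsDagger A) ⟨D, hT.isDagger_iff.2 hD⟩

theorem dagger_comp (hT : T.IsSharpWithPurification) {U : A ⟶ B} {V : B ⟶ A}
    (hU : T.IsChannel U) (hV : T.IsChannel V) (h1 : U ≫ V = 𝟙 A) (h2 : V ≫ U = 𝟙 B)
    (ξ : 𝟙_ C ⟶ A) : T.dagger B (ξ ≫ U) = V ≫ T.dagger A ξ := by
  have h3 : (T.dagger B).comp (Linear.rightComp ℝ (𝟙_ C) U) =
      (Linear.leftComp ℝ (𝟙_ C) V).comp (T.dagger A) := hT.linearMap_ext_pure fun α hα => by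
    have h4 := hT.isDagger_iff.1 (hT.isDagger_dagger B) _
      (hT.pure_comp_reversible hα ⟨hU, V, hV, h1, h2⟩)
    have h5 := hT.isDagger_iff.1 (hT.isDagger_dagger A) α hα
    simp only [LinearMap.comp_apply, Linear.rightComp_apply, Linear.leftComp_apply, h4, h5]
    exact hT.dag_comp hα hU hV h1 h2
  exact LinearMap.congr_fun h3 ξ

end IsSharpWithPurification

end Sharp

end ProbTheory

/-- In a sharp theory with purification every system has a unique dagger `ξ ↦ ξ†`, and the inner
product `⟨ξ, η⟩ = (ξ†|η)` is invariant under reversible channels. -/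
theorem mainTheorem8 {C : Type u} [Category.{v} C] [MonoidalCategory C] [SymmetricCategory C]
    [Preadditive C] [Linear ℝ C] [MonoidalPreadditive C] [MonoidalLinear ℝ C]
    (T : ProbTheory C) (hT : T.IsSharpWithPurification) :
    (∀ A : C, T.IsDagger A (T.dagger A) ∧
      ∀ D : (𝟙_ C ⟶ A) →ₗ[ℝ] (A ⟶ 𝟙_ C), T.IsDagger A D → D = T.dagger A) ∧
    ∀ (A B : C) (U : A ⟶ B), T.IsReversible U → ∀ ξ η : 𝟙_ C ⟶ A,
      T.daggerInner (ξ ≫ U) (η ≫ U) = T.daggerInner ξ η := by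
  refine ⟨fun A => ⟨hT.isDagger_dagger A, fun D hD => hT.linearMap_ext_pure fun α hα => ?_⟩, ?_⟩
  · rw [hT.isDagger_iff.1 hD α hα, hT.isDagger_iff.1 (hT.isDagger_dagger A) α hα]
  · rintro A B U ⟨hU, V, hV, h1, h2⟩ ξ η
    rw [ProbTheory.daggerInner, hT.dagger_comp hU hV h1 h2, ProbTheory.pair_comp, Category.assoc,
      h1, Category.comp_id, ProbTheory.daggerInner]
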